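/- For real-valued $f\in L^2(\mathbb R)$ write $\hat f(k)=\frac1{2\pi}\int_{\mathbb R}f(\theta)e^{-ik\theta}\,d\theta$ (extended to $L^2$ by Plancherel), and set $$\|f\|_{\sigma}=\Big(\int_{\mathbb R}|k|^{2\sigma}|\hat f(k)|^2\,dk\Big)^{1/2}\in[0,\infty],\qquad \|f\|_{H^\sigma}=\Big(\int_{\mathbb R}(1+|k|^{2\sigma})|\hat f(k)|^2\,dk\Big)^{1/2}\quad(\sigma\ge0);$$ $H^\sigma(\mathbb R)$ is the space of real-valued $f\in L^2(\mathbb R)$ with $\|f\|_{H^\sigma}<\infty$. Let $$\Lambda(k,\ell)=\frac{2|k+\ell|\,|k|\,|\ell|}{|k+\ell|+|k|+|\ell|},\qquad S(k,\ell)=\frac{\Lambda(k,\ell)}{|k\ell(k+\ell)|^{1/2}},$$ with $S(k,\ell)=0$ if $k\ell(k+\ell)=0$, and let the bilinear form $a$ be given by $$\widehat{a(\psi,\phi)}(k)=\int_{\mathbb R}S(k-\ell,\ell)\,\hat\psi(k-\ell)\,\hat\phi(\ell)\,d\ell .$$ For $s>2$ and an interval $I$, an $H^s$ solution on $I$ of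 the noncanonical equation $$\partial_\tau\psi+\partial_\theta a(\psi,\psi)=0 \qquad (\ast)$$ is a function $\psi\in C(I;H^s(\mathbb R))\cap C^1(I;H^{s-1}(\mathbb R))$ such that $(\ast)$ holds at every time in $I$, that is, $\partial_\tau\hat\psi(k,\tau)+ik\,\widehat{a(\psi,\psi)}(k,\tau)=0$ for almost every $k\in\mathbb R$. **Lemma.** Let $s>2$ and $0<T<\infty$, and let $\psi$ be an $H^s$ solution of $(\ast)$ on $[0,T)$. If $$\int_0^T\|\psi(\cdot,\tau)\|_{s'}^{2/s'}\,d\tau<\infty$$ for some real $s'>2$, then $\psi$ can be continued beyond $T$: there are $T'>T$ and an $H^s$ solution of $(\ast)$ on $[0,T')$ which coincides with $\psi$ on $[0,T)$. -/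

import Mathlib

open MeasureTheory Filter Topology FourierTransform
open scoped ENNReal

namespace SurfaceWave

noncomputable section

/-- Real-valued square integrable functions on the line. -/
abbrev L2R : Type := Lp ℝ 2 (volume : Measure ℝ)

/-- The Fourier transform `f̂(k) = (1 / 2π) ∫ f(θ) exp(-i k θ) dθ` of a real-valued `f ∈ L²(ℝ)`
(Plancherel extension). Mathlib's `𝓕` has the phase `exp(-2π i ξ θ)` and no prefactor, so that
`f̂(k) = (1 / 2π) (𝓕 f)(k / 2π)`. As usual it is determined up to a null set. -/
def hat (f : L2R) (k : ℝ) : ℂ :=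
  ((1 / (2 * Real.pi) : ℝ) : ℂ) *
    (𝓕 (Complex.ofRealCLM.compLp f) : Lp ℂ 2 (volume : Measure ℝ)) (k / (2 * Real.pi))

/-- The homogeneous norm `(∫ |k|^{2s} |f̂(k)|² dk)^{1/2}`, with value `∞` off `Ḣ^s`. -/
def homNorm (s : ℝ) (f : L2R) : ℝ≥0∞ :=
  (∫⁻ k : ℝ, ENNReal.ofReal (|k| ^ (2 * s)) * ‖hat f k‖ₑ ^ 2) ^ (1 / 2 : ℝ)

/-- The norm `(∫ (1 + |k|^{2s}) |f̂(k)|² dk)^{1/2}` of `H^s(ℝ)`, `s ≥ 0`, with value `∞` off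
`H^s`. -/
def sobNorm (s : ℝ) (f : L2R) : ℝ≥0∞ :=
  (∫⁻ k : ℝ, ENNReal.ofReal (1 + |k| ^ (2 * s)) * ‖hat f k‖ₑ ^ 2) ^ (1 / 2 : ℝ)

/-- Membership in the space `H^s(ℝ)` of real-valued functions, `s ≥ 0`. -/
def MemSob (s : ℝ) (f : L2R) : Prop := sobNorm s f < ∞

/-- `u ∈ C(I; H^s)`. -/
def ContSob (s : ℝ) (I : Set ℝ) (u : ℝ → L2R) : Prop :=
  ∀ t ∈ I, MemSob s (u t) ∧ Tendsto (fun r => sobNorm s (u r - u t)) (𝓝[I] t) (𝓝 0)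

/-- `v(t)` is the derivative of `u` at every `t ∈ I`, as a limit in `H^s` of difference quotients
with times in `I` (one-sided at an endpoint that belongs to `I`). -/
def HasTimeDeriv (s : ℝ) (I : Set ℝ) (u v : ℝ → L2R) : Prop :=
  ∀ t ∈ I, Tendsto (fun r => sobNorm s ((r - t)⁻¹ • (u r - u t) - v t)) (𝓝[I \ {t}] t) (𝓝 0)

/-- The kernel `Λ(k, ℓ) = 2 |k + ℓ| |k| |ℓ| / (|k + ℓ| + |k| + |ℓ|)`. -/
def kerLambda (k l : ℝ) : ℝ :=
  2 * |k + l| * |k| * |l| / (|k + l| + |k| + |l|)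

/-- The kernel `S(k, ℓ) = Λ(k, ℓ) / |k ℓ (k + ℓ)|^{1/2}`, and `S(k, ℓ) = 0` if `k ℓ = 0`.
(On `k + ℓ = 0` the numerator vanishes, and the value is `0`, the continuous extension.) -/
def kerS (k l : ℝ) : ℝ :=
  if k * l = 0 then 0 else kerLambda k l / Real.sqrt |k * l * (k + l)|

/-- The Fourier transform `k ↦ ∫ S(k - ℓ, ℓ) f̂(k - ℓ) ĝ(ℓ) dℓ` of the bilinear form `a(f, g)`. -/
def bilinHat (f g : L2R) (k : ℝ) : ℂ :=
  ∫ l : ℝ, (kerS (k - l) l : ℂ) * hat f (k - l) * hat g l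

/-- `ψ` is an `H^s` solution on the time interval `I` of `∂_τ ψ + ∂_θ a(ψ, ψ) = 0`:
`ψ ∈ C(I; H^s) ∩ C¹(I; H^{s-1})`, and at every time in `I` the equation holds, on the Fourier side
`∂_τ ψ̂(k) + i k ∫ S(k - ℓ, ℓ) ψ̂(k - ℓ) ψ̂(ℓ) dℓ = 0`. -/
def IsSolution (s : ℝ) (I : Set ℝ) (ψ : ℝ → L2R) : Prop :=
  ContSob s I ψ ∧
    ∃ ψ' : ℝ → L2R, ContSob (s - 1) I ψ' ∧ HasTimeDeriv (s - 1) I ψ ψ' ∧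
      ∀ t ∈ I, ∀ᵐ k : ℝ,
        hat (ψ' t) k + Complex.I * (k : ℂ) * bilinHat (ψ t) (ψ t) k = 0

end

end SurfaceWave

namespace SurfaceWave

noncomputable section

/-! ### The interaction kernel -/

/-! On triples x + y + z = 0 the kernel is a symmetric function of |x|, |y|, |z| and is at most the
square root of each of them. Let w be an even weight, nondecreasing in |k|, of growth exponent p.
Symmetrizing the time derivative of ∫ w |ψ̂|² over the three frequencies produces the kernel (w(x) x
+ w(y) y + w(z) z) S(x, y). For w = 1 it vanishes, so the L² norm is conserved. In general the two
large frequencies almost cancel and a factor of the smallest one, say x, is left: the kernel is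
O(|x|^{3/2} √(w(y) w(z))) (`IsWeight.commutator`). Hence the logarithmic growth rate of ∫ w |ψ̂|² is
at most a constant depending on p alone times the weighted Wiener norm ∫ |k|^{3/2} |ψ̂|
(`abs_inner_sqrtMul_bil_le`); no derivative is lost.

A scaling argument bounds this Wiener norm by ‖ψ‖_{s'}^{2/s'} times a constant depending on s' and
the conserved L² norm (`wiener_le_homNorm`), so the hypothesis makes it integrable on (0, T).
Grönwall then controls all weighted energies of a given exponent at once. The weight 1 + |k|^{2s}
bounds the H^s norm; the same weight damped at low frequencies makes the high-frequency tails
uniformly small. The time derivative is bounded in L², so ψ has an L² limit at T, and the uniform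
tails turn this into convergence in H^s (`tendsto_enE_of_tail`, `IsStrongSol.exists_extension`).

A local solution starting from the limit is glued on. It comes from Galerkin approximations
(`exists_local_solution`): they obey the same energy and tail estimates uniformly in the cut-off,
and they are Cauchy in L² because in the equation for a difference the derivative can be moved off
the difference (`abs_inner_bil_le`). Throughout, weights are truncated so that √w is a bounded
multiplier on L²; truncation keeps p, hence the constants, and is removed by Fatou's lemma
(`enE_le_of_trunc`). -/

lemma kerS_eq (k l : ℝ) :
    kerS k l = 2 * Real.sqrt (|k| * |l| * |k + l|) / (|k + l| + |k| + |l|) := by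
  unfold kerS kerLambda
  -- For k l = 0 the radicand vanishes as well, and k + l = 0 is covered by x / √x = √x at x = 0.
  -- The closed form therefore has no exceptional set.
  split_ifs with h
  · have : |k| * |l| = 0 := by rw [← abs_mul, h, abs_zero]
    simp [this]
  · rw [abs_mul, abs_mul]
    have h2 : 2 * |k + l| * |k| * |l| = 2 * (|k| * |l| * |k + l|) := by ring
    rw [h2, div_right_comm, mul_div_assoc, Real.div_sqrt]

lemma kerS_nonneg (k l : ℝ) : 0 ≤ kerS k l := by
  rw [kerS_eq]; positivity

lemma kerS_comm (k l : ℝ) : kerS k l = kerS l k := by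
  rw [kerS_eq, kerS_eq, mul_comm |k| |l|, add_comm k l]; congr 1; ring

lemma kerS_neg_neg (k l : ℝ) : kerS (-k) (-l) = kerS k l := by
  rw [kerS_eq, kerS_eq, ← neg_add]; simp only [abs_neg]

/-- The third frequency of the triple replaces k. Together with `kerS_comm` and evenness this makes
the kernel invariant under all permutations of a triple of zero sum. -/
lemma kerS_neg_add_left (k l : ℝ) : kerS (-k - l) l = kerS k l := by
  have e : |-k - l| = |k + l| := by rw [← abs_neg]; ring_nf
  rw [kerS_eq, kerS_eq, sub_add_cancel, abs_neg, e]; ring_nf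

/-- By the inequality of means, 2 √|l| √|k + l| is at most |l| + |k + l|, which the denominator
absorbs; √|k| remains. -/
lemma kerS_le_sqrt_left (k l : ℝ) : kerS k l ≤ Real.sqrt |k| := by
  rw [kerS_eq]
  have h1 : Real.sqrt (|k| * |l| * |k + l|)
      = Real.sqrt |k| * (Real.sqrt |l| * Real.sqrt |k + l|) := by
    rw [mul_assoc, Real.sqrt_mul (abs_nonneg _), Real.sqrt_mul (abs_nonneg _)]
  have h2 := Real.sq_sqrt (abs_nonneg l)
  have h3 := Real.sq_sqrt (abs_nonneg (k + l))
  have h4 := sq_nonneg (Real.sqrt |l| - Real.sqrt |k + l|)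
  apply div_le_of_le_mul₀ (by positivity) (by positivity)
  rw [h1]
  have h5 : 2 * (Real.sqrt |l| * Real.sqrt |k + l|) ≤ |k + l| + |k| + |l| := by
    nlinarith [abs_nonneg k]
  nlinarith [Real.sqrt_nonneg |k|]

lemma kerS_le_sqrt_right (k l : ℝ) : kerS k l ≤ Real.sqrt |l| := by
  rw [kerS_comm]; exact kerS_le_sqrt_left l k

@[fun_prop]
lemma measurable_kerS : Measurable (fun p : ℝ × ℝ => kerS p.1 p.2) := by
  simp_rw [kerS_eq]
  fun_prop

lemma abs_mul_kerS_le (k l : ℝ) : |k| * kerS k l ≤ |k| ^ (3 / 2 : ℝ) := by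
  have h : |k| ^ (3 / 2 : ℝ) = |k| * Real.sqrt |k| := by
    rcases eq_or_lt_of_le (abs_nonneg k) with h | h
    · rw [← h]; simp
    · rw [Real.sqrt_eq_rpow, show (3 / 2 : ℝ) = 1 + 1 / 2 by norm_num, Real.rpow_add h,
        Real.rpow_one]
  rw [h]
  exact mul_le_mul_of_nonneg_left (kerS_le_sqrt_left k l) (abs_nonneg k)

/-! ### Admissible weights -/

/-- Even weights, nondecreasing in `|x|`, that grow at most like a power `p`. -/
structure IsWeight (p : ℝ) (w : ℝ → ℝ) : Prop where
  nonneg : ∀ x, 0 ≤ w x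
  mono : ∀ {x y}, |x| ≤ |y| → w x ≤ w y
  growth : ∀ {c} (x), 1 ≤ c → w (c * x) ≤ c ^ p * w x

namespace IsWeight

variable {p q : ℝ} {v w : ℝ → ℝ}

lemma even (h : IsWeight p w) (x : ℝ) : w (-x) = w x :=
  le_antisymm (h.mono (abs_neg x).le) (h.mono (abs_neg x).ge)

lemma measurable (h : IsWeight p w) : Measurable w := by
  have h1 : Monotone (fun x => w (max x 0)) := fun x y hxy => h.mono (by
    rw [abs_of_nonneg (le_max_right _ _), abs_of_nonneg (le_max_right _ _)]
    exact max_le_max_right _ hxy)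
  have h2 : w = (fun x => w (max x 0)) ∘ (fun x => |x|) := by
    funext x
    have : max |x| 0 = |x| := max_eq_left (abs_nonneg x)
    simp only [Function.comp, this]
    exact le_antisymm (h.mono (abs_abs x).ge) (h.mono (abs_abs x).le)
  rw [h2]
  exact h1.measurable.comp measurable_norm

lemma one (hp : 0 ≤ p) : IsWeight p (fun _ => 1) where
  nonneg _ := zero_le_one
  mono _ := le_rfl
  growth _ hc := by simpa using Real.one_le_rpow hc hp

lemma rpow (hp : 0 ≤ p) : IsWeight p (fun x => |x| ^ p) where
  nonneg x := by positivity
  mono h := Real.rpow_le_rpow (abs_nonneg _) h hp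
  growth {c} x hc := by
    have : 0 ≤ c := by linarith
    rw [abs_mul, abs_of_nonneg this, Real.mul_rpow this (abs_nonneg x)]

lemma add (hv : IsWeight p v) (hw : IsWeight p w) : IsWeight p (fun x => v x + w x) where
  nonneg x := add_nonneg (hv.nonneg x) (hw.nonneg x)
  mono h := add_le_add (hv.mono h) (hw.mono h)
  growth x hc := by
    have := hv.growth x hc
    have := hw.growth x hc
    rw [mul_add]; linarith

lemma mul (hv : IsWeight p v) (hw : IsWeight q w) : IsWeight (p + q) (fun x => v x * w x) where
  nonneg x := mul_nonneg (hv.nonneg x) (hw.nonneg x)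
  mono h := mul_le_mul (hv.mono h) (hw.mono h) (hw.nonneg _) (hv.nonneg _)
  growth {c} x hc := by
    have h0 : 0 < c := by linarith
    calc v (c * x) * w (c * x) ≤ (c ^ p * v x) * (c ^ q * w x) :=
          mul_le_mul (hv.growth x hc) (hw.growth x hc) (hw.nonneg _)
            (mul_nonneg (by positivity) (hv.nonneg _))
      _ = c ^ (p + q) * (v x * w x) := by rw [Real.rpow_add h0]; ring

/-- The exponent p does not depend on ρ, so constants depending only on p are uniform over the
bounded truncations. -/
lemma trunc (hw : IsWeight p w) {ρ : ℝ} (hρ : 0 ≤ ρ) :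
    IsWeight p (fun x => w (min |x| ρ)) where
  nonneg x := hw.nonneg _
  mono {x y} h := hw.mono (by
    rw [abs_of_nonneg (le_min (abs_nonneg x) hρ), abs_of_nonneg (le_min (abs_nonneg y) hρ)]
    exact min_le_min_right _ h)
  growth {c} x hc := by
    have h0 : 0 < c := by linarith
    refine (hw.mono ?_).trans (hw.growth _ hc)
    have h1 : 0 ≤ min |x| ρ := le_min (abs_nonneg x) hρ
    rw [abs_of_nonneg (le_min (abs_nonneg _) hρ), abs_of_nonneg (mul_nonneg h0.le h1),
      mul_min_of_nonneg _ _ h0.le, abs_mul, abs_of_pos h0]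
    exact min_le_min_left _ (by nlinarith)

lemma trunc_le (hw : IsWeight p w) {ρ : ℝ} (hρ : 0 ≤ ρ) (x : ℝ) : w (min |x| ρ) ≤ w x :=
  hw.mono (by
    rw [abs_of_nonneg (le_min (abs_nonneg x) hρ)]; exact min_le_left _ _)

lemma trunc_le_const (hw : IsWeight p w) {ρ : ℝ} (hρ : 0 ≤ ρ) (x : ℝ) : w (min |x| ρ) ≤ w ρ :=
  hw.mono (by
    rw [abs_of_nonneg (le_min (abs_nonneg x) hρ), abs_of_nonneg hρ]; exact min_le_right _ _)

lemma apply_abs (hw : IsWeight p w) (x : ℝ) : w |x| = w x :=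
  le_antisymm (hw.mono (abs_abs x).le) (hw.mono (abs_abs x).ge)

lemma trunc_eq (hw : IsWeight p w) {ρ x : ℝ} (h : |x| ≤ ρ) : w (min |x| ρ) = w x := by
  rw [min_eq_left h, hw.apply_abs]

/-- Factor that damps frequencies below R; it costs one unit of growth exponent, whatever R is. -/
lemma ramp {R : ℝ} (hR : 0 < R) : IsWeight 1 (fun x => min (|x| / R) 1) where
  nonneg x := by positivity
  mono h := min_le_min_right _ (by gcongr)
  growth {c} x hc := by
    have h0 : 0 < c := by linarith
    rw [Real.rpow_one, mul_min_of_nonneg _ _ h0.le, abs_mul, abs_of_pos h0, mul_div_assoc, mul_one]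
    exact min_le_min_left _ hc

/-! ### Cancellation in the symmetrized kernel -/

/-- Up to sign, the quantity is b (w(a+b) - w(b)) + a (w(a+b) - w(a)). Growth with c = 1 + a/b makes
the first difference O(a/b) w(b), so the factor b is traded for the smaller a. -/
lemma commutator_of_nonneg (hp : 1 ≤ p) (hw : IsWeight p w) {a b : ℝ} (ha : 0 ≤ a) (hab : a ≤ b) :
    |w a * a + w b * b - w (a + b) * (a + b)|
      ≤ 2 * 2 ^ p * (a * Real.sqrt (w b * w (a + b))) := by
  have hb : 0 ≤ b := ha.trans hab
  rcases eq_or_lt_of_le hb with hb0 | hb0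
  · have : a = 0 := by linarith
    simp [this, ← hb0]
  have h2p : (1 : ℝ) ≤ 2 ^ p := Real.one_le_rpow (by norm_num) (by linarith)
  have m1 : w a ≤ w (a + b) := hw.mono (by
    rw [abs_of_nonneg ha, abs_of_nonneg (by linarith)]; linarith)
  have m2 : w b ≤ w (a + b) := hw.mono (by
    rw [abs_of_nonneg hb, abs_of_nonneg (by linarith)]; linarith)
  have n1 := hw.nonneg a
  have n2 := hw.nonneg b
  set t := a / b with ht
  have ht0 : 0 ≤ t := by positivity
  have ht1 : t ≤ 1 := by rw [ht, div_le_one hb0]; exact hab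
  have hat : a = t * b := by rw [ht]; field_simp
  have hg : w (a + b) ≤ (1 + t) ^ p * w b := by
    have := hw.growth b (c := 1 + t) (by linarith)
    rwa [show (1 + t) * b = a + b by rw [add_mul, ← hat]; ring] at this
  -- Chord of the convex function x ↦ x ^ p between 1 and 2; this uses p ≥ 1.
  have hconv : (1 + t) ^ p ≤ 1 + (2 ^ p - 1) * t := by
    have := (convexOn_rpow hp).2 (show (1 : ℝ) ∈ Set.Ici 0 by simp)
      (show (2 : ℝ) ∈ Set.Ici 0 by simp) (sub_nonneg.2 ht1) ht0 (by ring)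
    simp only [smul_eq_mul, Real.one_rpow, mul_one] at this
    rw [show 1 - t + t * 2 = 1 + t by ring] at this
    linarith
  have hg2 : w (a + b) ≤ w b + (2 ^ p) * t * w b := by nlinarith [mul_nonneg ht0 n2]
  have hg3 : w (a + b) ≤ 2 ^ p * w b := by
    refine hg.trans (mul_le_mul_of_nonneg_right ?_ n2)
    exact Real.rpow_le_rpow (by linarith) (by linarith) (by linarith)
  have hs1 : w b ≤ Real.sqrt (w b * w (a + b)) := Real.le_sqrt_of_sq_le (by nlinarith)
  have hneg : w a * a + w b * b - w (a + b) * (a + b) ≤ 0 := by nlinarith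
  rw [abs_of_nonpos hneg]
  have h5 : b * (w (a + b) - w b) ≤ 2 ^ p * (a * w b) := by
    calc b * (w (a + b) - w b) ≤ b * (2 ^ p * t * w b) := by gcongr; linarith
      _ = 2 ^ p * (a * w b) := by rw [hat]; ring
  have h6 : a * (w (a + b) - w a) ≤ 2 ^ p * (a * w b) := by nlinarith
  have h7 : 2 ^ p * (a * w b) ≤ 2 ^ p * (a * Real.sqrt (w b * w (a + b))) := by gcongr
  linarith

/-- The sum dominating the symmetrized weighted kernel. -/
def triSum (w : ℝ → ℝ) (x y z : ℝ) : ℝ :=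
  |x| ^ (3 / 2 : ℝ) * Real.sqrt (w y * w z) + |y| ^ (3 / 2 : ℝ) * Real.sqrt (w x * w z)
    + |z| ^ (3 / 2 : ℝ) * Real.sqrt (w x * w y)

lemma triSum_swap12 (w : ℝ → ℝ) (x y z : ℝ) : triSum w x y z = triSum w y x z := by
  unfold triSum; rw [mul_comm (w x) (w y)]; ring

lemma triSum_swap23 (w : ℝ → ℝ) (x y z : ℝ) : triSum w x y z = triSum w x z y := by
  unfold triSum; rw [mul_comm (w y) (w z)]; ring

/-- Here x and y cannot have opposite signs, since otherwise |z| = |x + y| would be smaller than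
|y|. Up to a reflection the triple is therefore a, b, -(a + b) with 0 ≤ a ≤ b. A single term of
`triSum` suffices; the full sum is kept because it is symmetric. -/
lemma commutator_aux (hp : 1 ≤ p) (hw : IsWeight p w) {x y z : ℝ} (h : x + y + z = 0)
    (h1 : |x| ≤ |y|) (h2 : |y| ≤ |z|) :
    |w x * x + w y * y + w z * z| * kerS x y ≤ 2 * 2 ^ p * triSum w x y z := by
  have key : |w x * x + w y * y + w z * z| ≤ 2 * 2 ^ p * (|x| * Real.sqrt (w y * w z)) := by
    wlog hy : 0 ≤ y generalizing x y z
    · have := this (x := -x) (y := -y) (z := -z) (by linarith) (by simpa using h1)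
        (by simpa using h2) (by linarith)
      rw [hw.even, hw.even, hw.even, abs_neg] at this
      convert! this using 1
      rw [← abs_neg]; ring_nf
    have hx : 0 ≤ x := by
      by_contra hx
      rw [abs_of_nonneg hy, abs_of_neg (not_le.1 hx)] at h1
      have : |z| = x + y := by rw [show z = -(x + y) by linarith, abs_neg, abs_of_nonneg (by linarith)]
      rw [abs_of_nonneg hy] at h2
      linarith
    rw [abs_of_nonneg hx, abs_of_nonneg hy] at h1
    have := commutator_of_nonneg hp hw hx h1
    have hz : z = -(x + y) := by linarith
    rw [hz, hw.even, abs_of_nonneg hx]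
    convert! this using 2
    ring
  calc |w x * x + w y * y + w z * z| * kerS x y
      ≤ 2 * 2 ^ p * (|x| * Real.sqrt (w y * w z)) * kerS x y :=
        mul_le_mul_of_nonneg_right key (kerS_nonneg _ _)
    _ = 2 * 2 ^ p * ((|x| * kerS x y) * Real.sqrt (w y * w z)) := by ring
    _ ≤ 2 * 2 ^ p * (|x| ^ (3 / 2 : ℝ) * Real.sqrt (w y * w z)) := by
        gcongr; exact abs_mul_kerS_le x y
    _ ≤ 2 * 2 ^ p * triSum w x y z := by
        gcongr; unfold triSum; rw [add_assoc]; exact le_add_of_nonneg_right (by positivity)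

/-- Both sides are symmetric in x, y, z, so the frequencies may be sorted by modulus. -/
lemma commutator (hp : 1 ≤ p) (hw : IsWeight p w) {x y z : ℝ} (h : x + y + z = 0) :
    |w x * x + w y * y + w z * z| * kerS x y ≤ 2 * 2 ^ p * triSum w x y z := by
  have e1 : ∀ x y z : ℝ, w x * x + w y * y + w z * z = w y * y + w x * x + w z * z := by
    intros; ring
  have e2 : ∀ x y z : ℝ, w x * x + w y * y + w z * z = w x * x + w z * z + w y * y := by
    intros; ring
  have k2 : ∀ x y z : ℝ, x + y + z = 0 → kerS x y = kerS x z := by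
    intro x y z h
    rw [kerS_comm, ← kerS_neg_add_left, show -y - x = z by linarith, kerS_comm]
  wlog hxy : |x| ≤ |y| generalizing x y z
  · have := this (x := y) (y := x) (z := z) (by linarith) (le_of_not_ge hxy)
    rwa [e1, kerS_comm, triSum_swap12] at this
  rcases le_total |y| |z| with hyz | hyz
  · exact commutator_aux hp hw h hxy hyz
  rcases le_total |x| |z| with hxz | hxz
  · have := commutator_aux hp hw (x := x) (y := z) (z := y) (by linarith) hxz hyz
    rwa [e2, triSum_swap23, ← k2 x y z h] at this
  · have := commutator_aux hp hw (x := z) (y := x) (z := y) (by linarith) hxz hxy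
    rwa [e1, e2, triSum_swap12, triSum_swap23, kerS_comm, ← k2 x y z h] at this

end IsWeight

/-! ### Cauchy–Schwarz, Young and trilinear bounds for nonnegative functions -/

lemma lintegral_mul_sq_le {α : Type*} [MeasurableSpace α] {μ : Measure α} {f g : α → ℝ≥0∞}
    (hf : AEMeasurable f μ) (hg : AEMeasurable g μ) :
    (∫⁻ x, f x * g x ∂μ) ^ 2 ≤ (∫⁻ x, f x ^ 2 ∂μ) * ∫⁻ x, g x ^ 2 ∂μ := by
  have h := ENNReal.lintegral_mul_le_Lp_mul_Lq μ Real.HolderConjugate.two_two hf hg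
  calc (∫⁻ x, f x * g x ∂μ) ^ 2
      ≤ ((∫⁻ x, f x ^ (2 : ℝ) ∂μ) ^ (1 / 2 : ℝ) * (∫⁻ x, g x ^ (2 : ℝ) ∂μ) ^ (1 / 2 : ℝ)) ^ 2 :=
        pow_le_pow_left' h 2
    _ = _ := by
        rw [mul_pow, ← ENNReal.rpow_natCast, ← ENNReal.rpow_natCast, ← ENNReal.rpow_mul,
          ← ENNReal.rpow_mul]
        norm_num

/-- Young's inequality L² ∗ L¹ → L²: Cauchy–Schwarz against the measure g(l) dl, then Tonelli. -/
lemma lintegral_conv_sq_le {f g : ℝ → ℝ≥0∞} (hf : Measurable f) (hg : Measurable g) :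
    ∫⁻ k, (∫⁻ l, f (k - l) * g l) ^ 2 ≤ (∫⁻ x, f x ^ 2) * (∫⁻ x, g x) ^ 2 := by
  have hh : Measurable (fun l => (g l) ^ (1 / 2 : ℝ)) := hg.pow_const _
  have hsq : ∀ a : ℝ≥0∞, (a ^ (1 / 2 : ℝ)) ^ 2 = a := by
    intro a; rw [← ENNReal.rpow_natCast, ← ENNReal.rpow_mul]; norm_num
  have h1 : ∀ k, (∫⁻ l, f (k - l) * g l) ^ 2 ≤ (∫⁻ l, f (k - l) ^ 2 * g l) * ∫⁻ l, g l := by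
    intro k
    have := lintegral_mul_sq_le (μ := volume) (f := fun l => f (k - l) * (g l) ^ (1 / 2 : ℝ))
      (g := fun l => (g l) ^ (1 / 2 : ℝ)) (by fun_prop) (by fun_prop)
    simp only [mul_pow, mul_assoc, ← sq, hsq] at this
    exact this
  calc ∫⁻ k, (∫⁻ l, f (k - l) * g l) ^ 2
      ≤ ∫⁻ k, (∫⁻ l, f (k - l) ^ 2 * g l) * ∫⁻ l, g l := lintegral_mono h1
    _ = (∫⁻ k, ∫⁻ l, f (k - l) ^ 2 * g l) * ∫⁻ l, g l := by
        rw [lintegral_mul_const _ (Measurable.lintegral_prod_right' (f := fun p : ℝ × ℝ =>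
          f (p.1 - p.2) ^ 2 * g p.2) (by fun_prop))]
    _ = (∫⁻ l, ∫⁻ k, f (k - l) ^ 2 * g l) * ∫⁻ l, g l := by
        rw [lintegral_lintegral_swap (by fun_prop)]
    _ = (∫⁻ x, f x ^ 2) * (∫⁻ x, g x) ^ 2 := by
        have : ∀ l, ∫⁻ k, f (k - l) ^ 2 * g l = (∫⁻ x, f x ^ 2) * g l := by
          intro l
          rw [lintegral_mul_const _ (by fun_prop),
            lintegral_sub_right_eq_self (fun x => f x ^ 2) l]
        simp_rw [this]
        rw [lintegral_const_mul _ hg, sq, mul_assoc]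

/-- Cauchy–Schwarz bounds the inner integral uniformly in x, which leaves the L¹ norm of f. -/
lemma lintegral_trilinear_sq_le {f g h : ℝ → ℝ≥0∞} (hf : Measurable f) (hg : Measurable g)
    (hh : Measurable h) :
    (∫⁻ x, ∫⁻ y, f x * (g y * h (-x - y))) ^ 2
      ≤ (∫⁻ x, f x) ^ 2 * ((∫⁻ x, g x ^ 2) * ∫⁻ x, h x ^ 2) := by
  set c := ((∫⁻ x, g x ^ 2) * ∫⁻ x, h x ^ 2) ^ (1 / 2 : ℝ) with hc
  have hsq : c ^ 2 = (∫⁻ x, g x ^ 2) * ∫⁻ x, h x ^ 2 := by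
    rw [hc, ← ENNReal.rpow_natCast, ← ENNReal.rpow_mul]; norm_num
  have h1 : ∀ x, ∫⁻ y, g y * h (-x - y) ≤ c := by
    intro x
    have := lintegral_mul_sq_le (μ := volume) (f := g) (g := fun y => h (-x - y))
      (by fun_prop) (by fun_prop)
    rw [lintegral_sub_left_eq_self (fun y => h y ^ 2) (-x), ← hsq] at this
    exact (ENNReal.pow_le_pow_left_iff two_ne_zero).1 this
  rw [← hsq, ← mul_pow]
  refine pow_le_pow_left' ?_ 2
  calc ∫⁻ x, ∫⁻ y, f x * (g y * h (-x - y)) = ∫⁻ x, f x * ∫⁻ y, g y * h (-x - y) := by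
        congr 1; funext x; rw [lintegral_const_mul _ (by fun_prop)]
    _ ≤ ∫⁻ x, f x * c := by gcongr with x; exact h1 x
    _ = (∫⁻ x, f x) * c := lintegral_mul_const _ hf

/-! ### Weighted norms and the convolution on the Fourier side -/

/-- The weighted square integral `∫ w |g|²`. -/
def energy (w : ℝ → ℝ) (g : ℝ → ℂ) : ℝ≥0∞ := ∫⁻ k, ENNReal.ofReal (w k) * ‖g k‖ₑ ^ 2

/-- The weighted `L¹` norm `∫ |k|^r |g|`. -/
def wiener (r : ℝ) (g : ℝ → ℂ) : ℝ≥0∞ := ∫⁻ k, ENNReal.ofReal (|k| ^ r) * ‖g k‖ₑ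

/-- The weight of `H^s`. -/
def sobWeight (s : ℝ) (k : ℝ) : ℝ := 1 + |k| ^ (2 * s)

/-- The Fourier transform of the bilinear form, for given Fourier transforms. -/
def kconv (g h : ℝ → ℂ) (k : ℝ) : ℂ := ∫ l : ℝ, (kerS (k - l) l : ℂ) * g (k - l) * h l

/-- Hermitian functions, the Fourier transforms of real-valued functions. -/
def Herm (g : ℝ → ℂ) : Prop := ∀ k, g (-k) = starRingEnd ℂ (g k)

lemma isWeight_sobWeight {s : ℝ} (hs : 0 ≤ s) : IsWeight (2 * s) (sobWeight s) :=
  (IsWeight.one (by linarith)).add (IsWeight.rpow (by linarith))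

lemma one_le_sobWeight (s k : ℝ) : 1 ≤ sobWeight s k := by
  unfold sobWeight
  exact le_add_of_nonneg_right (by positivity)

@[fun_prop]
lemma measurable_sobWeight (s : ℝ) : Measurable (sobWeight s) := by
  unfold sobWeight; fun_prop

/-! ### Weighted `L¹` norms -/

/-- The weight is comparable to (1 + |k|)^{2s}, so the integrand decays with exponent 2s - 2r; the
hypothesis says that this exceeds the dimension 1. -/
lemma lintegral_rpow_div_sobWeight_lt_top {r s : ℝ} (hr : 0 ≤ r) (hrs : r + 1 / 2 < s) :
    ∫⁻ k, ENNReal.ofReal (|k| ^ (2 * r) / sobWeight s k) < ∞ := by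
  have h1 : Integrable (fun x : ℝ => (2 : ℝ) ^ (2 * s) * (1 + ‖x‖) ^ (-(2 * s - 2 * r))) :=
    (integrable_one_add_norm (by simp; linarith)).const_mul _
  refine lt_of_le_of_lt (lintegral_mono fun k => ENNReal.ofReal_le_ofReal ?_)
    h1.lintegral_lt_top
  have h0 : 0 ≤ |k| := abs_nonneg k
  have hp : (0 : ℝ) < 1 + |k| := by linarith
  have h2 : (1 + |k|) ^ (2 * s) ≤ 2 ^ (2 * s) * sobWeight s k := by
    have hm : (1 + |k|) ≤ 2 * max 1 |k| := by
      have := le_max_left 1 |k|; have := le_max_right 1 |k|; linarith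
    calc (1 + |k|) ^ (2 * s) ≤ (2 * max 1 |k|) ^ (2 * s) :=
          Real.rpow_le_rpow hp.le hm (by linarith)
      _ = 2 ^ (2 * s) * (max 1 |k|) ^ (2 * s) := Real.mul_rpow (by norm_num) (by positivity)
      _ ≤ 2 ^ (2 * s) * sobWeight s k := by
          gcongr
          unfold sobWeight
          rcases le_total 1 |k| with h | h
          · rw [max_eq_right h]; linarith
          · rw [max_eq_left h, Real.one_rpow]; exact le_add_of_nonneg_right (by positivity)
  have h3 : |k| ^ (2 * r) ≤ (1 + |k|) ^ (2 * r) :=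
    Real.rpow_le_rpow h0 (by linarith) (by linarith)
  have hsw : 0 < sobWeight s k := lt_of_lt_of_le one_pos (one_le_sobWeight s k)
  rw [div_le_iff₀ hsw, Real.norm_eq_abs, show -(2 * s - 2 * r) = 2 * r - 2 * s by ring,
    Real.rpow_sub hp]
  calc |k| ^ (2 * r) ≤ (1 + |k|) ^ (2 * r) := h3
    _ = (1 + |k|) ^ (2 * r) / (1 + |k|) ^ (2 * s) * (1 + |k|) ^ (2 * s) := by field_simp
    _ ≤ (1 + |k|) ^ (2 * r) / (1 + |k|) ^ (2 * s) * (2 ^ (2 * s) * sobWeight s k) := by gcongr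
    _ = _ := by ring

/-- The constant in the embedding of `H^s` into the weighted Wiener algebra. -/
def wienerConst (r s : ℝ) : ℝ≥0∞ := ∫⁻ k, ENNReal.ofReal (|k| ^ (2 * r) / sobWeight s k)

/-- Cauchy–Schwarz for |k|^r |g| = (|k|^r / √m) (√m |g|). The weight m is left free because the
interpolation inequality uses a rescaled one. -/
lemma wiener_sq_le_of_pos {r : ℝ} {m : ℝ → ℝ} (hm : Measurable m) (hw : ∀ k, 0 < m k)
    {g : ℝ → ℂ} (hg : Measurable g) :
    wiener r g ^ 2 ≤ (∫⁻ k, ENNReal.ofReal (|k| ^ (2 * r) / m k)) * energy m g := by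
  have h := lintegral_mul_sq_le (μ := volume)
    (f := fun k => ENNReal.ofReal (Real.sqrt (|k| ^ (2 * r) / m k)))
    (g := fun k => ENNReal.ofReal (Real.sqrt (m k)) * ‖g k‖ₑ)
    (by fun_prop) (by fun_prop)
  convert! h using 3
  · unfold wiener
    congr 1; funext k
    rw [← mul_assoc, ← ENNReal.ofReal_mul (Real.sqrt_nonneg _), ← Real.sqrt_mul (by
      have := (hw k).le; positivity),
      div_mul_cancel₀ _ (hw k).ne', mul_comm 2 r, Real.rpow_mul (abs_nonneg k)]
    rw [Real.rpow_ofNat, Real.sqrt_sq (by positivity)]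
  · funext k
    rw [← ENNReal.ofReal_pow (Real.sqrt_nonneg _), Real.sq_sqrt (by
      have := (hw k).le; positivity)]
  · unfold energy
    congr 1; funext k
    rw [mul_pow, ← ENNReal.ofReal_pow (Real.sqrt_nonneg _), Real.sq_sqrt (hw k).le]

lemma wiener_sq_le {r s : ℝ} {g : ℝ → ℂ} (hg : Measurable g) :
    wiener r g ^ 2 ≤ wienerConst r s * energy (sobWeight s) g :=
  wiener_sq_le_of_pos (measurable_sobWeight s)
    (fun k => lt_of_lt_of_le one_pos (one_le_sobWeight s k)) hg

lemma wiener_lt_top {r s : ℝ} (hr : 0 ≤ r) (hrs : r + 1 / 2 < s) {g : ℝ → ℂ} (hg : Measurable g)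
    (h : energy (sobWeight s) g < ∞) : wiener r g < ∞ := by
  have h2 := (wiener_sq_le (r := r) (s := s) hg).trans_lt
    (ENNReal.mul_lt_top (lintegral_rpow_div_sobWeight_lt_top hr hrs) h)
  by_contra hc
  rw [not_lt, top_le_iff] at hc
  simp [hc] at h2

lemma energy_one_le {s : ℝ} (g : ℝ → ℂ) : energy (fun _ => 1) g ≤ energy (sobWeight s) g :=
  lintegral_mono fun k => by gcongr; exact one_le_sobWeight s k

/-! ### Algebra of the convolution -/

lemma kconv_comm (g h : ℝ → ℂ) : kconv g h = kconv h g := by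
  funext k
  unfold kconv
  rw [← integral_sub_left_eq_self _ volume k]
  congr 1; funext l
  rw [sub_sub_cancel, kerS_comm]; ring

lemma Herm.kconv {g h : ℝ → ℂ} (hg : Herm g) (hh : Herm h) : Herm (kconv g h) := by
  intro k
  unfold SurfaceWave.kconv
  rw [← integral_neg_eq_self, ← integral_conj]
  congr 1; funext l
  rw [show -k - -l = -(k - l) by ring, kerS_neg_neg, hg, hh]
  simp

lemma measurable_kconv {g h : ℝ → ℂ} (hg : Measurable g) (hh : Measurable h) :
    Measurable (kconv g h) := by
  unfold kconv
  have h1 : Measurable (fun p : ℝ × ℝ => (kerS (p.1 - p.2) p.2 : ℂ) * g (p.1 - p.2) * h p.2) := by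
    have : Measurable (fun p : ℝ × ℝ => kerS (p.1 - p.2) p.2) :=
      measurable_kerS.comp (f := fun p : ℝ × ℝ => (p.1 - p.2, p.2)) (by fun_prop)
    fun_prop
  exact (h1.stronglyMeasurable.integral_prod_right').measurable

lemma lintegral_rpow_half_lt_top {s : ℝ} (hs : 1 ≤ s) {g : ℝ → ℂ}
    (h : energy (sobWeight s) g < ∞) :
    ∫⁻ k, (ENNReal.ofReal (Real.sqrt |k|) * ‖g k‖ₑ) ^ 2 < ∞ := by
  refine lt_of_le_of_lt (lintegral_mono fun k => ?_) h
  simp only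
  rw [mul_pow, ← ENNReal.ofReal_pow (Real.sqrt_nonneg _), Real.sq_sqrt (abs_nonneg k)]
  gcongr
  unfold sobWeight
  rcases le_total 1 |k| with h | h
  · have : |k| ^ (1 : ℝ) ≤ |k| ^ (2 * s) := Real.rpow_le_rpow_of_exponent_le h (by linarith)
    rw [Real.rpow_one] at this; linarith
  · have : 0 ≤ |k| ^ (2 * s) := by positivity
    linarith

/-- The bound of the kernel by √|l| reduces this to a product of two square integrable functions,
hence it holds for every k, not just almost every k. -/
lemma integrable_kconv {s : ℝ} (hs : 1 ≤ s) {g h : ℝ → ℂ} (hg : Measurable g) (hh : Measurable h)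
    (hgE : energy (sobWeight s) g < ∞) (hhE : energy (sobWeight s) h < ∞) (k : ℝ) :
    Integrable (fun l => (kerS (k - l) l : ℂ) * g (k - l) * h l) := by
  have hm : Measurable (fun l => kerS (k - l) l) :=
    measurable_kerS.comp (f := fun l : ℝ => (k - l, l)) (by fun_prop)
  refine ⟨by fun_prop, ?_⟩
  have h1 := lintegral_mul_sq_le (μ := volume) (f := fun l => ‖g (k - l)‖ₑ)
    (g := fun l => ENNReal.ofReal (Real.sqrt |l|) * ‖h l‖ₑ) (by fun_prop) (by fun_prop)
  have h2 : ∫⁻ l, ‖g (k - l)‖ₑ ^ 2 < ∞ := by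
    rw [lintegral_sub_left_eq_self (fun y => ‖g y‖ₑ ^ 2) k]
    have := (energy_one_le (s := s) g).trans_lt hgE
    simpa [energy] using this
  have h3 := h1.trans_lt (ENNReal.mul_lt_top h2 (lintegral_rpow_half_lt_top hs hhE))
  have h4 : ∫⁻ l, ‖g (k - l)‖ₑ * (ENNReal.ofReal (Real.sqrt |l|) * ‖h l‖ₑ) < ∞ := by
    by_contra hc
    rw [not_lt, top_le_iff] at hc
    simp [hc] at h3
  refine lt_of_le_of_lt (lintegral_mono fun l => ?_) h4
  rw [enorm_mul, enorm_mul]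
  have h5 : ‖((kerS (k - l) l : ℝ) : ℂ)‖ₑ ≤ ENNReal.ofReal (Real.sqrt |l|) := by
    rw [← ofReal_norm, Complex.norm_real, Real.norm_of_nonneg (kerS_nonneg _ _)]
    exact ENNReal.ofReal_le_ofReal (kerS_le_sqrt_right _ _)
  calc _ ≤ ENNReal.ofReal (Real.sqrt |l|) * ‖g (k - l)‖ₑ * ‖h l‖ₑ := by gcongr
    _ = _ := by ring

lemma enorm_kerS (k l : ℝ) : ‖((kerS k l : ℝ) : ℂ)‖ₑ = ENNReal.ofReal (kerS k l) := by
  rw [← ofReal_norm, Complex.norm_real, Real.norm_of_nonneg (kerS_nonneg _ _)]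

lemma energy_add_lt_top {w : ℝ → ℝ} {f g : ℝ → ℂ} (hw : Measurable w)
    (hf : Measurable f)
    (h1 : energy w f < ∞) (h2 : energy w g < ∞) : energy w (fun x => f x + g x) < ∞ := by
  have : energy w (fun x => f x + g x) ≤ 2 * energy w f + 2 * energy w g := by
    unfold energy
    rw [← lintegral_const_mul' _ _ (by simp), ← lintegral_const_mul' _ _ (by simp),
      ← lintegral_add_left (by fun_prop)]
    refine lintegral_mono fun k => ?_
    have h3 : ‖f k + g k‖ₑ ^ 2 ≤ 2 * (‖f k‖ₑ ^ 2 + ‖g k‖ₑ ^ 2) := by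
      refine (pow_le_pow_left' (enorm_add_le _ _) 2).trans ?_
      have := ENNReal.rpow_add_le_mul_rpow_add_rpow ‖f k‖ₑ ‖g k‖ₑ (p := 2) (by norm_num)
      norm_num at this
      exact this
    calc ENNReal.ofReal (w k) * ‖f k + g k‖ₑ ^ 2
        ≤ ENNReal.ofReal (w k) * (2 * (‖f k‖ₑ ^ 2 + ‖g k‖ₑ ^ 2)) := by gcongr
      _ = _ := by ring
  refine this.trans_lt ?_
  exact ENNReal.add_lt_top.2 ⟨ENNReal.mul_lt_top (by simp) h1, ENNReal.mul_lt_top (by simp) h2⟩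

lemma kconv_add_left {s : ℝ} (hs : 1 ≤ s) {f g h : ℝ → ℂ} (hf : Measurable f) (hg : Measurable g)
    (hh : Measurable h) (hfE : energy (sobWeight s) f < ∞) (hgE : energy (sobWeight s) g < ∞)
    (hhE : energy (sobWeight s) h < ∞) (k : ℝ) :
    kconv (fun x => f x + g x) h k = kconv f h k + kconv g h k := by
  unfold kconv
  rw [← integral_add (integrable_kconv hs hf hh hfE hhE k) (integrable_kconv hs hg hh hgE hhE k)]
  congr 1; funext l; ring

lemma kconv_smul_left (c : ℂ) (f h : ℝ → ℂ) (k : ℝ) :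
    kconv (fun x => c * f x) h k = c * kconv f h k := by
  unfold kconv
  rw [← integral_const_mul]
  congr 1; funext l; ring

lemma energy_neg (w : ℝ → ℝ) (f : ℝ → ℂ) : energy w (fun x => -f x) = energy w f := by
  unfold energy; simp

/-- `a(f, f) - a(g, g) = a(f - g, f + g)`. -/
lemma kconv_self_sub {s : ℝ} (hs : 1 ≤ s) {f g : ℝ → ℂ} (hf : Measurable f) (hg : Measurable g)
    (hfE : energy (sobWeight s) f < ∞) (hgE : energy (sobWeight s) g < ∞) (k : ℝ) :
    kconv f f k - kconv g g k = kconv (fun x => f x + -g x) (fun x => f x + g x) k := by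
  have hg' : Measurable (fun x => -g x) := hg.neg
  have hgE' : energy (sobWeight s) (fun x => -g x) < ∞ := by rwa [energy_neg]
  have hs1 := energy_add_lt_top (measurable_sobWeight s) hf hfE hgE
  rw [kconv_add_left hs hf hg' (by fun_prop) hfE hgE' hs1]
  have h1 : kconv (fun x => -g x) (fun x => f x + g x) k
      = - kconv g (fun x => f x + g x) k := by
    have := kconv_smul_left (-1) g (fun x => f x + g x) k
    simpa using this
  rw [h1, kconv_comm f (fun x => f x + g x), kconv_comm g (fun x => f x + g x),
    kconv_add_left hs hf hg hf hfE hgE hfE,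
    kconv_add_left hs hf hg hg hfE hgE hgE, kconv_comm g f]
  ring

/-! ### The bilinear estimate -/

/-- Accounts for the outer factor k of the nonlinearity, which uses up one of the s derivatives. -/
lemma sq_mul_sobWeight_le {s : ℝ} (hs : 1 ≤ s) (k : ℝ) :
    |k| ^ 2 * sobWeight (s - 1) k ≤ 2 * (1 + |k| ^ s) ^ 2 := by
  have h0 : 0 ≤ |k| := abs_nonneg k
  have h1 : |k| ≤ 1 + |k| ^ s := by
    have : 0 ≤ |k| ^ s := by positivity
    rcases le_total 1 |k| with h | h
    · have : |k| ^ (1 : ℝ) ≤ |k| ^ s := Real.rpow_le_rpow_of_exponent_le h hs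
      rw [Real.rpow_one] at this; linarith
    · linarith
  have h2 : |k| ^ 2 * |k| ^ (2 * (s - 1)) = (|k| ^ s) ^ 2 := by
    rcases eq_or_lt_of_le h0 with h | h
    · rw [← h, Real.zero_rpow (by linarith : s ≠ 0)]; simp
    · rw [← Real.rpow_natCast, ← Real.rpow_natCast, ← Real.rpow_mul h0, ← Real.rpow_add h]
      congr 1; push_cast; ring
  have h3 : 0 ≤ |k| ^ s := by positivity
  unfold sobWeight
  rw [mul_add, h2]
  nlinarith

lemma sobWeight_half_sq_le (s : ℝ) (k : ℝ) : (1 + |k| ^ s) ^ 2 ≤ 2 * sobWeight s k := by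
  unfold sobWeight
  have : |k| ^ (2 * s) = (|k| ^ s) ^ 2 := by
    rw [mul_comm, Real.rpow_mul (abs_nonneg k), Real.rpow_ofNat]
  rw [this]
  nlinarith [sq_nonneg (|k| ^ s - 1)]

lemma one_add_rpow_sub_add_le {s : ℝ} (hs : 0 ≤ s) (x y : ℝ) :
    1 + |x + y| ^ s ≤ 2 ^ s * ((1 + |x| ^ s) + (1 + |y| ^ s)) := by
  have hw : IsWeight s (fun x => 1 + |x| ^ s) := (IsWeight.one hs).add (IsWeight.rpow hs)
  have hp : (0 : ℝ) ≤ 2 ^ s := by positivity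
  wlog h : |x| ≤ |y| generalizing x y
  · have := this y x (le_of_not_ge h)
    rw [add_comm x y]; linarith
  have h1 : |x + y| ≤ |2 * y| := by
    rw [abs_mul, abs_two]; exact (abs_add_le x y).trans (by linarith)
  have h2 := (hw.mono h1).trans (hw.growth y one_le_two)
  have h3 : 0 ≤ 1 + |x| ^ s := hw.nonneg x
  nlinarith [mul_nonneg hp h3]

/-- The constant of the bilinear estimate. -/
def bilinConst (s : ℝ) : ℝ≥0∞ :=
  2 * (ENNReal.ofReal (2 ^ s) ^ 2 * (2 * (2 * wienerConst (1 / 2) s + 2 * wienerConst (1 / 2) s)))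

lemma bilinConst_lt_top {s : ℝ} (hs : 1 < s) : bilinConst s < ∞ := by
  have h : wienerConst (1 / 2) s < ∞ :=
    lintegral_rpow_div_sobWeight_lt_top (by norm_num) (by linarith)
  unfold bilinConst
  exact ENNReal.mul_lt_top (by simp) (ENNReal.mul_lt_top (by simp)
    (ENNReal.mul_lt_top (by simp) (ENNReal.add_lt_top.2
      ⟨ENNReal.mul_lt_top (by simp) h, ENNReal.mul_lt_top (by simp) h⟩)))

/-- The weight at k is distributed over k - l and l. In each term the kernel is bounded by the root
of the frequency that did not receive the weight, so the half derivative falls on the factor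
measured in L¹. -/
lemma enorm_kconv_le {s : ℝ} (hs : 0 ≤ s) {g h : ℝ → ℂ} (hg : Measurable g) (hh : Measurable h)
    (k : ℝ) :
    ENNReal.ofReal (1 + |k| ^ s) * ‖kconv g h k‖ₑ ≤ ENNReal.ofReal (2 ^ s) *
      ((∫⁻ l, (ENNReal.ofReal (1 + |k - l| ^ s) * ‖g (k - l)‖ₑ) *
          (ENNReal.ofReal (|l| ^ (1 / 2 : ℝ)) * ‖h l‖ₑ)) +
        ∫⁻ l, (ENNReal.ofReal (1 + |k - l| ^ s) * ‖h (k - l)‖ₑ) *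
          (ENNReal.ofReal (|l| ^ (1 / 2 : ℝ)) * ‖g l‖ₑ)) := by
  have e : ∫⁻ l, (ENNReal.ofReal (1 + |k - l| ^ s) * ‖h (k - l)‖ₑ) *
          (ENNReal.ofReal (|l| ^ (1 / 2 : ℝ)) * ‖g l‖ₑ) =
      ∫⁻ l, (ENNReal.ofReal (1 + |l| ^ s) * ‖h l‖ₑ) *
          (ENNReal.ofReal (|k - l| ^ (1 / 2 : ℝ)) * ‖g (k - l)‖ₑ) := by
    rw [← lintegral_sub_left_eq_self _ k]
    simp only [sub_sub_cancel]
  rw [e, ← lintegral_add_left (by fun_prop), ← lintegral_const_mul _ (by fun_prop)]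
  calc ENNReal.ofReal (1 + |k| ^ s) * ‖kconv g h k‖ₑ
      ≤ ENNReal.ofReal (1 + |k| ^ s) *
          ∫⁻ l, ‖(kerS (k - l) l : ℂ) * g (k - l) * h l‖ₑ := by
        gcongr; exact enorm_integral_le_lintegral_enorm _
    _ = ∫⁻ l, ENNReal.ofReal (1 + |k| ^ s) * ‖(kerS (k - l) l : ℂ) * g (k - l) * h l‖ₑ := by
        rw [lintegral_const_mul' _ _ (by simp)]
    _ ≤ _ := by
        refine lintegral_mono fun l => ?_
        simp only
        rw [enorm_mul, enorm_mul, enorm_kerS]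
        have h1 := one_add_rpow_sub_add_le hs (k - l) l
        rw [sub_add_cancel] at h1
        have h2 : ENNReal.ofReal (1 + |k| ^ s) ≤ ENNReal.ofReal (2 ^ s) *
            (ENNReal.ofReal (1 + |k - l| ^ s) + ENNReal.ofReal (1 + |l| ^ s)) := by
          rw [← ENNReal.ofReal_add (by positivity) (by positivity),
            ← ENNReal.ofReal_mul (by positivity)]
          exact ENNReal.ofReal_le_ofReal h1
        have h3 : ENNReal.ofReal (kerS (k - l) l) ≤ ENNReal.ofReal (|l| ^ (1 / 2 : ℝ)) := by
          rw [← Real.sqrt_eq_rpow]; exact ENNReal.ofReal_le_ofReal (kerS_le_sqrt_right _ _)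
        have h4 : ENNReal.ofReal (kerS (k - l) l) ≤ ENNReal.ofReal (|k - l| ^ (1 / 2 : ℝ)) := by
          rw [← Real.sqrt_eq_rpow]; exact ENNReal.ofReal_le_ofReal (kerS_le_sqrt_left _ _)
        calc ENNReal.ofReal (1 + |k| ^ s) * (ENNReal.ofReal (kerS (k - l) l) * ‖g (k - l)‖ₑ * ‖h l‖ₑ)
            ≤ (ENNReal.ofReal (2 ^ s) *
              (ENNReal.ofReal (1 + |k - l| ^ s) + ENNReal.ofReal (1 + |l| ^ s))) *
              (ENNReal.ofReal (kerS (k - l) l) * ‖g (k - l)‖ₑ * ‖h l‖ₑ) := by gcongr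
          _ = ENNReal.ofReal (2 ^ s) *
              (ENNReal.ofReal (1 + |k - l| ^ s) *
                (ENNReal.ofReal (kerS (k - l) l) * ‖g (k - l)‖ₑ * ‖h l‖ₑ) +
              ENNReal.ofReal (1 + |l| ^ s) *
                (ENNReal.ofReal (kerS (k - l) l) * ‖g (k - l)‖ₑ * ‖h l‖ₑ)) := by ring
          _ ≤ ENNReal.ofReal (2 ^ s) *
              (ENNReal.ofReal (1 + |k - l| ^ s) *
                (ENNReal.ofReal (|l| ^ (1 / 2 : ℝ)) * ‖g (k - l)‖ₑ * ‖h l‖ₑ) +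
              ENNReal.ofReal (1 + |l| ^ s) *
                (ENNReal.ofReal (|k - l| ^ (1 / 2 : ℝ)) * ‖g (k - l)‖ₑ * ‖h l‖ₑ)) := by gcongr
          _ = _ := by ring

lemma lintegral_weight_sq_le (s : ℝ) (g : ℝ → ℂ) :
    ∫⁻ x, (ENNReal.ofReal (1 + |x| ^ s) * ‖g x‖ₑ) ^ 2 ≤ 2 * energy (sobWeight s) g := by
  unfold energy
  rw [← lintegral_const_mul' _ _ (by simp)]
  refine lintegral_mono fun k => ?_
  simp only
  have hp : 0 ≤ |k| ^ s := by positivity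
  rw [mul_pow, ← ENNReal.ofReal_pow (by linarith), ← mul_assoc]
  gcongr
  rw [show (2 : ℝ≥0∞) = ENNReal.ofReal 2 by simp, ← ENNReal.ofReal_mul (by norm_num)]
  exact ENNReal.ofReal_le_ofReal (sobWeight_half_sq_le s k)

lemma ennreal_add_sq_le (a b : ℝ≥0∞) : (a + b) ^ 2 ≤ 2 * (a ^ 2 + b ^ 2) := by
  have := ENNReal.rpow_add_le_mul_rpow_add_rpow a b (p := 2) (by norm_num)
  norm_num at this
  exact this

/-- The splitting in `enorm_kconv_le` followed by Young's inequality, with the L¹ factor controlled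
by the H^s energy through `wiener_sq_le`. -/
lemma energy_mul_kconv_le {s : ℝ} (hs : 1 ≤ s) {g h : ℝ → ℂ} (hg : Measurable g)
    (hh : Measurable h) :
    energy (sobWeight (s - 1)) (fun k => (k : ℂ) * kconv g h k)
      ≤ bilinConst s * (energy (sobWeight s) g * energy (sobWeight s) h) := by
  set A : (ℝ → ℂ) → (ℝ → ℂ) → ℝ → ℝ≥0∞ := fun g h k =>
    ∫⁻ l, (ENNReal.ofReal (1 + |k - l| ^ s) * ‖g (k - l)‖ₑ) *
          (ENNReal.ofReal (|l| ^ (1 / 2 : ℝ)) * ‖h l‖ₑ) with hA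
  have hAm : ∀ g h, Measurable g → Measurable h → Measurable (A g h) := by
    intro g h hg hh
    exact Measurable.lintegral_prod_right' (f := fun p : ℝ × ℝ =>
      (ENNReal.ofReal (1 + |p.1 - p.2| ^ s) * ‖g (p.1 - p.2)‖ₑ) *
          (ENNReal.ofReal (|p.2| ^ (1 / 2 : ℝ)) * ‖h p.2‖ₑ)) (by fun_prop)
  have hY : ∀ g h, Measurable g → Measurable h → ∫⁻ k, A g h k ^ 2
      ≤ 2 * wienerConst (1 / 2) s * (energy (sobWeight s) g * energy (sobWeight s) h) := by
    intro g h hg hh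
    have h1 := lintegral_conv_sq_le (f := fun x => ENNReal.ofReal (1 + |x| ^ s) * ‖g x‖ₑ)
      (g := fun x => ENNReal.ofReal (|x| ^ (1 / 2 : ℝ)) * ‖h x‖ₑ) (by fun_prop) (by fun_prop)
    refine h1.trans ?_
    calc _ ≤ (2 * energy (sobWeight s) g) * (wienerConst (1 / 2) s * energy (sobWeight s) h) :=
          mul_le_mul' (lintegral_weight_sq_le s g) (wiener_sq_le hh)
      _ = _ := by ring
  have hpt : ∀ k, ENNReal.ofReal (sobWeight (s - 1) k) * ‖(k : ℂ) * kconv g h k‖ₑ ^ 2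
      ≤ 2 * (ENNReal.ofReal (2 ^ s) ^ 2 * (2 * (A g h k ^ 2 + A h g k ^ 2))) := by
    intro k
    have h1 := enorm_kconv_le (s := s) (by linarith) hg hh k
    have hk : ‖(k : ℂ)‖ₑ = ENNReal.ofReal |k| := by
      rw [← ofReal_norm, Complex.norm_real, Real.norm_eq_abs]
    have hp : 0 ≤ |k| ^ s := by positivity
    rw [enorm_mul, mul_pow, hk, ← ENNReal.ofReal_pow (abs_nonneg k), ← mul_assoc, mul_comm
      (ENNReal.ofReal (sobWeight _ _)), ← ENNReal.ofReal_mul (by positivity)]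
    calc ENNReal.ofReal (|k| ^ 2 * sobWeight (s - 1) k) * ‖kconv g h k‖ₑ ^ 2
        ≤ ENNReal.ofReal (2 * (1 + |k| ^ s) ^ 2) * ‖kconv g h k‖ₑ ^ 2 := by
          exact mul_le_mul' (ENNReal.ofReal_le_ofReal (sq_mul_sobWeight_le hs k)) le_rfl
      _ = 2 * (ENNReal.ofReal (1 + |k| ^ s) * ‖kconv g h k‖ₑ) ^ 2 := by
          rw [ENNReal.ofReal_mul (by norm_num), ENNReal.ofReal_pow (by linarith), mul_pow]
          simp [mul_assoc]
      _ ≤ 2 * (ENNReal.ofReal (2 ^ s) * (A g h k + A h g k)) ^ 2 := by gcongr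
      _ ≤ _ := by
          rw [mul_pow]; gcongr; exact ennreal_add_sq_le _ _
  have hm1 := hAm g h hg hh
  have hm2 := hAm h g hh hg
  calc energy (sobWeight (s - 1)) (fun k => (k : ℂ) * kconv g h k)
      ≤ ∫⁻ k, 2 * (ENNReal.ofReal (2 ^ s) ^ 2 * (2 * (A g h k ^ 2 + A h g k ^ 2))) :=
        lintegral_mono hpt
    _ = 2 * (ENNReal.ofReal (2 ^ s) ^ 2 * (2 * ((∫⁻ k, A g h k ^ 2) + ∫⁻ k, A h g k ^ 2))) := by
        rw [lintegral_const_mul _ (by fun_prop), lintegral_const_mul _ (by fun_prop),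
          lintegral_const_mul _ (by fun_prop), lintegral_add_left (by fun_prop)]
    _ ≤ 2 * (ENNReal.ofReal (2 ^ s) ^ 2 * (2 *
          (2 * wienerConst (1 / 2) s * (energy (sobWeight s) g * energy (sobWeight s) h) +
          2 * wienerConst (1 / 2) s * (energy (sobWeight s) h * energy (sobWeight s) g)))) := by
        gcongr
        · exact hY g h hg hh
        · exact hY h g hh hg
    _ = _ := by unfold bilinConst; ring

/-! ### Energy estimates -/

/-- The trilinear form `∫∫ f(x) g(y) h(-x-y)`. -/
def tri (f g h : ℝ → ℝ≥0∞) : ℝ≥0∞ := ∫⁻ x, ∫⁻ y, f x * (g y * h (-x - y))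

lemma tri_swap23 (f g h : ℝ → ℝ≥0∞) : tri f g h = tri f h g := by
  unfold tri
  congr 1; funext x
  rw [← lintegral_sub_left_eq_self _ (-x)]
  congr 1; funext y
  rw [sub_sub_cancel, mul_comm (h y)]

lemma tri_swap12 {f g h : ℝ → ℝ≥0∞} (hf : Measurable f) (hg : Measurable g) (hh : Measurable h) :
    tri f g h = tri g f h := by
  unfold tri
  rw [lintegral_lintegral_swap (by fun_prop)]
  congr 1; funext x
  congr 1; funext y
  rw [show -y - x = -x - y by ring]; ring

lemma tri_sq_le {f g h : ℝ → ℝ≥0∞} (hf : Measurable f) (hg : Measurable g) (hh : Measurable h) :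
    tri f g h ^ 2 ≤ (∫⁻ x, f x) ^ 2 * ((∫⁻ x, g x ^ 2) * ∫⁻ x, h x ^ 2) :=
  lintegral_trilinear_sq_le hf hg hh

lemma tri_self_le {f g : ℝ → ℝ≥0∞} (hf : Measurable f) (hg : Measurable g) :
    tri f g g ≤ (∫⁻ x, f x) * ∫⁻ x, g x ^ 2 := by
  have := tri_sq_le hf hg hg
  rw [← sq, ← mul_pow] at this
  exact (ENNReal.pow_le_pow_left_iff two_ne_zero).1 this

lemma integrable_of_le_tri {M : ℝ × ℝ → ℂ} (hM : Measurable M) {f g h : ℝ → ℝ≥0∞}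
    (hle : ∀ x y, ‖M (x, y)‖ₑ ≤ f x * (g y * h (-x - y))) (hfin : tri f g h < ∞) :
    Integrable M (volume.prod volume) := by
  refine ⟨hM.aestronglyMeasurable, ?_⟩
  unfold HasFiniteIntegral
  rw [lintegral_prod _ (by fun_prop)]
  exact lt_of_le_of_lt (lintegral_mono fun x => lintegral_mono fun y => hle x y) hfin

lemma measurable_kerS_neg {g h f : ℝ → ℂ} (hg : Measurable g) (hh : Measurable h)
    (hf : Measurable f) :
    Measurable (fun p : ℝ × ℝ => (kerS p.1 p.2 : ℂ) * g p.1 * h p.2 * f (-p.1 - p.2)) := by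
  have := measurable_kerS
  fun_prop

/-- Pairing of the convolution with a Hermitian function, as a trilinear integral. -/
lemma integral_conj_mul_kconv {w : ℝ → ℝ} (hw : ∀ x, w (-x) = w x) {f g h : ℝ → ℂ} (hf : Herm f) :
    ∫ k, (w k : ℂ) * starRingEnd ℂ (f k) * ((k : ℂ) * kconv g h k)
      = - ∫ x, ∫ y, (w x * x : ℂ) * ((kerS x y : ℂ) * f x * h y * g (-x - y)) := by
  -- Substituting k = -x turns the conjugate of f(-x) into f(x) and leaves the frequencies x, y, -x
  -- - y of zero sum.
  rw [← integral_neg_eq_self, ← integral_neg]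
  congr 1; funext x
  rw [← integral_neg]
  unfold kconv
  rw [← integral_const_mul, ← integral_const_mul]
  congr 1; funext y
  rw [hw, hf, kerS_neg_add_left, Complex.conj_conj]
  push_cast; ring

lemma enorm_mul_kerS_le (x y : ℝ) :
    ‖(x : ℂ)‖ₑ * ‖((kerS x y : ℝ) : ℂ)‖ₑ ≤ ENNReal.ofReal (|x| ^ (3 / 2 : ℝ)) := by
  rw [enorm_kerS, ← ofReal_norm, Complex.norm_real, Real.norm_eq_abs,
    ← ENNReal.ofReal_mul (abs_nonneg x)]
  exact ENNReal.ofReal_le_ofReal (abs_mul_kerS_le x y)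

lemma enorm_mul_kerS_le' (x y : ℝ) :
    ‖(-x - y : ℂ)‖ₑ * ‖((kerS x y : ℝ) : ℂ)‖ₑ ≤ ENNReal.ofReal (|-x - y| ^ (3 / 2 : ℝ)) := by
  have := enorm_mul_kerS_le (-x - y) y
  rw [kerS_neg_add_left] at this
  exact_mod_cast this

/-- The difference estimate. -/
lemma enorm_integral_conj_mul_kconv_le {f z : ℝ → ℂ} (hf : Measurable f) (hz : Measurable z)
    (hH : Herm f) (hfw : wiener (3 / 2) f < ∞)
    (hf2 : energy (fun _ => 1) f < ∞) (hz2 : energy (fun _ => 1) z < ∞) :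
    ‖∫ k, starRingEnd ℂ (f k) * ((k : ℂ) * kconv f z k)‖ₑ
      ≤ wiener (3 / 2) z * energy (fun _ => 1) f := by
  set F : ℝ × ℝ → ℂ := fun p => (kerS p.1 p.2 : ℂ) * f p.1 * z p.2 * f (-p.1 - p.2) with hF
  have hFm : Measurable F := measurable_kerS_neg hf hz hf
  have h2 : ∀ g : ℝ → ℂ, energy (fun _ => 1) g = ∫⁻ x, ‖g x‖ₑ ^ 2 := fun g => by simp [energy]
  have h0 := integral_conj_mul_kconv (w := fun _ => 1) (fun _ => rfl) (g := f) (h := z) hH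
  simp only [Complex.ofReal_one, one_mul] at h0
  rw [h0, enorm_neg]
  have i1 : Integrable (fun p : ℝ × ℝ => (p.1 : ℂ) * F p) (volume.prod volume) := by
    refine integrable_of_le_tri (by fun_prop)
      (f := fun x => ENNReal.ofReal (|x| ^ (3 / 2 : ℝ)) * ‖f x‖ₑ) (g := fun x => ‖z x‖ₑ)
      (h := fun x => ‖f x‖ₑ) ?_ ?_
    · intro x y
      simp only [hF, enorm_mul]
      calc _ = (‖(x : ℂ)‖ₑ * ‖((kerS x y : ℝ) : ℂ)‖ₑ) * ‖f x‖ₑ * (‖z y‖ₑ * ‖f (-x - y)‖ₑ) := by ring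
        _ ≤ _ := by gcongr; exact enorm_mul_kerS_le x y
    · have := tri_sq_le (f := fun x => ENNReal.ofReal (|x| ^ (3 / 2 : ℝ)) * ‖f x‖ₑ)
        (g := fun x => ‖z x‖ₑ) (h := fun x => ‖f x‖ₑ) (by fun_prop) (by fun_prop) (by fun_prop)
      rw [← h2, ← h2] at this
      have h3 := this.trans_lt (ENNReal.mul_lt_top (ENNReal.pow_lt_top hfw)
        (ENNReal.mul_lt_top hz2 hf2))
      by_contra hc
      rw [not_lt, top_le_iff] at hc
      simp [hc] at h3
  have e1 : ∫ x : ℝ, ∫ y : ℝ, (x : ℂ) * F (x, y) = ∫ y : ℝ, ∫ x : ℝ, (x : ℂ) * F (x, y) :=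
    integral_integral_swap i1
  -- At fixed y, F is invariant under the exchange of the two frequencies x and -x - y of f.
  -- Averaging replaces the factor x by (x + (-x - y)) / 2 = -y / 2, so the derivative falls on z
  -- and only z needs a Wiener norm in the bound.
  have hsub : ∀ y : ℝ, ∫ x : ℝ, (x : ℂ) * F (x, y) = ∫ x : ℝ, (-x - y : ℂ) * F (x, y) := by
    intro y
    rw [← integral_sub_left_eq_self _ volume (-y)]
    congr 1; funext x
    simp only [hF]
    rw [show (-y - x : ℝ) = -x - y by ring, kerS_neg_add_left, show -(-x - y) - y = x by ring]
    push_cast; ring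
  have i1' : ∀ᵐ y : ℝ, Integrable (fun x : ℝ => (x : ℂ) * F (x, y)) := i1.prod_left_ae
  have i2' : ∀ᵐ y : ℝ, Integrable (fun x : ℝ => (-x - y : ℂ) * F (x, y)) := by
    filter_upwards [i1'] with y hy
    have := (hy.comp_sub_left (-y))
    convert! this using 1
    funext x
    simp only [hF]
    rw [show (-y - x : ℝ) = -x - y by ring, kerS_neg_add_left, show -(-x - y) - y = x by ring]
    push_cast; ring
  have e2 : ∀ᵐ y : ℝ, 2 * ∫ x : ℝ, (x : ℂ) * F (x, y) = ∫ x : ℝ, (-y : ℂ) * F (x, y) := by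
    filter_upwards [i1', i2'] with y h1 h2
    rw [two_mul]
    nth_rewrite 2 [hsub y]
    rw [← integral_add h1 h2]
    congr 1; funext x; ring
  have e3 : 2 * ∫ x : ℝ, ∫ y : ℝ, (x : ℂ) * F (x, y) = ∫ y : ℝ, ∫ x : ℝ, (-y : ℂ) * F (x, y) := by
    rw [e1, ← integral_const_mul]
    exact integral_congr_ae e2
  have e4 : ‖2 * ∫ x : ℝ, ∫ y : ℝ, (x : ℂ) * F (x, y)‖ₑ ≤ wiener (3 / 2) z * energy (fun _ => 1) f := by
    rw [e3]
    calc ‖∫ y : ℝ, ∫ x : ℝ, (-y : ℂ) * F (x, y)‖ₑ ≤ ∫⁻ y : ℝ, ∫⁻ x : ℝ, ‖(-y : ℂ) * F (x, y)‖ₑ :=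
          (enorm_integral_le_lintegral_enorm _).trans
            (lintegral_mono fun y => enorm_integral_le_lintegral_enorm _)
      _ ≤ tri (fun x => ENNReal.ofReal (|x| ^ (3 / 2 : ℝ)) * ‖z x‖ₑ) (fun x => ‖f x‖ₑ)
            (fun x => ‖f x‖ₑ) := by
          unfold tri
          refine lintegral_mono fun y => lintegral_mono fun x => ?_
          simp only [hF, enorm_mul, enorm_neg]
          rw [kerS_comm, show -y - x = -x - y by ring]
          calc _ = (‖(y : ℂ)‖ₑ * ‖((kerS y x : ℝ) : ℂ)‖ₑ) * ‖z y‖ₑ * (‖f x‖ₑ * ‖f (-x - y)‖ₑ) := by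
                ring
            _ ≤ _ := by gcongr; exact enorm_mul_kerS_le y x
      _ ≤ _ := by
          rw [h2]
          exact tri_self_le (by fun_prop) (by fun_prop)
  refine le_trans ?_ e4
  rw [enorm_mul]
  have : (1 : ℝ≥0∞) ≤ ‖(2 : ℂ)‖ₑ := by
    rw [← ofReal_norm]; norm_num
  exact le_mul_of_one_le_left' this

section Symmetrization

variable {w : ℝ → ℝ} {p C : ℝ} {g : ℝ → ℂ}

lemma tri_wiener_lt_top (hg : Measurable g) (hgw : wiener (3 / 2) g < ∞)
    (hg2 : energy (fun _ => 1) g < ∞) :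
    tri (fun x => ENNReal.ofReal (|x| ^ (3 / 2 : ℝ)) * ‖g x‖ₑ) (fun x => ‖g x‖ₑ)
      (fun x => ‖g x‖ₑ) < ∞ := by
  refine (tri_self_le (by fun_prop) (by fun_prop)).trans_lt (ENNReal.mul_lt_top hgw ?_)
  simpa [energy] using hg2

/-- Threefold symmetrization of the weighted trilinear form. -/
lemma three_mul_integral_weight (hw : IsWeight p w) (hC : ∀ x, w x ≤ C) (hg : Measurable g)
    (hgw : wiener (3 / 2) g < ∞) (hg2 : energy (fun _ => 1) g < ∞) :
    3 * ∫ x, ∫ y, (w x * x : ℂ) * ((kerS x y : ℂ) * g x * g y * g (-x - y))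
      = ∫ x, ∫ y, (w x * x + w y * y + w (-x - y) * (-x - y) : ℂ) *
          ((kerS x y : ℂ) * g x * g y * g (-x - y)) := by
  set F : ℝ × ℝ → ℂ := fun p => (kerS p.1 p.2 : ℂ) * g p.1 * g p.2 * g (-p.1 - p.2) with hF
  have hFm : Measurable F := measurable_kerS_neg hg hg hg
  have hwm := hw.measurable
  set a : ℝ → ℝ≥0∞ := fun x => ENNReal.ofReal (|x| ^ (3 / 2 : ℝ)) * ‖g x‖ₑ with ha
  set b : ℝ → ℝ≥0∞ := fun x => ‖g x‖ₑ with hb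
  have ham : Measurable a := by fun_prop
  have hbm : Measurable b := by fun_prop
  have hfin : tri a b b < ∞ := tri_wiener_lt_top hg hgw hg2
  have hwC : ∀ x, ‖(w x : ℂ)‖ₑ ≤ ENNReal.ofReal C := by
    intro x
    rw [← ofReal_norm, Complex.norm_real, Real.norm_of_nonneg (hw.nonneg x)]
    exact ENNReal.ofReal_le_ofReal (hC x)
  have hCtri : ∀ a b c : ℝ → ℝ≥0∞, tri (fun x => ENNReal.ofReal C * a x) b c
      = ENNReal.ofReal C * tri a b c := by
    intro a b c
    unfold tri
    simp_rw [mul_assoc]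
    rw [← lintegral_const_mul' _ _ (by simp)]
    congr 1; funext x
    rw [← lintegral_const_mul' _ _ (by simp)]
  -- The bound C serves only for integrability of the three terms and does not enter the resulting
  -- identity.
  have i1 : Integrable (fun p : ℝ × ℝ => (w p.1 * p.1 : ℂ) * F p) (volume.prod volume) := by
    refine integrable_of_le_tri (by fun_prop) (f := fun x => ENNReal.ofReal C * a x) (g := b)
      (h := b) ?_ (by rw [hCtri]; exact ENNReal.mul_lt_top (by simp) hfin)
    intro x y
    simp only [hF, enorm_mul, ha, hb]
    calc _ = ‖(w x : ℂ)‖ₑ * ((‖(x : ℂ)‖ₑ * ‖((kerS x y : ℝ) : ℂ)‖ₑ) * ‖g x‖ₑ) *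
            (‖g y‖ₑ * ‖g (-x - y)‖ₑ) := by ring
      _ ≤ _ := by gcongr; exacts [hwC x, enorm_mul_kerS_le x y]
  have hsymm : ∀ x y, F (y, x) = F (x, y) := by
    intro x y
    simp only [hF]
    rw [kerS_comm, show -y - x = -x - y by ring]; ring
  have hrot : ∀ x y, F (x, -x - y) = F (x, y) := by
    intro x y
    simp only [hF]
    rw [kerS_comm, show -x - y = -y - x by ring, kerS_neg_add_left, kerS_comm,
      show -x - (-y - x) = y by ring]; ring
  have i2 : Integrable (fun p : ℝ × ℝ => (w p.2 * p.2 : ℂ) * F p) (volume.prod volume) := by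
    have := i1.swap
    refine this.congr (Eventually.of_forall fun q => ?_)
    simp only [Function.comp, Prod.fst_swap]
    rw [← hsymm]; rfl
  have i3 : Integrable (fun p : ℝ × ℝ => (w (-p.1 - p.2) * (-p.1 - p.2) : ℂ) * F p)
      (volume.prod volume) := by
    refine integrable_of_le_tri (by fun_prop) (f := fun x => ENNReal.ofReal C * b x) (g := b)
      (h := a) ?_ ?_
    · intro x y
      simp only [hF, enorm_mul, ha, hb]
      calc _ = ‖((w (-x - y) : ℝ) : ℂ)‖ₑ * ‖g x‖ₑ *
              (‖g y‖ₑ * ((‖(-x - y : ℂ)‖ₑ * ‖((kerS x y : ℝ) : ℂ)‖ₑ) * ‖g (-x - y)‖ₑ)) := by ring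
        _ ≤ _ := by gcongr; exacts [hwC _, enorm_mul_kerS_le' x y]
    · rw [hCtri, tri_swap23, tri_swap12 hbm ham hbm]
      exact ENNReal.mul_lt_top (by simp) hfin
  have e12 : ∫ x, ∫ y, (w x * x : ℂ) * F (x, y) = ∫ x, ∫ y, (w y * y : ℂ) * F (x, y) := by
    rw [integral_integral_swap i1]
    congr 1; funext y
    congr 1; funext x
    rw [hsymm]
  have e23 : ∫ x, ∫ y, (w y * y : ℂ) * F (x, y)
      = ∫ x, ∫ y, (w (-x - y) * (-x - y) : ℂ) * F (x, y) := by
    congr 1; funext x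
    rw [← integral_sub_left_eq_self _ volume (-x)]
    congr 1; funext y
    rw [hrot]; push_cast; ring
  calc 3 * ∫ x, ∫ y, (w x * x : ℂ) * F (x, y)
      = ((∫ x, ∫ y, (w x * x : ℂ) * F (x, y)) + ∫ x, ∫ y, (w y * y : ℂ) * F (x, y))
        + ∫ x, ∫ y, (w (-x - y) * (-x - y) : ℂ) * F (x, y) := by
        rw [← e23, ← e12]; ring
    _ = _ := by
        have j1 := integral_integral_add i1 i2
        have j2 := integral_integral_add (i1.add i2) i3
        simp only [Pi.add_apply] at j1 j2
        rw [← j1, ← j2]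
        congr 1; funext x
        congr 1; funext y
        simp only [hF]
        ring

/-- The weighted energy estimate. -/
lemma enorm_integral_weight_conj_mul_kconv_le (hp : 1 ≤ p) (hw : IsWeight p w)
    (hC : ∀ x, w x ≤ C) (hg : Measurable g) (hH : Herm g)
    (hgw : wiener (3 / 2) g < ∞) (hg2 : energy (fun _ => 1) g < ∞) :
    ‖∫ k, (w k : ℂ) * starRingEnd ℂ (g k) * ((k : ℂ) * kconv g g k)‖ₑ
      ≤ ENNReal.ofReal (2 * 2 ^ p) * (wiener (3 / 2) g * energy w g) := by
  have hwm := hw.measurable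
  set a : ℝ → ℝ≥0∞ := fun x => ENNReal.ofReal (|x| ^ (3 / 2 : ℝ)) * ‖g x‖ₑ with ha
  set b : ℝ → ℝ≥0∞ := fun x => ENNReal.ofReal (Real.sqrt (w x)) * ‖g x‖ₑ with hb
  have ham : Measurable a := by fun_prop
  have hbm : Measurable b := by fun_prop
  have hpos : (0 : ℝ) ≤ 2 * 2 ^ p := by positivity
  have hb2 : ∫⁻ x, b x ^ 2 = energy w g := by
    unfold energy
    congr 1; funext x
    simp only [hb]
    rw [mul_pow, ← ENNReal.ofReal_pow (Real.sqrt_nonneg _), Real.sq_sqrt (hw.nonneg x)]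
  have htri : tri a b b ≤ wiener (3 / 2) g * energy w g := by
    rw [← hb2]; exact tri_self_le ham hbm
  -- Each term of `triSum` places |·|^{3/2} on one frequency and √w on the other two. All three thus
  -- integrate to permutations of one trilinear form, bounded on L¹ × L² × L².
  have hpt : ∀ x y : ℝ, ‖(w x * x + w y * y + w (-x - y) * (-x - y) : ℂ) *
          ((kerS x y : ℂ) * g x * g y * g (-x - y))‖ₑ ≤ ENNReal.ofReal (2 * 2 ^ p) *
        (a x * (b y * b (-x - y)) + b x * (a y * b (-x - y)) + b x * (b y * a (-x - y))) := by
    intro x y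
    have h1 := IsWeight.commutator hp hw (x := x) (y := y) (z := -x - y) (by ring)
    have e : (w x * x + w y * y + w (-x - y) * (-x - y) : ℂ)
        = ((w x * x + w y * y + w (-x - y) * (-x - y) : ℝ) : ℂ) := by push_cast; ring
    have h2 : ‖(w x * x + w y * y + w (-x - y) * (-x - y) : ℂ)‖ₑ * ‖((kerS x y : ℝ) : ℂ)‖ₑ
        ≤ ENNReal.ofReal (2 * 2 ^ p) * ENNReal.ofReal (IsWeight.triSum w x y (-x - y)) := by
      rw [enorm_kerS, e, ← ofReal_norm, Complex.norm_real, Real.norm_eq_abs,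
        ← ENNReal.ofReal_mul (abs_nonneg _), ← ENNReal.ofReal_mul hpos]
      exact ENNReal.ofReal_le_ofReal h1
    calc _ = (‖(w x * x + w y * y + w (-x - y) * (-x - y) : ℂ)‖ₑ * ‖((kerS x y : ℝ) : ℂ)‖ₑ) *
          (‖g x‖ₑ * ‖g y‖ₑ * ‖g (-x - y)‖ₑ) := by simp only [enorm_mul]; ring
      _ ≤ (ENNReal.ofReal (2 * 2 ^ p) * ENNReal.ofReal (IsWeight.triSum w x y (-x - y))) *
          (‖g x‖ₑ * ‖g y‖ₑ * ‖g (-x - y)‖ₑ) := by gcongr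
      _ = _ := by
          unfold IsWeight.triSum
          rw [Real.sqrt_mul (hw.nonneg _), Real.sqrt_mul (hw.nonneg _),
            Real.sqrt_mul (hw.nonneg _), ENNReal.ofReal_add (by positivity) (by positivity),
            ENNReal.ofReal_add (by positivity) (by positivity)]
          simp only [ENNReal.ofReal_mul (Real.sqrt_nonneg _),
            ENNReal.ofReal_mul (Real.rpow_nonneg (abs_nonneg _) (3 / 2 : ℝ)), ha, hb]
          ring
  have hmain : ‖3 * ∫ x, ∫ y, (w x * x : ℂ) * ((kerS x y : ℂ) * g x * g y * g (-x - y))‖ₑ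
      ≤ 3 * (ENNReal.ofReal (2 * 2 ^ p) * (wiener (3 / 2) g * energy w g)) := by
    rw [three_mul_integral_weight hw hC hg hgw hg2]
    refine ((enorm_integral_le_lintegral_enorm _).trans
      (lintegral_mono fun x => enorm_integral_le_lintegral_enorm _)).trans ?_
    refine (lintegral_mono fun x => lintegral_mono fun y => hpt x y).trans ?_
    have m1 : Measurable fun x => ∫⁻ y, a x * (b y * b (-x - y)) :=
      Measurable.lintegral_prod_right' (f := fun p : ℝ × ℝ => a p.1 * (b p.2 * b (-p.1 - p.2)))
        (by fun_prop)
    have m2 : Measurable fun x => ∫⁻ y, b x * (a y * b (-x - y)) :=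
      Measurable.lintegral_prod_right' (f := fun p : ℝ × ℝ => b p.1 * (a p.2 * b (-p.1 - p.2)))
        (by fun_prop)
    calc _ = ENNReal.ofReal (2 * 2 ^ p) * (tri a b b + tri b a b + tri b b a) := by
          unfold tri
          rw [← lintegral_add_left m1, ← lintegral_add_left (by exact m1.add m2),
            ← lintegral_const_mul' _ _ ENNReal.ofReal_ne_top]
          congr 1; funext x
          rw [← lintegral_add_left (by fun_prop), ← lintegral_add_left (by fun_prop),
            ← lintegral_const_mul' _ _ ENNReal.ofReal_ne_top]
      _ = 3 * (ENNReal.ofReal (2 * 2 ^ p) * tri a b b) := by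
          rw [tri_swap23 b b a, tri_swap12 hbm ham hbm]; ring
      _ ≤ _ := by gcongr
  rw [enorm_mul] at hmain
  rw [integral_conj_mul_kconv hw.even hH, enorm_neg]
  have h3 : ‖(3 : ℂ)‖ₑ = 3 := by rw [← ofReal_norm]; norm_num
  rw [h3] at hmain
  exact (ENNReal.mul_le_mul_iff_right (by norm_num) (by norm_num)).1 hmain

/-- The `L²` norm is conserved. -/
lemma integral_conj_mul_kconv_self (hg : Measurable g) (hH : Herm g)
    (hgw : wiener (3 / 2) g < ∞) (hg2 : energy (fun _ => 1) g < ∞) :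
    ∫ k, starRingEnd ℂ (g k) * ((k : ℂ) * kconv g g k) = 0 := by
  have h1 := integral_conj_mul_kconv (w := fun _ => 1) (fun _ => rfl) (g := g) (h := g) hH
  have h2 := three_mul_integral_weight (IsWeight.one zero_le_one) (C := 1) (fun _ => le_rfl)
    hg hgw hg2
  simp only [Complex.ofReal_one, one_mul] at h1 h2
  rw [h1, neg_eq_zero]
  have h3 : ∀ x y : ℝ, ((x : ℂ) + y + (-x - y)) = 0 := fun x y => by ring
  simp only [h3, zero_mul, integral_zero] at h2
  simpa using h2

end Symmetrization

/-! ### The Fourier transform of real-valued square integrable functions -/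

/-- Complex-valued square integrable functions on the line. -/
abbrev L2C : Type := Lp ℂ 2 (volume : Measure ℝ)

/-- Complex conjugation on `L²`. -/
def conjL : L2C →L[ℝ] L2C := (Complex.conjCLE : ℂ →L[ℝ] ℂ).compLpL 2 volume

/-- Reflection on `L²`. -/
def reflL : L2C → L2C := Lp.compMeasurePreserving Neg.neg (Measure.measurePreserving_neg volume)

lemma coeFn_conjL (F : L2C) : conjL F =ᵐ[volume] fun x => starRingEnd ℂ (F x) :=
  ContinuousLinearMap.coeFn_compLpL _ _

lemma coeFn_reflL (F : L2C) : reflL F =ᵐ[volume] fun x => F (-x) :=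
  Lp.coeFn_compMeasurePreserving F _

lemma continuous_reflL : Continuous reflL :=
  (Lp.isometry_compMeasurePreserving _).continuous

/-- Both sides are continuous in F, so Schwartz functions suffice; for these, conjugating the
integrand reverses the sign of the frequency in the phase. -/
lemma fourier_conjL (F : L2C) : (𝓕 (conjL F) : L2C) = reflL (conjL (𝓕 F : L2C)) := by
  refine DenseRange.induction_on (p := fun F : L2C => (𝓕 (conjL F) : L2C) = reflL (conjL (𝓕 F)))
    (SchwartzMap.denseRange_toLpCLM (F := ℂ) (μ := (volume : Measure ℝ))
      (p := (2 : ℝ≥0∞)) ENNReal.ofNat_ne_top) F ?_ ?_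
  · have hF : Continuous (fun F : L2C => (𝓕 F : L2C)) :=
      (Lp.fourierTransformₗᵢ ℝ ℂ).continuous
    exact isClosed_eq (hF.comp conjL.continuous)
      (continuous_reflL.comp (conjL.continuous.comp hF))
  · intro φ
    have e0 : SchwartzMap.toLpCLM ℝ ℂ 2 volume φ = φ.toLp 2 volume := rfl
    set φc : SchwartzMap ℝ ℂ := SchwartzMap.postcompCLM (Complex.conjCLE : ℂ →L[ℝ] ℂ) φ with hφc
    have e1 : conjL (φ.toLp 2 volume) = φc.toLp 2 volume := by
      apply Lp.ext
      filter_upwards [coeFn_conjL (φ.toLp 2 volume), φ.coeFn_toLp 2 volume,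
        φc.coeFn_toLp 2 volume] with x h1 h2 h3
      rw [h1, h2, h3, hφc, SchwartzMap.postcompCLM_apply]
      rfl
    simp only [e0]
    rw [e1, SchwartzMap.toLp_fourier_eq, SchwartzMap.toLp_fourier_eq]
    apply Lp.ext
    have h4 := (Measure.measurePreserving_neg (volume : Measure ℝ)).quasiMeasurePreserving.ae
      (coeFn_conjL ((𝓕 φ : SchwartzMap ℝ ℂ).toLp 2 volume))
    have h5 := (Measure.measurePreserving_neg (volume : Measure ℝ)).quasiMeasurePreserving.ae
      ((𝓕 φ : SchwartzMap ℝ ℂ).coeFn_toLp 2 volume)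
    filter_upwards [coeFn_reflL (conjL ((𝓕 φ : SchwartzMap ℝ ℂ).toLp 2 volume)), h4, h5,
        (𝓕 φc : SchwartzMap ℝ ℂ).coeFn_toLp 2 volume] with x h1 h2 h3 h6
    rw [h1, h2, h3, h6, SchwartzMap.fourier_coe, SchwartzMap.fourier_coe,
      Real.fourier_eq, Real.fourier_eq, ← integral_conj]
    congr 1; funext y
    rw [hφc, SchwartzMap.postcompCLM_apply]
    simp only [Circle.smul_def, smul_eq_mul, map_mul, inner_neg_right, neg_neg]
    congr 1
    rw [← Circle.coe_inv_eq_conj, ← AddChar.map_neg_eq_inv]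

/-- Multiplication by a real constant, as a quasi measure preserving map. -/
lemma quasiMeasurePreserving_div_const {a : ℝ} (ha : a ≠ 0) :
    Measure.QuasiMeasurePreserving (fun k : ℝ => k / a) := by
  refine ⟨by fun_prop, ?_⟩
  have : (fun k : ℝ => k / a) = fun k => k * a⁻¹ := by funext k; rw [div_eq_mul_inv]
  rw [this, Real.map_volume_mul_right (inv_ne_zero ha)]
  exact Measure.smul_absolutelyContinuous

lemma two_pi_ne_zero : (2 * Real.pi : ℝ) ≠ 0 := by positivity

lemma aestronglyMeasurable_hat (f : L2R) : AEStronglyMeasurable (hat f) volume := by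
  unfold hat
  exact ((Lp.aestronglyMeasurable _).comp_quasiMeasurePreserving
    (quasiMeasurePreserving_div_const two_pi_ne_zero)).const_mul _

lemma hat_ae_of_ae {P : ℝ → Prop} (h : ∀ᵐ x, P x) : ∀ᵐ k : ℝ, P (k / (2 * Real.pi)) :=
  (quasiMeasurePreserving_div_const two_pi_ne_zero).ae h

/-- The embedding of real-valued into complex-valued functions. -/
def toC (f : L2R) : L2C := Complex.ofRealCLM.compLp f

lemma toC_add (f g : L2R) : toC (f + g) = toC f + toC g :=
  (Complex.ofRealCLM.compLpL 2 volume).map_add f g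

lemma toC_smul (c : ℝ) (f : L2R) : toC (c • f) = c • toC f :=
  (Complex.ofRealCLM.compLpL 2 volume).map_smul c f

lemma coeFn_toC (f : L2R) : toC f =ᵐ[volume] fun x => (f x : ℂ) :=
  ContinuousLinearMap.coeFn_compLp' _ _

lemma hat_def (f : L2R) (k : ℝ) :
    hat f k = ((1 / (2 * Real.pi) : ℝ) : ℂ) * (𝓕 (toC f) : L2C) (k / (2 * Real.pi)) := rfl

lemma hat_add (f g : L2R) : hat (f + g) =ᵐ[volume] fun k => hat f k + hat g k := by
  have e : (𝓕 (toC (f + g)) : L2C) = 𝓕 (toC f) + 𝓕 (toC g) := by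
    rw [toC_add]; exact (Lp.fourierTransformₗᵢ ℝ ℂ).map_add _ _
  have := hat_ae_of_ae (Lp.coeFn_add (𝓕 (toC f) : L2C) (𝓕 (toC g)))
  filter_upwards [this] with k hk
  rw [hat_def, e, hk, Pi.add_apply, mul_add]; rfl

lemma hat_smul (c : ℝ) (f : L2R) : hat (c • f) =ᵐ[volume] fun k => (c : ℂ) * hat f k := by
  have e : (𝓕 (toC (c • f)) : L2C) = (c : ℂ) • (𝓕 (toC f) : L2C) := by
    rw [toC_smul]
    have : c • toC f = (c : ℂ) • toC f := by
      rw [← algebraMap_smul ℂ c (toC f)]; rfl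
    rw [this]
    exact (Lp.fourierTransformₗᵢ ℝ ℂ).map_smul _ _
  have := hat_ae_of_ae (Lp.coeFn_smul (c : ℂ) (𝓕 (toC f) : L2C))
  filter_upwards [this] with k hk
  rw [hat_def, e, hk, Pi.smul_apply, smul_eq_mul, hat_def]; ring

lemma conjL_toC (f : L2R) : conjL (toC f) = toC f := by
  apply Lp.ext
  filter_upwards [coeFn_conjL (toC f), coeFn_toC f] with x h1 h2
  rw [h1, h2, Complex.conj_ofReal]

lemma hat_neg_arg (f : L2R) : ∀ᵐ k, hat f (-k) = starRingEnd ℂ (hat f k) := by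
  have h := fourier_conjL (toC f)
  rw [conjL_toC] at h
  have h1 : ∀ᵐ x, (𝓕 (toC f) : L2C) x = starRingEnd ℂ ((𝓕 (toC f) : L2C) (-x)) := by
    have h2 := (Measure.measurePreserving_neg (volume : Measure ℝ)).quasiMeasurePreserving.ae
      (coeFn_conjL (𝓕 (toC f) : L2C))
    filter_upwards [coeFn_reflL (conjL (𝓕 (toC f) : L2C)), h2] with x h3 h4
    rw [← h4, ← h3, ← h]
  filter_upwards [hat_ae_of_ae h1] with k hk
  rw [hat_def, hat_def, hk, map_mul, Complex.conj_conj, Complex.conj_ofReal, neg_div]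

/-- Plancherel: the two prefactors 1/(2π) and the Jacobian 2π combine to 1/(2π). -/
lemma inner_eq_integral_hat (f g : L2R) :
    ((inner ℝ f g : ℝ) : ℂ) = 2 * Real.pi * ∫ k, starRingEnd ℂ (hat f k) * hat g k := by
  have h1 : ∫ k, starRingEnd ℂ (hat f k) * hat g k
      = ∫ k, (fun x => ((1 / (2 * Real.pi) : ℝ) : ℂ) ^ 2 *
        (starRingEnd ℂ ((𝓕 (toC f) : L2C) x) * (𝓕 (toC g) : L2C) x)) (k / (2 * Real.pi)) := by
    congr 1; funext k
    rw [hat_def, hat_def, map_mul, Complex.conj_ofReal]; ring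
  have h2 : ∫ x, starRingEnd ℂ ((𝓕 (toC f) : L2C) x) * (𝓕 (toC g) : L2C) x
      = ∫ x, starRingEnd ℂ (toC f x) * toC g x := by
    have := Lp.inner_fourier_eq (toC f) (toC g)
    rw [L2.inner_def, L2.inner_def] at this
    simpa [mul_comm] using this
  have h3 : ∫ x, starRingEnd ℂ (toC f x) * toC g x = ((inner ℝ f g : ℝ) : ℂ) := by
    rw [L2.inner_def, ← integral_complex_ofReal]
    apply integral_congr_ae
    filter_upwards [coeFn_toC f, coeFn_toC g] with x h4 h5
    rw [h4, h5, Complex.conj_ofReal]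
    simp [mul_comm]
  rw [h1, Measure.integral_comp_div (fun x => ((1 / (2 * Real.pi) : ℝ) : ℂ) ^ 2 *
        (starRingEnd ℂ ((𝓕 (toC f) : L2C) x) * (𝓕 (toC g) : L2C) x)), integral_const_mul, h2, h3, abs_of_pos Real.two_pi_pos]
  have : (Real.pi : ℂ) ≠ 0 := by exact_mod_cast Real.pi_ne_zero
  rw [Complex.real_smul]
  push_cast
  field_simp

lemma memLp_hat (f : L2R) : MemLp (hat f) 2 volume := by
  refine (memLp_two_iff_integrable_sq_norm (aestronglyMeasurable_hat f)).2 ?_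
  have h1 : Integrable (fun x => ‖(𝓕 (toC f) : L2C) x‖ ^ 2) :=
    (memLp_two_iff_integrable_sq_norm (Lp.aestronglyMeasurable _)).1 (Lp.memLp _)
  have h2 := (h1.comp_div two_pi_ne_zero).const_mul ((1 / (2 * Real.pi)) ^ 2)
  refine h2.congr (Eventually.of_forall fun k => ?_)
  simp only
  rw [hat_def, norm_mul, mul_pow, Complex.norm_real, Real.norm_eq_abs, sq_abs]

/-- By injectivity of the Fourier transform, Hermitian symmetry of g makes the inverse transform
invariant under conjugation, hence real. The function `G` in the proof undoes the normalization
built into `hat`. -/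
lemma exists_hat_eq {g : ℝ → ℂ} (hg : MemLp g 2 volume)
    (hH : ∀ᵐ k, g (-k) = starRingEnd ℂ (g k)) : ∃ f : L2R, hat f =ᵐ[volume] g := by
  set a : ℝ := 2 * Real.pi with ha
  have ha0 : a ≠ 0 := two_pi_ne_zero
  have hqm : Measure.QuasiMeasurePreserving (fun k : ℝ => k * a) := by
    have := quasiMeasurePreserving_div_const (inv_ne_zero ha0)
    simpa [div_eq_mul_inv] using this
  set G : ℝ → ℂ := fun x => (a : ℂ) * g (x * a) with hG
  have hGm : AEStronglyMeasurable G volume :=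
    (hg.1.comp_quasiMeasurePreserving hqm).const_mul _
  have hG2 : MemLp G 2 volume := by
    refine (memLp_two_iff_integrable_sq_norm hGm).2 ?_
    have h1 : Integrable (fun x => ‖g x‖ ^ 2) := (memLp_two_iff_integrable_sq_norm hg.1).1 hg
    refine ((h1.comp_mul_right' ha0).const_mul (a ^ 2)).congr (Eventually.of_forall fun k => ?_)
    simp only [hG, norm_mul, mul_pow, Complex.norm_real, Real.norm_eq_abs, sq_abs]
  set Gl : L2C := hG2.toLp G with hGl
  set F : L2C := (Lp.fourierTransformₗᵢ ℝ ℂ).symm Gl with hF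
  have hFG : (𝓕 F : L2C) = Gl := (Lp.fourierTransformₗᵢ ℝ ℂ).apply_symm_apply Gl
  have hGH : reflL (conjL Gl) = Gl := by
    apply Lp.ext
    have h2 := (Measure.measurePreserving_neg (volume : Measure ℝ)).quasiMeasurePreserving.ae
      (coeFn_conjL Gl)
    have h3 := (Measure.measurePreserving_neg (volume : Measure ℝ)).quasiMeasurePreserving.ae
      hG2.coeFn_toLp
    filter_upwards [coeFn_reflL (conjL Gl), h2, h3, hG2.coeFn_toLp, hqm.ae hH] with x h4 h5 h6 h7 h8
    rw [h4, h5, h6, h7]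
    simp only [hG]
    rw [neg_mul, h8, map_mul, Complex.conj_conj, Complex.conj_ofReal]
  have hFc : conjL F = F := by
    apply (Lp.fourierTransformₗᵢ ℝ ℂ).injective
    have := fourier_conjL F
    rw [hFG, hGH, ← hFG] at this
    exact this
  set f : L2R := Complex.reCLM.compLp F with hf
  have hfF : toC f = F := by
    apply Lp.ext
    have h1 : conjL F =ᵐ[volume] F := by rw [hFc]
    filter_upwards [coeFn_toC f, Complex.reCLM.coeFn_compLp F, coeFn_conjL F, h1] with x h2 h3 h4 h5
    rw [h2, h3]
    rw [h4] at h5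
    exact Complex.conj_eq_iff_re.1 h5
  refine ⟨f, ?_⟩
  filter_upwards [hat_ae_of_ae hG2.coeFn_toLp] with k hk
  rw [hat_def, hfF, hFG, hk]
  simp only [hG]
  rw [← ha, div_mul_cancel₀ _ ha0, ← mul_assoc, ← Complex.ofReal_mul, one_div_mul_cancel ha0]
  simp

/-! ### Hermitian representatives and weighted energies -/

/-- Averaging a measurable version with its conjugate reflection makes the symmetry hold at every
point, as the changes of variables in the trilinear integrals require. -/
lemma exists_rep (f : L2R) : ∃ g : ℝ → ℂ, Measurable g ∧ Herm g ∧ hat f =ᵐ[volume] g := by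
  have hm := aestronglyMeasurable_hat f
  set g0 := hm.mk with hg0
  have hg0m : Measurable g0 := hm.stronglyMeasurable_mk.measurable
  refine ⟨fun k => (g0 k + starRingEnd ℂ (g0 (-k))) / 2, ?_, ?_, ?_⟩
  · have : Measurable (fun k => starRingEnd ℂ (g0 (-k))) :=
      Complex.continuous_conj.measurable.comp (by fun_prop)
    fun_prop
  · intro k
    simp only [neg_neg, map_div₀, map_add, Complex.conj_conj]
    rw [add_comm, map_ofNat]
  · have h1 := hm.ae_eq_mk
    have h2 := (Measure.measurePreserving_neg (volume : Measure ℝ)).quasiMeasurePreserving.ae h1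
    filter_upwards [h1, h2, hat_neg_arg f] with k h3 h4 h5
    rw [hg0, ← h3, ← h4, h5, Complex.conj_conj]; ring

/-- A measurable Hermitian representative of the Fourier transform. -/
def rep (f : L2R) : ℝ → ℂ := (exists_rep f).choose

@[fun_prop]
lemma measurable_rep (f : L2R) : Measurable (rep f) := (exists_rep f).choose_spec.1

lemma herm_rep (f : L2R) : Herm (rep f) := (exists_rep f).choose_spec.2.1

lemma hat_ae_eq_rep (f : L2R) : hat f =ᵐ[volume] rep f := (exists_rep f).choose_spec.2.2

lemma rep_add (f g : L2R) : rep (f + g) =ᵐ[volume] fun k => rep f k + rep g k := by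
  filter_upwards [hat_add f g, hat_ae_eq_rep f, hat_ae_eq_rep g, hat_ae_eq_rep (f + g)]
    with k h1 h2 h3 h4
  rw [← h4, h1, h2, h3]

lemma rep_smul (c : ℝ) (f : L2R) : rep (c • f) =ᵐ[volume] fun k => (c : ℂ) * rep f k := by
  filter_upwards [hat_smul c f, hat_ae_eq_rep f, hat_ae_eq_rep (c • f)] with k h1 h2 h4
  rw [← h4, h1, h2]

lemma rep_neg (f : L2R) : rep (-f) =ᵐ[volume] fun k => -rep f k := by
  have := rep_smul (-1) f
  rw [neg_one_smul] at this
  filter_upwards [this] with k hk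
  rw [hk]; simp

lemma rep_sub (f g : L2R) : rep (f - g) =ᵐ[volume] fun k => rep f k + -rep g k := by
  rw [sub_eq_add_neg]
  filter_upwards [rep_add f (-g), rep_neg g] with k h1 h2
  rw [h1, h2]

lemma memLp_rep (f : L2R) : MemLp (rep f) 2 volume := (memLp_hat f).ae_eq (hat_ae_eq_rep f)

lemma inner_eq_integral_rep (f g : L2R) :
    ((inner ℝ f g : ℝ) : ℂ) = 2 * Real.pi * ∫ k, starRingEnd ℂ (rep f k) * rep g k := by
  rw [inner_eq_integral_hat]
  congr 1
  apply integral_congr_ae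
  filter_upwards [hat_ae_eq_rep f, hat_ae_eq_rep g] with k h1 h2
  rw [h1, h2]

lemma energy_one_eq_eLpNorm_sq (g : ℝ → ℂ) :
    energy (fun _ => 1) g = eLpNorm g 2 volume ^ 2 := by
  rw [eLpNorm_eq_lintegral_rpow_enorm_toReal (by norm_num) (by norm_num)]
  unfold energy
  rw [← ENNReal.rpow_natCast, ← ENNReal.rpow_mul]
  norm_num

lemma energy_one_lt_top_iff {g : ℝ → ℂ} (hg : Measurable g) :
    energy (fun _ => 1) g < ∞ ↔ MemLp g 2 volume := by
  rw [energy_one_eq_eLpNorm_sq]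
  constructor
  · intro h
    refine ⟨hg.aestronglyMeasurable, ?_⟩
    by_contra hc
    rw [not_lt, top_le_iff] at hc
    simp [hc] at h
  · intro h
    exact ENNReal.pow_lt_top h.2

lemma energy_one_rep (f : L2R) :
    energy (fun _ => 1) (rep f) = ENNReal.ofReal (‖f‖ ^ 2 / (2 * Real.pi)) := by
  have h1 := inner_eq_integral_rep f f
  have h2 : ∫ k, starRingEnd ℂ (rep f k) * rep f k = ((∫ k, ‖rep f k‖ ^ 2 : ℝ) : ℂ) := by
    rw [← integral_complex_ofReal]
    congr 1; funext k
    rw [mul_comm, Complex.mul_conj, Complex.normSq_eq_norm_sq]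
  rw [h2, real_inner_self_eq_norm_sq] at h1
  have h3 : ‖f‖ ^ 2 = 2 * Real.pi * ∫ k, ‖rep f k‖ ^ 2 := by exact_mod_cast h1
  rw [h3, mul_div_cancel_left₀ _ two_pi_ne_zero, ofReal_integral_eq_lintegral_ofReal]
  · unfold energy
    congr 1; funext k
    rw [ENNReal.ofReal_one, one_mul, ENNReal.ofReal_pow (norm_nonneg _), ofReal_norm]
  · exact (memLp_two_iff_integrable_sq_norm (memLp_rep f).1).1 (memLp_rep f)
  · exact Eventually.of_forall fun k => by positivity

lemma exists_rep_eq {g : ℝ → ℂ} (hg : MemLp g 2 volume) (hH : Herm g) :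
    ∃ f : L2R, rep f =ᵐ[volume] g := by
  obtain ⟨f, hf⟩ := exists_hat_eq hg (Eventually.of_forall hH)
  exact ⟨f, (hat_ae_eq_rep f).symm.trans hf⟩

open Classical in
/-- The real-valued function with a given Fourier transform (zero if there is none). -/
def ofHat (g : ℝ → ℂ) : L2R :=
  if h : ∃ f : L2R, rep f =ᵐ[volume] g then h.choose else 0

lemma rep_ofHat {g : ℝ → ℂ} (hg : MemLp g 2 volume) (hH : Herm g) :
    rep (ofHat g) =ᵐ[volume] g := by
  have h := exists_rep_eq hg hH
  rw [ofHat, dif_pos h]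
  exact h.choose_spec

lemma eq_of_rep_ae_eq {f g : L2R} (h : rep f =ᵐ[volume] rep g) : f = g := by
  have h1 : energy (fun _ => 1) (rep (f - g)) = 0 := by
    unfold energy
    rw [← lintegral_zero (μ := (volume : Measure ℝ))]
    apply lintegral_congr_ae
    filter_upwards [rep_sub f g, h] with k h1 h2
    rw [h1, h2]; simp
  rw [energy_one_rep, ENNReal.ofReal_eq_zero] at h1
  have h2 : 0 ≤ ‖f - g‖ ^ 2 / (2 * Real.pi) := by positivity
  have h3 : ‖f - g‖ ^ 2 / (2 * Real.pi) = 0 := le_antisymm h1 h2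
  rw [div_eq_zero_iff, or_iff_left two_pi_ne_zero, sq_eq_zero_iff, norm_eq_zero, sub_eq_zero] at h3
  exact h3

/-- The weighted square integral of the Fourier transform. -/
def enE (w : ℝ → ℝ) (f : L2R) : ℝ≥0∞ := energy w (rep f)

lemma energy_congr {w : ℝ → ℝ} {g h : ℝ → ℂ} (H : g =ᵐ[volume] h) : energy w g = energy w h := by
  unfold energy
  apply lintegral_congr_ae
  filter_upwards [H] with k hk
  rw [hk]

lemma sobNorm_eq (s : ℝ) (f : L2R) : sobNorm s f = enE (sobWeight s) f ^ (1 / 2 : ℝ) := by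
  unfold sobNorm enE
  rw [← energy_congr (hat_ae_eq_rep f)]; rfl

lemma homNorm_eq (s : ℝ) (f : L2R) :
    homNorm s f = enE (fun k => |k| ^ (2 * s)) f ^ (1 / 2 : ℝ) := by
  unfold homNorm enE
  rw [← energy_congr (hat_ae_eq_rep f)]; rfl

lemma bilinHat_eq (f g : L2R) : bilinHat f g = kconv (rep f) (rep g) := by
  funext k
  unfold bilinHat kconv
  apply integral_congr_ae
  have h1 := (Measure.measurePreserving_sub_left volume k).quasiMeasurePreserving.ae
    (hat_ae_eq_rep f)
  filter_upwards [h1, hat_ae_eq_rep g] with l h2 h3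
  rw [h2, h3]

/-! ### Fourier multipliers -/

lemma norm_le_of_energy_le {f g : L2R} {C : ℝ} (hC : 0 ≤ C)
    (h : enE (fun _ => 1) f ≤ ENNReal.ofReal (C ^ 2) * enE (fun _ => 1) g) :
    ‖f‖ ≤ C * ‖g‖ := by
  unfold enE at h
  rw [energy_one_rep, energy_one_rep, ← ENNReal.ofReal_mul (by positivity),
    ENNReal.ofReal_le_ofReal_iff (by positivity), ← mul_div_assoc,
    div_le_div_iff_of_pos_right Real.two_pi_pos, ← mul_pow] at h
  exact (pow_le_pow_iff_left₀ (norm_nonneg _) (by positivity) two_ne_zero).1 h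

/-- Symbols of bounded Fourier multipliers that preserve real-valued functions. -/
structure IsSymbol (w : ℝ → ℝ) : Prop where
  measurable : Measurable w
  even : ∀ x, w (-x) = w x
  bdd : ∃ C, ∀ x, |w x| ≤ C

lemma IsSymbol.memLp {w : ℝ → ℝ} (h : IsSymbol w) (f : L2R) :
    MemLp (fun k => (w k : ℂ) * rep f k) 2 volume := by
  obtain ⟨C, hC⟩ := h.bdd
  have hm := h.measurable
  refine MemLp.of_le_mul (c := C) (memLp_rep f) (by fun_prop) (Eventually.of_forall fun k => ?_)
  rw [norm_mul, Complex.norm_real]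
  exact mul_le_mul_of_nonneg_right (hC k) (norm_nonneg _)

lemma IsSymbol.herm {w : ℝ → ℝ} (h : IsSymbol w) (f : L2R) :
    Herm (fun k => (w k : ℂ) * rep f k) := by
  intro k
  simp only
  rw [h.even, herm_rep f, map_mul, Complex.conj_ofReal]

lemma IsSymbol.rep_ofHat {w : ℝ → ℝ} (h : IsSymbol w) (f : L2R) :
    rep (ofHat fun k => (w k : ℂ) * rep f k) =ᵐ[volume] fun k => (w k : ℂ) * rep f k :=
  SurfaceWave.rep_ofHat (h.memLp f) (h.herm f)

open Classical in
/-- The Fourier multiplier with symbol `w`. -/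
def mulL (w : ℝ → ℝ) : L2R →L[ℝ] L2R :=
  if h : IsSymbol w then
    LinearMap.mkContinuous
      { toFun := fun f => ofHat fun k => (w k : ℂ) * rep f k
        map_add' := fun f g => by
          apply eq_of_rep_ae_eq
          filter_upwards [h.rep_ofHat (f + g), h.rep_ofHat f, h.rep_ofHat g, rep_add f g,
            rep_add (ofHat fun k => (w k : ℂ) * rep f k) (ofHat fun k => (w k : ℂ) * rep g k)]
            with k h1 h2 h3 h4 h5
          rw [h1, h5, h2, h3, h4]; ring
        map_smul' := fun c f => by
          apply eq_of_rep_ae_eq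
          filter_upwards [h.rep_ofHat (c • f), h.rep_ofHat f, rep_smul c f,
            rep_smul c (ofHat fun k => (w k : ℂ) * rep f k)] with k h1 h2 h3 h4
          rw [RingHom.id_apply, h1, h4, h2, h3]; ring }
      |h.bdd.choose| (fun f => by
        refine norm_le_of_energy_le (abs_nonneg _) ?_
        have hb := h.bdd.choose_spec
        unfold enE
        simp only [LinearMap.coe_mk, AddHom.coe_mk]
        rw [energy_congr (h.rep_ofHat f)]
        unfold energy
        rw [← lintegral_const_mul' _ _ ENNReal.ofReal_ne_top]
        refine lintegral_mono fun k => ?_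
        simp only [ENNReal.ofReal_one, one_mul]
        rw [enorm_mul, mul_pow]
        gcongr
        rw [← ofReal_norm, Complex.norm_real, ← ENNReal.ofReal_pow (norm_nonneg _)]
        apply ENNReal.ofReal_le_ofReal
        gcongr
        exact (hb k).trans (le_abs_self _))
  else 0

lemma rep_mulL {w : ℝ → ℝ} (h : IsSymbol w) (f : L2R) :
    rep (mulL w f) =ᵐ[volume] fun k => (w k : ℂ) * rep f k := by
  rw [mulL, dif_pos h]
  exact h.rep_ofHat f

lemma IsWeight.isSymbol_sqrt {p C : ℝ} {w : ℝ → ℝ} (hw : IsWeight p w) (hC : ∀ x, w x ≤ C) :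
    IsSymbol (fun x => Real.sqrt (w x)) where
  measurable := hw.measurable.sqrt
  even x := by rw [hw.even]
  bdd := ⟨Real.sqrt C, fun x => by
    rw [abs_of_nonneg (Real.sqrt_nonneg _)]; exact Real.sqrt_le_sqrt (hC x)⟩

/-- The multiplier with symbol `√w`, so that `‖sqrtMul w f‖² = 2π ∫ w |f̂|²`. -/
def sqrtMul (w : ℝ → ℝ) : L2R →L[ℝ] L2R := mulL (fun x => Real.sqrt (w x))

section Bounded

variable {p C : ℝ} {w : ℝ → ℝ}

lemma inner_sqrtMul (hw : IsWeight p w) (hC : ∀ x, w x ≤ C) (f g : L2R) :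
    ((inner ℝ (sqrtMul w f) (sqrtMul w g) : ℝ) : ℂ)
      = 2 * Real.pi * ∫ k, (w k : ℂ) * starRingEnd ℂ (rep f k) * rep g k := by
  rw [inner_eq_integral_rep]
  congr 1
  apply integral_congr_ae
  filter_upwards [rep_mulL (hw.isSymbol_sqrt hC) f, rep_mulL (hw.isSymbol_sqrt hC) g]
    with k h1 h2
  unfold sqrtMul
  rw [h1, h2, map_mul, Complex.conj_ofReal]
  have : (w k : ℂ) = (Real.sqrt (w k) : ℂ) * (Real.sqrt (w k) : ℂ) := by
    rw [← Complex.ofReal_mul, Real.mul_self_sqrt (hw.nonneg k)]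
  rw [this]; ring

lemma enE_eq_norm_sqrtMul (hw : IsWeight p w) (hC : ∀ x, w x ≤ C) (f : L2R) :
    enE w f = ENNReal.ofReal (‖sqrtMul w f‖ ^ 2 / (2 * Real.pi)) := by
  rw [← energy_one_rep, sqrtMul, energy_congr (rep_mulL (hw.isSymbol_sqrt hC) f)]
  unfold enE energy
  congr 1; funext k
  rw [enorm_mul, mul_pow, ENNReal.ofReal_one, one_mul, ← ofReal_norm (Complex.ofReal _),
    Complex.norm_real, Real.norm_of_nonneg (Real.sqrt_nonneg _),
    ← ENNReal.ofReal_pow (Real.sqrt_nonneg _), Real.sq_sqrt (hw.nonneg k)]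

end Bounded

/-! ### Sobolev energies -/

lemma enE_congr_ae {w : ℝ → ℝ} {f : L2R} {g : ℝ → ℂ} (h : rep f =ᵐ[volume] g) :
    enE w f = energy w g := energy_congr h

lemma enE_add_le {w : ℝ → ℝ} (hw : Measurable w) (f g : L2R) :
    enE w (f + g) ≤ 2 * (enE w f + enE w g) := by
  rw [enE_congr_ae (rep_add f g)]
  unfold enE energy
  rw [← lintegral_add_left (by fun_prop), ← lintegral_const_mul' _ _ (by simp)]
  refine lintegral_mono fun k => ?_
  calc ENNReal.ofReal (w k) * ‖rep f k + rep g k‖ₑ ^ 2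
      ≤ ENNReal.ofReal (w k) * (2 * (‖rep f k‖ₑ ^ 2 + ‖rep g k‖ₑ ^ 2)) := by
        gcongr
        exact (pow_le_pow_left' (enorm_add_le _ _) 2).trans (ennreal_add_sq_le _ _)
    _ = _ := by ring

lemma enE_neg (w : ℝ → ℝ) (f : L2R) : enE w (-f) = enE w f := by
  rw [enE_congr_ae (rep_neg f), energy_neg]; rfl

lemma enE_sub_le {w : ℝ → ℝ} (hw : Measurable w) (f g : L2R) :
    enE w (f - g) ≤ 2 * (enE w f + enE w g) := by
  rw [sub_eq_add_neg, ← enE_neg w g]; exact enE_add_le hw f (-g)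

lemma enE_smul (w : ℝ → ℝ) (c : ℝ) (f : L2R) :
    enE w (c • f) = ENNReal.ofReal (c ^ 2) * enE w f := by
  rw [enE_congr_ae (rep_smul c f)]
  unfold enE energy
  rw [← lintegral_const_mul' _ _ ENNReal.ofReal_ne_top]
  congr 1; funext k
  rw [enorm_mul, mul_pow, ← ofReal_norm (c : ℂ), Complex.norm_real, ← ENNReal.ofReal_pow
    (norm_nonneg _), Real.norm_eq_abs, sq_abs]; ring

lemma enE_mono {v w : ℝ → ℝ} (h : ∀ x, v x ≤ w x) (f : L2R) : enE v f ≤ enE w f :=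
  lintegral_mono fun k => by gcongr; exact h k

lemma enE_one (f : L2R) : enE (fun _ => 1) f = ENNReal.ofReal (‖f‖ ^ 2 / (2 * Real.pi)) :=
  energy_one_rep f

lemma enE_one_le (s : ℝ) (f : L2R) : enE (fun _ => 1) f ≤ enE (sobWeight s) f :=
  enE_mono (one_le_sobWeight s) f

lemma norm_sq_le_of_enE_le {f : L2R} {c : ℝ} (hc : 0 ≤ c)
    (h : enE (fun _ => 1) f ≤ ENNReal.ofReal c) : ‖f‖ ^ 2 ≤ 2 * Real.pi * c := by
  rw [enE_one, ENNReal.ofReal_le_ofReal_iff hc, div_le_iff₀ Real.two_pi_pos] at h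
  linarith

lemma memSob_iff (s : ℝ) (f : L2R) : MemSob s f ↔ enE (sobWeight s) f < ∞ := by
  unfold MemSob
  rw [sobNorm_eq, ENNReal.rpow_lt_top_iff_of_pos (by norm_num)]

lemma tendsto_sobNorm_iff {α : Type*} {l : Filter α} {s : ℝ} {u : α → L2R} :
    Tendsto (fun r => sobNorm s (u r)) l (𝓝 0)
      ↔ Tendsto (fun r => enE (sobWeight s) (u r)) l (𝓝 0) := by
  constructor
  · intro h
    have h2 := (ENNReal.continuous_pow 2).tendsto 0 |>.comp h
    simp only [ne_eq, OfNat.ofNat_ne_zero, not_false_eq_true, zero_pow] at h2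
    refine h2.congr fun r => ?_
    simp only [Function.comp]
    rw [sobNorm_eq, ← ENNReal.rpow_natCast, ← ENNReal.rpow_mul]; norm_num
  · intro h
    have h2 := (ENNReal.continuous_rpow_const (y := 1 / 2)).tendsto 0 |>.comp h
    rw [ENNReal.zero_rpow_of_pos (by norm_num)] at h2
    refine h2.congr fun r => ?_
    simp only [Function.comp]
    rw [sobNorm_eq]

/-- Monotone convergence for truncated weights. -/
lemma enE_le_of_trunc {p : ℝ} {w : ℝ → ℝ} (hw : IsWeight p w) {f : L2R} {K : ℝ≥0∞}
    (h : ∀ n : ℕ, enE (fun x => w (min |x| n)) f ≤ K) : enE w f ≤ K := by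
  have hw' := hw.measurable
  have h1 : enE w f ≤ liminf (fun n : ℕ => enE (fun x => w (min |x| n)) f) atTop := by
    refine le_trans (lintegral_mono fun k => ?_) (lintegral_liminf_le' fun n => ?_)
    · refine le_of_eq (Tendsto.liminf_eq ?_).symm
      obtain ⟨N, hN⟩ := exists_nat_ge |k|
      refine tendsto_const_nhds.congr' ?_
      filter_upwards [eventually_ge_atTop N] with n hn
      rw [hw.trunc_eq (hN.trans (by exact_mod_cast hn))]
    · have := (hw.trunc (ρ := n) (Nat.cast_nonneg n)).measurable
      fun_prop
  refine h1.trans ?_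
  refine (liminf_le_liminf (Eventually.of_forall h)).trans ?_
  simp

/-- Lower semicontinuity of weighted energies with respect to `L²` convergence. -/
lemma enE_le_of_tendsto {p : ℝ} {w : ℝ → ℝ} (hw : IsWeight p w) {α : Type*} {l : Filter α}
    [l.NeBot] {u : α → L2R} {f : L2R} {K : ℝ≥0∞} (hu : Tendsto u l (𝓝 f))
    (h : ∀ᶠ a in l, enE w (u a) ≤ K) : enE w f ≤ K := by
  refine enE_le_of_trunc hw fun n => ?_
  have hn := hw.trunc (ρ := n) (Nat.cast_nonneg n)
  have hb := hw.trunc_le_const (ρ := n) (Nat.cast_nonneg n)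
  -- For a bounded weight the energy is the squared norm of a bounded multiplier, hence continuous
  -- on L².
  have hc : Tendsto (fun a => enE (fun x => w (min |x| n)) (u a)) l
      (𝓝 (enE (fun x => w (min |x| n)) f)) := by
    simp_rw [enE_eq_norm_sqrtMul hn hb]
    apply (ENNReal.continuous_ofReal.tendsto _).comp
    exact ((((sqrtMul _).continuous.tendsto f).comp hu).norm.pow 2).div_const _
  refine le_of_tendsto hc ?_
  filter_upwards [h] with a ha
  exact (enE_mono (hw.trunc_le (Nat.cast_nonneg n)) _).trans ha

/-! ### The bilinear form -/

/-- `-∂_θ a(f, g)`. -/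
def bil (f g : L2R) : L2R := ofHat fun k => -Complex.I * ((k : ℂ) * kconv (rep f) (rep g) k)

lemma enorm_neg_I_mul (z : ℂ) : ‖-Complex.I * z‖ₑ = ‖z‖ₑ := by
  rw [enorm_mul, ← ofReal_norm (-Complex.I)]; simp

lemma energy_neg_I_mul (w : ℝ → ℝ) (g : ℝ → ℂ) :
    energy w (fun k => -Complex.I * g k) = energy w g := by
  unfold energy; simp_rw [enorm_neg_I_mul]

section Bilinear

variable {s : ℝ} {f g : L2R}

lemma rep_bil (hs : 1 < s) (hf : enE (sobWeight s) f < ∞) (hg : enE (sobWeight s) g < ∞) :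
    rep (bil f g) =ᵐ[volume] fun k => -Complex.I * ((k : ℂ) * kconv (rep f) (rep g) k) := by
  have hm := measurable_kconv (measurable_rep f) (measurable_rep g)
  apply rep_ofHat
  · rw [← energy_one_lt_top_iff (by fun_prop), energy_neg_I_mul]
    refine (energy_one_le (s := s - 1) _).trans_lt ?_
    refine (energy_mul_kconv_le hs.le (measurable_rep f) (measurable_rep g)).trans_lt ?_
    exact ENNReal.mul_lt_top (bilinConst_lt_top hs) (ENNReal.mul_lt_top hf hg)
  · intro k
    simp only
    rw [(herm_rep f).kconv (herm_rep g)]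
    simp

lemma enE_bil_le (hs : 1 < s) (hf : enE (sobWeight s) f < ∞) (hg : enE (sobWeight s) g < ∞) :
    enE (sobWeight (s - 1)) (bil f g)
      ≤ bilinConst s * (enE (sobWeight s) f * enE (sobWeight s) g) := by
  rw [enE_congr_ae (rep_bil hs hf hg), energy_neg_I_mul]
  exact energy_mul_kconv_le hs.le (measurable_rep f) (measurable_rep g)

lemma kconv_congr_ae {g g' h h' : ℝ → ℂ} (hg : g =ᵐ[volume] g') (hh : h =ᵐ[volume] h') :
    kconv g h = kconv g' h' := by
  funext k
  unfold kconv
  apply integral_congr_ae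
  have h1 := (Measure.measurePreserving_sub_left volume k).quasiMeasurePreserving.ae hg
  filter_upwards [h1, hh] with l h2 h3
  rw [h2, h3]

lemma enE_add_lt_top (hf : enE (sobWeight s) f < ∞) (hg : enE (sobWeight s) g < ∞) :
    enE (sobWeight s) (f + g) < ∞ :=
  (enE_add_le (measurable_sobWeight s) f g).trans_lt
    (ENNReal.mul_lt_top (by simp) (ENNReal.add_lt_top.2 ⟨hf, hg⟩))

lemma enE_sub_lt_top (hf : enE (sobWeight s) f < ∞) (hg : enE (sobWeight s) g < ∞) :
    enE (sobWeight s) (f - g) < ∞ :=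
  (enE_sub_le (measurable_sobWeight s) f g).trans_lt
    (ENNReal.mul_lt_top (by simp) (ENNReal.add_lt_top.2 ⟨hf, hg⟩))

/-- Polarization: it reduces Lipschitz and stability estimates for the nonlinearity to bilinear
bounds. -/
lemma bil_self_sub (hs : 1 < s) (hf : enE (sobWeight s) f < ∞) (hg : enE (sobWeight s) g < ∞) :
    bil f f - bil g g = bil (f - g) (f + g) := by
  apply eq_of_rep_ae_eq
  have h := kconv_congr_ae (rep_sub f g) (rep_add f g)
  filter_upwards [rep_sub (bil f f) (bil g g), rep_bil hs hf hf, rep_bil hs hg hg,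
    rep_bil hs (enE_sub_lt_top hf hg) (enE_add_lt_top hf hg)] with k h1 h2 h3 h4
  rw [h1, h2, h3, h4, h, ← kconv_self_sub hs.le (measurable_rep f) (measurable_rep g) hf hg]
  ring

/-- The weighted `L¹` norm of the Fourier transform that controls the energy estimates. -/
def wn (f : L2R) : ℝ := (wiener (3 / 2) (rep f)).toReal

lemma wn_nonneg (f : L2R) : 0 ≤ wn f := ENNReal.toReal_nonneg

lemma wiener_rep_lt_top (hs : 2 < s) (hf : enE (sobWeight s) f < ∞) :
    wiener (3 / 2) (rep f) < ∞ :=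
  wiener_lt_top (by norm_num) (by linarith) (measurable_rep f) hf

lemma energy_one_rep_lt_top (f : L2R) : energy (fun _ => 1) (rep f) < ∞ := by
  rw [energy_one_rep]; exact ENNReal.ofReal_lt_top

lemma wn_sq_le (hs : 2 < s) (hf : enE (sobWeight s) f < ∞) :
    wn f ^ 2 ≤ (wienerConst (3 / 2) s).toReal * (enE (sobWeight s) f).toReal := by
  unfold wn
  rw [← ENNReal.toReal_pow, ← ENNReal.toReal_mul]
  exact ENNReal.toReal_mono (ENNReal.mul_lt_top
    (lintegral_rpow_div_sobWeight_lt_top (by norm_num) (by linarith)) hf).ne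
    (wiener_sq_le (measurable_rep f))

lemma wn_sub_le (hs : 2 < s) (hf : enE (sobWeight s) f < ∞) (hg : enE (sobWeight s) g < ∞) :
    |wn f - wn g| ≤ wn (f - g) := by
  have key : ∀ f g : L2R, enE (sobWeight s) f < ∞ → enE (sobWeight s) g < ∞ →
      wn f ≤ wn g + wn (f - g) := by
    intro f g hf hg
    have hfg := enE_sub_lt_top hf hg
    unfold wn
    rw [← ENNReal.toReal_add (wiener_rep_lt_top hs hg).ne (wiener_rep_lt_top hs hfg).ne]
    refine ENNReal.toReal_mono (ENNReal.add_lt_top.2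
      ⟨wiener_rep_lt_top hs hg, wiener_rep_lt_top hs hfg⟩).ne ?_
    unfold wiener
    rw [← lintegral_add_left (by fun_prop)]
    apply lintegral_mono_ae
    filter_upwards [rep_sub f g] with k hk
    rw [← mul_add]
    gcongr
    rw [hk]
    calc ‖rep f k‖ₑ = ‖rep g k + (rep f k + -rep g k)‖ₑ := by congr 1; ring
      _ ≤ _ := enorm_add_le _ _
  have e : wn (f - g) = wn (g - f) := by
    unfold wn wiener
    congr 1
    apply lintegral_congr_ae
    filter_upwards [rep_sub f g, rep_sub g f] with k h1 h2
    rw [h1, h2, ← enorm_neg (rep g k + -rep f k)]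
    congr 2; ring
  rw [abs_le]
  have h1 := key f g hf hg
  have h2 := key g f hg hf
  rw [← e] at h2
  constructor <;> linarith

/-- The a priori estimate in Hilbert space form. The constant involves p alone, not C; the factors
2π on the two sides cancel. -/
lemma abs_inner_sqrtMul_bil_le {p C : ℝ} {w : ℝ → ℝ} (hp : 1 ≤ p) (hw : IsWeight p w)
    (hC : ∀ x, w x ≤ C) (hs : 2 < s) (hf : enE (sobWeight s) f < ∞) :
    |inner ℝ (sqrtMul w f) (sqrtMul w (bil f f))|
      ≤ 2 * 2 ^ p * (wn f * ‖sqrtMul w f‖ ^ 2) := by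
  have h1 := inner_sqrtMul hw hC f (bil f f)
  have h2 : ∫ k, (w k : ℂ) * starRingEnd ℂ (rep f k) * rep (bil f f) k = -Complex.I *
      ∫ k, (w k : ℂ) * starRingEnd ℂ (rep f k) * ((k : ℂ) * kconv (rep f) (rep f) k) := by
    rw [← integral_const_mul]
    apply integral_congr_ae
    filter_upwards [rep_bil (by linarith : 1 < s) hf hf] with k hk
    rw [hk]; ring
  have hwn := wiener_rep_lt_top hs hf
  have h3 := enorm_integral_weight_conj_mul_kconv_le hp hw hC (measurable_rep f) (herm_rep f)
    hwn (energy_one_rep_lt_top f)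
  have hpos : (0 : ℝ) ≤ 2 * 2 ^ p := by positivity
  have hE := enE_eq_norm_sqrtMul hw hC f
  unfold enE at hE
  rw [hE, ← ENNReal.ofReal_toReal hwn.ne, ← ENNReal.ofReal_mul ENNReal.toReal_nonneg,
    ← ENNReal.ofReal_mul hpos, ← ofReal_norm, ENNReal.ofReal_le_ofReal_iff (by positivity)] at h3
  rw [h2] at h1
  have h4 := congrArg norm h1
  rw [Complex.norm_real, Real.norm_eq_abs, norm_mul, norm_mul, norm_mul] at h4
  simp only [norm_neg, Complex.norm_I, one_mul, Complex.norm_real, Complex.norm_ofNat,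
    Real.norm_of_nonneg Real.pi_pos.le] at h4
  rw [h4]
  calc _ ≤ 2 * Real.pi * (2 * 2 ^ p * ((wiener (3 / 2) (rep f)).toReal *
        (‖sqrtMul w f‖ ^ 2 / (2 * Real.pi)))) :=
        mul_le_mul_of_nonneg_left h3 (by positivity)
    _ = _ := by unfold wn; field_simp

lemma inner_bil_self (hs : 2 < s) (hf : enE (sobWeight s) f < ∞) : inner ℝ f (bil f f) = 0 := by
  have h1 := inner_eq_integral_rep f (bil f f)
  have h2 : ∫ k, starRingEnd ℂ (rep f k) * rep (bil f f) k = -Complex.I *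
      ∫ k, starRingEnd ℂ (rep f k) * ((k : ℂ) * kconv (rep f) (rep f) k) := by
    rw [← integral_const_mul]
    apply integral_congr_ae
    filter_upwards [rep_bil (by linarith : 1 < s) hf hf] with k hk
    rw [hk]; ring
  rw [h2, integral_conj_mul_kconv_self (measurable_rep f) (herm_rep f)
    (wiener_rep_lt_top hs hf) (energy_one_rep_lt_top f)] at h1
  exact_mod_cast (by simpa using h1)

/-- Stability estimate: with f a difference of two solutions and g their sum, f enters the bound
only through its L² norm. -/
lemma abs_inner_bil_le (hs : 2 < s) (hf : enE (sobWeight s) f < ∞)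
    (hg : enE (sobWeight s) g < ∞) : |inner ℝ f (bil f g)| ≤ wn g * ‖f‖ ^ 2 := by
  have h1 := inner_eq_integral_rep f (bil f g)
  have h2 : ∫ k, starRingEnd ℂ (rep f k) * rep (bil f g) k = -Complex.I *
      ∫ k, starRingEnd ℂ (rep f k) * ((k : ℂ) * kconv (rep f) (rep g) k) := by
    rw [← integral_const_mul]
    apply integral_congr_ae
    filter_upwards [rep_bil (by linarith : 1 < s) hf hg] with k hk
    rw [hk]; ring
  have hwn := wiener_rep_lt_top hs hg
  have h3 := enorm_integral_conj_mul_kconv_le (measurable_rep f) (measurable_rep g) (herm_rep f)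
    (wiener_rep_lt_top hs hf) (energy_one_rep_lt_top f) (energy_one_rep_lt_top g)
  rw [energy_one_rep, ← ENNReal.ofReal_toReal hwn.ne, ← ENNReal.ofReal_mul ENNReal.toReal_nonneg,
    ← ofReal_norm, ENNReal.ofReal_le_ofReal_iff (by positivity)] at h3
  rw [h2] at h1
  have h4 := congrArg norm h1
  rw [Complex.norm_real, Real.norm_eq_abs, norm_mul, norm_mul, norm_mul] at h4
  simp only [norm_neg, Complex.norm_I, one_mul, Complex.norm_real, Complex.norm_ofNat,
    Real.norm_of_nonneg Real.pi_pos.le] at h4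
  rw [h4]
  calc _ ≤ 2 * Real.pi * ((wiener (3 / 2) (rep g)).toReal * (‖f‖ ^ 2 / (2 * Real.pi))) :=
        mul_le_mul_of_nonneg_left h3 (by positivity)
    _ = _ := by unfold wn; field_simp

lemma norm_bil_sq_le (hs : 1 < s) (hf : enE (sobWeight s) f < ∞) (hg : enE (sobWeight s) g < ∞) :
    ‖bil f g‖ ^ 2 ≤ 2 * Real.pi * ((bilinConst s).toReal *
      ((enE (sobWeight s) f).toReal * (enE (sobWeight s) g).toReal)) := by
  apply norm_sq_le_of_enE_le (by positivity)
  refine (enE_one_le (s - 1) _).trans ((enE_bil_le hs hf hg).trans_eq ?_)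
  rw [ENNReal.ofReal_mul (by positivity), ENNReal.ofReal_mul (by positivity),
    ENNReal.ofReal_toReal (bilinConst_lt_top hs).ne, ENNReal.ofReal_toReal hf.ne,
    ENNReal.ofReal_toReal hg.ne]

end Bilinear

/-! ### Ordinary differential equations with a conserved norm, and Grönwall inequalities -/

section ODE

variable {E : Type*} [NormedAddCommGroup E] [InnerProductSpace ℝ E]

lemma norm_sq_const_of_inner_eq_zero {u u' : ℝ → E} {T : ℝ}
    (hu : ∀ t ∈ Set.Icc 0 T, HasDerivWithinAt u (u' t) (Set.Icc 0 T) t)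
    (h0 : ∀ t ∈ Set.Icc 0 T, inner ℝ (u t) (u' t) = 0) :
    ∀ t ∈ Set.Icc 0 T, ‖u t‖ ^ 2 = ‖u 0‖ ^ 2 := by
  have hd : ∀ t ∈ Set.Icc 0 T, HasDerivWithinAt (fun t => ‖u t‖ ^ 2) 0 (Set.Icc 0 T) t := by
    intro t ht
    have := (hu t ht).norm_sq
    rwa [h0 t ht, mul_zero] at this
  apply constant_of_has_deriv_right_zero
  · exact fun t ht => (hd t ht).continuousWithinAt
  · intro t ht
    exact (hd t ⟨ht.1, ht.2.le⟩).mono_of_mem_nhdsWithin (Icc_mem_nhdsGE_of_mem ht)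

/-- The field is first multiplied by c(u) = (1 + ‖u₀‖²) / (1 + ‖u‖²), which makes it bounded, so
that one application of Picard–Lindelöf covers [0, T]. Orthogonality survives the scalar factor and
conserves the norm, so c = 1 along the solution and the original equation holds. -/
lemma exists_global_solution [CompleteSpace E] {F : E → E} {C : ℝ} (hC : 0 ≤ C)
    (hF : ∀ u v, ‖F u - F v‖ ≤ C * (‖u‖ + ‖v‖) * ‖u - v‖) (hF0 : F 0 = 0)
    (horth : ∀ u, inner ℝ u (F u) = 0) (u₀ : E) {T : ℝ} (hT : 0 ≤ T) :
    ∃ u : ℝ → E, u 0 = u₀ ∧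
      ∀ t ∈ Set.Icc 0 T, HasDerivWithinAt u (F (u t)) (Set.Icc 0 T) t := by
  set A : ℝ := 1 + ‖u₀‖ ^ 2 with hA
  have hA0 : 0 < A := by positivity
  set c : E → ℝ := fun u => A / (1 + ‖u‖ ^ 2) with hc
  have hden : ∀ u : E, 0 < 1 + ‖u‖ ^ 2 := fun u => by positivity
  have hFn : ∀ u, ‖F u‖ ≤ C * ‖u‖ ^ 2 := by
    intro u
    have := hF u 0
    simp only [hF0, sub_zero, norm_zero, add_zero] at this
    linarith [this, show C * ‖u‖ * ‖u‖ = C * ‖u‖ ^ 2 by ring]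
  have hcn : ∀ u, 0 ≤ c u := fun u => by simp only [hc]; positivity
  have hcA : ∀ u, c u ≤ A := fun u => by
    simp only [hc]
    exact div_le_self hA0.le (by linarith [sq_nonneg ‖u‖])
  have hGL : ∀ u, ‖c u • F u‖ ≤ A * C := by
    intro u
    rw [norm_smul, Real.norm_of_nonneg (hcn u)]
    calc c u * ‖F u‖ ≤ c u * (C * ‖u‖ ^ 2) := mul_le_mul_of_nonneg_left (hFn u) (hcn u)
      _ = A * C * (‖u‖ ^ 2 / (1 + ‖u‖ ^ 2)) := by simp only [hc]; ring
      _ ≤ A * C * 1 := by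
          gcongr
          rw [div_le_one (hden u)]; linarith
      _ = A * C := mul_one _
  have hcc : ∀ u v, |c u - c v| ≤ A * ((‖u‖ + ‖v‖) * ‖u - v‖) := by
    intro u v
    have e : c u - c v = A * ((‖v‖ - ‖u‖) * (‖u‖ + ‖v‖)) / ((1 + ‖u‖ ^ 2) * (1 + ‖v‖ ^ 2)) := by
      simp only [hc]
      rw [div_sub_div _ _ (hden u).ne' (hden v).ne']
      congr 1; ring
    have h1 : (1 : ℝ) ≤ (1 + ‖u‖ ^ 2) * (1 + ‖v‖ ^ 2) :=
      one_le_mul_of_one_le_of_one_le (by linarith [sq_nonneg ‖u‖]) (by linarith [sq_nonneg ‖v‖])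
    rw [e, abs_div, abs_of_pos (mul_pos (hden u) (hden v))]
    refine (div_le_self (abs_nonneg _) h1).trans ?_
    rw [abs_mul, abs_mul, abs_of_pos hA0, abs_of_nonneg (by positivity : 0 ≤ ‖u‖ + ‖v‖),
      mul_comm |‖v‖ - ‖u‖|]
    gcongr
    rw [abs_sub_comm]; exact abs_norm_sub_norm_le u v
  -- At speed at most A C the solution stays within distance A C T of the datum up to time T.
  set a : ℝ := A * C * T with ha
  have ha0 : 0 ≤ a := by positivity
  set R : ℝ := ‖u₀‖ + a with hR
  have hR0 : 0 ≤ R := by positivity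
  set K : ℝ := A * (2 * R) * (C * R ^ 2) + A * (C * (2 * R)) with hK
  have hK0 : 0 ≤ K := by positivity
  have hLip : ∀ u v : E, ‖u‖ ≤ R → ‖v‖ ≤ R → ‖c u • F u - c v • F v‖ ≤ K * ‖u - v‖ := by
    intro u v hu hv
    have e : c u • F u - c v • F v = (c u - c v) • F u + c v • (F u - F v) := by
      rw [sub_smul, smul_sub]; abel
    rw [e]
    refine (norm_add_le _ _).trans ?_
    rw [norm_smul, norm_smul, Real.norm_eq_abs, Real.norm_of_nonneg (hcn v)]
    have huv : ‖u‖ + ‖v‖ ≤ 2 * R := by linarith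
    calc |c u - c v| * ‖F u‖ + c v * ‖F u - F v‖
        ≤ (A * ((2 * R) * ‖u - v‖)) * (C * R ^ 2) + A * (C * (2 * R) * ‖u - v‖) := by
          gcongr
          · exact (hcc u v).trans (by gcongr)
          · exact (hFn u).trans (by gcongr)
          · exact hcA v
          · exact (hF u v).trans (by gcongr)
      _ = K * ‖u - v‖ := by rw [hK]; ring
  have hball : ∀ u ∈ Metric.closedBall u₀ a, ‖u‖ ≤ R := by
    intro u hu
    rw [mem_closedBall_iff_norm] at hu
    calc ‖u‖ = ‖u₀ + (u - u₀)‖ := by congr 1; abel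
      _ ≤ ‖u₀‖ + ‖u - u₀‖ := norm_add_le _ _
      _ ≤ R := by rw [hR]; linarith
  have hPL : IsPicardLindelof (fun _ : ℝ => fun u : E => c u • F u)
      (⟨0, Set.left_mem_Icc.2 hT⟩ : Set.Icc 0 T) u₀ ⟨a, ha0⟩ 0 ⟨A * C, by positivity⟩ ⟨K, hK0⟩ :=
    { lipschitzOnWith := by
        intro t _
        apply LipschitzOnWith.of_dist_le_mul
        intro u hu v hv
        rw [dist_eq_norm, dist_eq_norm]
        exact hLip u v (hball u hu) (hball v hv)
      continuousOn := fun u _ => continuousOn_const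
      norm_le := fun t _ u _ => hGL u
      mul_max_le := by
        simp only [sub_zero, sub_self, max_eq_left hT, NNReal.coe_zero]
        exact le_of_eq ha.symm }
  obtain ⟨u, hu0, hu⟩ := hPL.exists_eq_forall_mem_Icc_hasDerivWithinAt₀
  refine ⟨u, hu0, fun t ht => ?_⟩
  have hconst := norm_sq_const_of_inner_eq_zero hu (fun t _ => by
    rw [inner_smul_right, horth, mul_zero]) t ht
  have hu0' : u 0 = u₀ := hu0
  have : c (u t) = 1 := by
    simp only [hc]
    rw [hconst, hu0', ← hA, div_self hA0.ne']
  have h := hu t ht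
  rwa [this, one_smul] at h

end ODE

/-- Grönwall's inequality with a variable coefficient. -/
lemma le_mul_exp_integral {f f' α : ℝ → ℝ} {T : ℝ} (hα : ContinuousOn α (Set.Icc 0 T))
    (hf : ∀ t ∈ Set.Icc 0 T, HasDerivWithinAt f (f' t) (Set.Icc 0 T) t)
    (hle : ∀ t ∈ Set.Icc 0 T, f' t ≤ α t * f t) :
    ∀ t ∈ Set.Icc 0 T, f t ≤ f 0 * Real.exp (∫ τ in 0..t, α τ) := by
  intro t ht
  have hT : (0 : ℝ) ≤ T := ht.1.trans ht.2
  set I : ℝ → ℝ := fun t => ∫ τ in 0..t, α τ with hI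
  have hint : IntegrableOn α (Set.Icc 0 T) := hα.integrableOn_Icc
  have hIc : ContinuousOn I (Set.Icc 0 T) := by
    have := intervalIntegral.continuousOn_primitive_interval (μ := volume) (a := 0) (b := T)
      (f := α) (by rwa [Set.uIcc_of_le hT])
    rwa [Set.uIcc_of_le hT] at this
  have hId : ∀ x ∈ Set.Ioo 0 T, HasDerivAt I (α x) x := by
    intro x hx
    have hn : Set.Icc 0 T ∈ 𝓝 x := Icc_mem_nhds hx.1 hx.2
    apply intervalIntegral.integral_hasDerivAt_right
    · refine (hα.mono ?_).intervalIntegrable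
      rw [Set.uIcc_of_le hx.1.le]
      exact Set.Icc_subset_Icc_right hx.2.le
    · exact (hα.mono Set.Ioo_subset_Icc_self).stronglyMeasurableAtFilter isOpen_Ioo x hx
    · exact hα.continuousAt hn
  have hanti : AntitoneOn (fun x => f x * Real.exp (-I x)) (Set.Icc 0 T) := by
    have hder : ∀ x ∈ Set.Ioo 0 T, HasDerivAt (fun x => f x * Real.exp (-I x))
        (f' x * Real.exp (-I x) + f x * (Real.exp (-I x) * (-α x))) x := by
      intro x hx
      have h1 := (hf x ⟨hx.1.le, hx.2.le⟩).hasDerivAt (Icc_mem_nhds hx.1 hx.2)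
      exact h1.mul ((hId x hx).neg.exp)
    apply antitoneOn_of_deriv_nonpos (convex_Icc 0 T)
    · exact ContinuousOn.mul (fun x hx => (hf x hx).continuousWithinAt) hIc.neg.rexp
    · rw [interior_Icc]
      exact fun x hx => (hder x hx).differentiableAt.differentiableWithinAt
    · rw [interior_Icc]
      intro x hx
      rw [(hder x hx).deriv]
      have := hle x ⟨hx.1.le, hx.2.le⟩
      have he := Real.exp_pos (-I x)
      nlinarith
  have h := hanti (Set.left_mem_Icc.2 hT) ht ht.1
  simp only [hI, intervalIntegral.integral_same, neg_zero, Real.exp_zero, mul_one] at h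
  rw [Real.exp_neg, ← div_eq_mul_inv, div_le_iff₀ (Real.exp_pos _)] at h
  exact h

/-- A superlinear differential inequality on a short time interval. -/
lemma le_four_mul_of_deriv_le {f f' : ℝ → ℝ} {c T : ℝ} (hc : 0 ≤ c)
    (hpos : ∀ t ∈ Set.Icc 0 T, 0 < f t)
    (hf : ∀ t ∈ Set.Icc 0 T, HasDerivWithinAt f (f' t) (Set.Icc 0 T) t)
    (hle : ∀ t ∈ Set.Icc 0 T, f' t ≤ c * (f t * Real.sqrt (f t)))
    (hT : c * Real.sqrt (f 0) * T ≤ 1) :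
    ∀ t ∈ Set.Icc 0 T, f t ≤ 4 * f 0 := by
  intro t ht
  have hT0 : (0 : ℝ) ≤ T := ht.1.trans ht.2
  have h0 := hpos 0 (Set.left_mem_Icc.2 hT0)
  have hder : ∀ x ∈ Set.Icc 0 T, HasDerivWithinAt (fun x => (Real.sqrt (f x))⁻¹ + c / 2 * x)
      (-(f' x / (2 * Real.sqrt (f x))) / Real.sqrt (f x) ^ 2 + c / 2 * 1) (Set.Icc 0 T) x := by
    intro x hx
    have hs := Real.sqrt_pos.2 (hpos x hx)
    exact (((hf x hx).sqrt (hpos x hx).ne').inv hs.ne').add ((hasDerivWithinAt_id x _).const_mul _)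
  -- From f' ≤ c f^{3/2}, the function f^{-1/2} decreases at rate at most c/2. By the choice of T it
  -- keeps half of its initial value, which is the origin of the factor 4 = 2².
  have hmono : MonotoneOn (fun x => (Real.sqrt (f x))⁻¹ + c / 2 * x) (Set.Icc 0 T) := by
    apply monotoneOn_of_deriv_nonneg (convex_Icc 0 T)
    · exact fun x hx => (hder x hx).continuousWithinAt
    · rw [interior_Icc]
      exact fun x hx => ((hder x ⟨hx.1.le, hx.2.le⟩).hasDerivAt
        (Icc_mem_nhds hx.1 hx.2)).differentiableAt.differentiableWithinAt
    · rw [interior_Icc]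
      intro x hx
      have hx' : x ∈ Set.Icc 0 T := ⟨hx.1.le, hx.2.le⟩
      rw [((hder x hx').hasDerivAt (Icc_mem_nhds hx.1 hx.2)).deriv]
      have hs := Real.sqrt_pos.2 (hpos x hx')
      have h1 := hle x hx'
      have h2 := Real.sq_sqrt (hpos x hx').le
      have h3 : f' x / (2 * Real.sqrt (f x)) / Real.sqrt (f x) ^ 2 ≤ c / 2 := by
        rw [div_div, div_le_iff₀ (by positivity)]
        calc f' x ≤ c * (f x * Real.sqrt (f x)) := h1
          _ = c * (Real.sqrt (f x) ^ 2 * Real.sqrt (f x)) := by rw [h2]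
          _ = _ := by ring
      rw [neg_div]
      linarith
  have h := hmono (Set.left_mem_Icc.2 hT0) ht ht.1
  simp only [mul_zero, add_zero] at h
  have hs0 := Real.sqrt_pos.2 h0
  have hst := Real.sqrt_pos.2 (hpos t ht)
  have h4 : c / 2 * t ≤ (Real.sqrt (f 0))⁻¹ / 2 := by
    have : c * T ≤ (Real.sqrt (f 0))⁻¹ := by
      rw [← one_div, le_div_iff₀ hs0]; linarith
    have : c * t ≤ c * T := mul_le_mul_of_nonneg_left ht.2 hc
    linarith
  have h5 : (Real.sqrt (f 0))⁻¹ / 2 ≤ (Real.sqrt (f t))⁻¹ := by linarith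
  have h6 : Real.sqrt (f t) ≤ 2 * Real.sqrt (f 0) := by
    have e : (Real.sqrt (f 0))⁻¹ / 2 = (2 * Real.sqrt (f 0))⁻¹ := by
      rw [mul_inv]; ring
    rw [e] at h5
    exact (inv_le_inv₀ (by positivity) hst).1 h5
  calc f t = Real.sqrt (f t) ^ 2 := (Real.sq_sqrt (hpos t ht).le).symm
    _ ≤ (2 * Real.sqrt (f 0)) ^ 2 := by gcongr
    _ = 4 * f 0 := by rw [mul_pow, Real.sq_sqrt h0.le]; norm_num

/-! ### Frequency truncation -/

/-- The symbol of the frequency cut-off. -/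
def cutoff (N : ℝ) (k : ℝ) : ℝ := if |k| ≤ N then 1 else 0

lemma isSymbol_cutoff (N : ℝ) : IsSymbol (cutoff N) where
  measurable := Measurable.ite (measurableSet_le measurable_norm measurable_const)
    measurable_const measurable_const
  even x := by unfold cutoff; rw [abs_neg]
  bdd := ⟨1, fun x => by unfold cutoff; split_ifs <;> simp⟩

/-- The frequency cut-off. -/
def proj (N : ℝ) : L2R →L[ℝ] L2R := mulL (cutoff N)

lemma rep_proj (N : ℝ) (f : L2R) :
    rep (proj N f) =ᵐ[volume] fun k => (cutoff N k : ℂ) * rep f k :=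
  rep_mulL (isSymbol_cutoff N) f

lemma proj_proj {M N : ℝ} (h : M ≤ N) (f : L2R) : proj N (proj M f) = proj M f := by
  apply eq_of_rep_ae_eq
  filter_upwards [rep_proj N (proj M f), rep_proj M f] with k h1 h2
  rw [h1, h2, ← mul_assoc]
  congr 1
  unfold cutoff
  by_cases hk : |k| ≤ M
  · simp [hk, hk.trans h]
  · simp [hk]

lemma enE_proj_le (w : ℝ → ℝ) (N : ℝ) (f : L2R) : enE w (proj N f) ≤ enE w f := by
  rw [enE_congr_ae (rep_proj N f)]
  refine lintegral_mono fun k => ?_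
  simp only
  gcongr
  unfold cutoff
  split_ifs <;> simp

lemma norm_proj_le (N : ℝ) (f : L2R) : ‖proj N f‖ ≤ ‖f‖ := by
  have := norm_le_of_energy_le (f := proj N f) (g := f) zero_le_one
    (by simpa using enE_proj_le (fun _ => 1) N f)
  rwa [one_mul] at this

lemma inner_proj_left (N : ℝ) (f g : L2R) : inner ℝ (proj N f) g = inner ℝ f (proj N g) := by
  have h : ((inner ℝ (proj N f) g : ℝ) : ℂ) = ((inner ℝ f (proj N g) : ℝ) : ℂ) := by
    rw [inner_eq_integral_rep, inner_eq_integral_rep]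
    congr 1
    apply integral_congr_ae
    filter_upwards [rep_proj N f, rep_proj N g] with k h1 h2
    rw [h1, h2, map_mul, Complex.conj_ofReal]; ring
  exact_mod_cast h

lemma inner_sqrtMul_proj {p C : ℝ} {w : ℝ → ℝ} (hw : IsWeight p w) (hC : ∀ x, w x ≤ C) (N : ℝ)
    (f g : L2R) :
    inner ℝ (sqrtMul w f) (sqrtMul w (proj N g)) = inner ℝ (sqrtMul w (proj N f)) (sqrtMul w g) := by
  have h : ((inner ℝ (sqrtMul w f) (sqrtMul w (proj N g)) : ℝ) : ℂ)
      = ((inner ℝ (sqrtMul w (proj N f)) (sqrtMul w g) : ℝ) : ℂ) := by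
    rw [inner_sqrtMul hw hC, inner_sqrtMul hw hC]
    congr 1
    apply integral_congr_ae
    filter_upwards [rep_proj N f, rep_proj N g] with k h1 h2
    rw [h1, h2, map_mul, Complex.conj_ofReal]; ring
  exact_mod_cast h

lemma enE_proj_le_one {p : ℝ} {w : ℝ → ℝ} (hw : IsWeight p w) {N : ℝ} (hN : 0 ≤ N) (f : L2R) :
    enE w (proj N f) ≤ ENNReal.ofReal (w N) * enE (fun _ => 1) f := by
  rw [enE_congr_ae (rep_proj N f)]
  unfold enE energy
  rw [← lintegral_const_mul' _ _ ENNReal.ofReal_ne_top]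
  refine lintegral_mono fun k => ?_
  simp only
  unfold cutoff
  split_ifs with h
  · rw [Complex.ofReal_one, one_mul, ENNReal.ofReal_one, one_mul]
    gcongr
    exact hw.mono (by rwa [abs_of_nonneg hN])
  · simp

lemma enE_proj_lt_top {s : ℝ} (hs : 0 ≤ s) {N : ℝ} (hN : 0 ≤ N) (f : L2R) :
    enE (sobWeight s) (proj N f) < ∞ :=
  (enE_proj_le_one (isWeight_sobWeight hs) hN f).trans_lt
    (ENNReal.mul_lt_top ENNReal.ofReal_lt_top (energy_one_rep_lt_top f))

/-- A band-limited function does not see the weight beyond N, so its full energy is already the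
energy for a bounded weight. -/
lemma enE_trunc_of_proj_eq {p : ℝ} {w : ℝ → ℝ} (hw : IsWeight p w) {N : ℝ} {f : L2R}
    (hf : proj N f = f) : enE (fun x => w (min |x| N)) f = enE w f := by
  have h := rep_proj N f
  rw [hf] at h
  rw [enE_congr_ae h, enE_congr_ae h]
  unfold energy
  congr 1; funext k
  simp only
  unfold cutoff
  split_ifs with hk
  · rw [hw.trunc_eq hk]
  · simp

lemma norm_sub_proj_sq_le {s : ℝ} {N : ℝ} (hs : 0 ≤ s) (hN : 0 ≤ N) {f : L2R}
    (hf : enE (sobWeight s) f < ∞) :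
    ‖f - proj N f‖ ^ 2 ≤ 2 * Real.pi * ((enE (sobWeight s) f).toReal / sobWeight s N) := by
  have hw : 0 < sobWeight s N := lt_of_lt_of_le one_pos (one_le_sobWeight s N)
  apply norm_sq_le_of_enE_le (by positivity)
  rw [ENNReal.ofReal_div_of_pos hw, ENNReal.ofReal_toReal hf.ne,
    ENNReal.le_div_iff_mul_le (Or.inl (by simpa using hw)) (Or.inl ENNReal.ofReal_ne_top), mul_comm]
  have h : rep (f - proj N f) =ᵐ[volume] fun k => (1 - cutoff N k : ℂ) * rep f k := by
    filter_upwards [rep_sub f (proj N f), rep_proj N f] with k h1 h2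
    rw [h1, h2]; ring
  rw [enE_congr_ae h]
  unfold enE energy
  rw [← lintegral_const_mul' _ _ ENNReal.ofReal_ne_top]
  refine lintegral_mono fun k => ?_
  simp only
  unfold cutoff
  split_ifs with hk
  · simp
  · rw [Complex.ofReal_zero, sub_zero, one_mul, ENNReal.ofReal_one, one_mul]
    gcongr
    exact (isWeight_sobWeight hs).mono (by rw [abs_of_nonneg hN]; exact (not_le.1 hk).le)

/-! ### Tails -/

/-- The weight of `H^s`, reduced to high frequencies. -/
def tailWeight (s : ℝ) (n : ℕ) (k : ℝ) : ℝ := sobWeight s k * min (|k| / (n + 1)) 1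

lemma isWeight_tailWeight {s : ℝ} (hs : 0 ≤ s) (n : ℕ) :
    IsWeight (2 * s + 1) (tailWeight s n) :=
  (isWeight_sobWeight hs).mul (IsWeight.ramp (by positivity))

lemma tailWeight_le (s : ℝ) (n : ℕ) (k : ℝ) : tailWeight s n k ≤ sobWeight s k :=
  mul_le_of_le_one_right (zero_le_one.trans (one_le_sobWeight s k)) (min_le_right _ _)

/-- Below frequency n + 1 the weight is bounded by its value there; above it the ramp equals 1. -/
lemma enE_le_tail {s : ℝ} (hs : 0 ≤ s) (n : ℕ) (f : L2R) :
    enE (sobWeight s) f ≤ ENNReal.ofReal (sobWeight s (n + 1)) * enE (fun _ => 1) f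
      + enE (tailWeight s n) f := by
  have hm := (isWeight_tailWeight hs n).measurable
  unfold enE energy
  rw [← lintegral_const_mul' _ _ ENNReal.ofReal_ne_top, ← lintegral_add_left (by fun_prop)]
  refine lintegral_mono fun k => ?_
  simp only [ENNReal.ofReal_one, one_mul]
  have hn : (0 : ℝ) < n + 1 := by positivity
  rcases le_total |k| (n + 1) with h | h
  · refine le_trans ?_ le_self_add
    gcongr
    exact (isWeight_sobWeight hs).mono (by rwa [abs_of_pos hn])
  · refine le_trans ?_ le_add_self
    gcongr
    unfold tailWeight
    rw [min_eq_right (by rwa [le_div_iff₀ hn, one_mul]), mul_one]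

lemma tendsto_enE_tail {s : ℝ} (hs : 0 ≤ s) {f : L2R} (hf : enE (sobWeight s) f < ∞) :
    Tendsto (fun n => enE (tailWeight s n) f) atTop (𝓝 0) := by
  have hm := fun n => (isWeight_tailWeight hs n).measurable
  have h := tendsto_lintegral_of_dominated_convergence' (μ := volume)
    (F := fun n k => ENNReal.ofReal (tailWeight s n k) * ‖rep f k‖ₑ ^ 2) (f := fun _ => 0)
    (fun k => ENNReal.ofReal (sobWeight s k) * ‖rep f k‖ₑ ^ 2)
    (fun n => by have := hm n; fun_prop)
    (fun n => Eventually.of_forall fun k => by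
      simp only
      gcongr
      exact tailWeight_le s n k) hf.ne
    (Eventually.of_forall fun k => by
      have h1 : Tendsto (fun n : ℕ => |k| / ((n : ℝ) + 1)) atTop (𝓝 0) :=
        tendsto_const_nhds.div_atTop (tendsto_atTop_add_const_right _ _
          tendsto_natCast_atTop_atTop)
      have h2 : Tendsto (fun n : ℕ => tailWeight s n k) atTop (𝓝 0) := by
        have := (h1.min (tendsto_const_nhds (x := (1 : ℝ)))).const_mul (sobWeight s k)
        simpa [tailWeight] using this
      have h3 := ENNReal.Tendsto.mul_const (b := ‖rep f k‖ₑ ^ 2)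
        ((ENNReal.continuous_ofReal.tendsto _).comp h2) (Or.inr (by finiteness))
      simpa using h3)
  rw [lintegral_zero] at h
  exact h

/-- Convergence in `L²` with uniformly small tails is convergence in `H^s`. -/
lemma tendsto_enE_of_tail {α : Type*} {l : Filter α} {s : ℝ} (hs : 0 ≤ s) {u : α → L2R} {f : L2R}
    {ε : ℕ → ℝ≥0∞} (hε : Tendsto ε atTop (𝓝 0)) (hu : Tendsto u l (𝓝 f))
    (h : ∀ n, ∀ᶠ a in l, enE (tailWeight s n) (u a) ≤ ε n) :
    Tendsto (fun a => enE (sobWeight s) (u a - f)) l (𝓝 0) := by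
  rcases eq_or_neBot l with hl | hl
  · rw [hl]; exact tendsto_bot
  have hw := fun n => isWeight_tailWeight hs n
  -- Lower semicontinuity transfers the tail bounds to the limit. The tail of the difference is then
  -- at most 2 (ε n + ε n), and for fixed n the low frequencies converge by L² convergence.
  have hf : ∀ n, enE (tailWeight s n) f ≤ ε n := fun n => enE_le_of_tendsto (hw n) hu (h n)
  rw [ENNReal.tendsto_nhds_zero]
  intro η hη
  have hη2 : (0 : ℝ≥0∞) < η / 2 := ENNReal.half_pos hη.ne'
  have h4 : Tendsto (fun n => 2 * (ε n + ε n)) atTop (𝓝 0) := by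
    have := ENNReal.Tendsto.const_mul (a := 2) (hε.add hε) (Or.inr (by simp))
    simpa using this
  obtain ⟨n, hn⟩ := ((ENNReal.tendsto_nhds_zero.1 h4) (η / 2) hη2).exists
  have h1 : Tendsto (fun a => ENNReal.ofReal (sobWeight s (n + 1)) * enE (fun _ => 1) (u a - f))
      l (𝓝 0) := by
    have h2 : Tendsto (fun a => enE (fun _ => 1) (u a - f)) l (𝓝 0) := by
      simp_rw [enE_one]
      have h3 : Tendsto (fun a => ‖u a - f‖ ^ 2 / (2 * Real.pi)) l (𝓝 0) := by
        have := ((hu.sub_const f).norm.pow 2).div_const (2 * Real.pi)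
        simpa using this
      have h4 := (ENNReal.continuous_ofReal.tendsto _).comp h3
      rw [ENNReal.ofReal_zero] at h4
      exact h4
    have := ENNReal.Tendsto.const_mul (a := ENNReal.ofReal (sobWeight s (n + 1))) h2
      (Or.inr ENNReal.ofReal_ne_top)
    simpa using this
  filter_upwards [(ENNReal.tendsto_nhds_zero.1 h1) (η / 2) hη2, h n] with a h2 h3
  calc enE (sobWeight s) (u a - f) ≤ _ := enE_le_tail hs n _
    _ ≤ η / 2 + 2 * (ε n + ε n) := by
        gcongr
        exact (enE_sub_le (hw n).measurable _ _).trans (by gcongr; exact hf n)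
    _ ≤ η / 2 + η / 2 := by gcongr
    _ = η := ENNReal.add_halves η

lemma tendsto_of_tendsto_enE {α : Type*} {l : Filter α} {s : ℝ} {u : α → L2R} {f : L2R}
    (h : Tendsto (fun a => enE (sobWeight s) (u a - f)) l (𝓝 0)) : Tendsto u l (𝓝 f) := by
  have h1 : Tendsto (fun a => enE (fun _ => 1) (u a - f)) l (𝓝 0) :=
    tendsto_of_tendsto_of_tendsto_of_le_of_le tendsto_const_nhds h (fun _ => zero_le)
      (fun a => enE_one_le s _)
  have h2 : Tendsto (fun a => ‖u a - f‖ ^ 2) l (𝓝 0) := by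
    have h3 := ((ENNReal.tendsto_toReal (a := 0) (by simp)).comp h1).mul_const (2 * Real.pi)
    simp only [ENNReal.toReal_zero, zero_mul] at h3
    refine h3.congr fun a => ?_
    simp only [Function.comp]
    rw [enE_one, ENNReal.toReal_ofReal (by positivity), div_mul_cancel₀ _ two_pi_ne_zero]
  rw [tendsto_iff_norm_sub_tendsto_zero]
  have h4 := h2.sqrt
  simp only [Real.sqrt_zero] at h4
  exact h4.congr fun a => Real.sqrt_sq (norm_nonneg _)

/-! ### Continuity of the nonlinearity -/

lemma tendsto_enE_bil {α : Type*} {l : Filter α} {s : ℝ} (hs : 1 < s) {u : α → L2R} {f : L2R}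
    (hf : enE (sobWeight s) f < ∞)
    (h : Tendsto (fun a => enE (sobWeight s) (u a - f)) l (𝓝 0)) :
    Tendsto (fun a => enE (sobWeight (s - 1)) (bil (u a) (u a) - bil f f)) l (𝓝 0) := by
  set K : ℝ≥0∞ := 2 * (1 + enE (sobWeight s) (f + f)) with hK
  have hKt : K < ∞ := ENNReal.mul_lt_top (by simp)
    (ENNReal.add_lt_top.2 ⟨by simp, enE_add_lt_top hf hf⟩)
  have h1 : ∀ᶠ a in l, enE (sobWeight (s - 1)) (bil (u a) (u a) - bil f f)
      ≤ bilinConst s * (enE (sobWeight s) (u a - f) * K) := by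
    filter_upwards [(ENNReal.tendsto_nhds_zero.1 h) 1 one_pos] with a ha
    have hd : enE (sobWeight s) (u a - f) < ∞ := ha.trans_lt (by simp)
    have hua : enE (sobWeight s) (u a) < ∞ := by
      have := enE_add_lt_top hd hf
      rwa [sub_add_cancel] at this
    rw [bil_self_sub hs hua hf]
    refine (enE_bil_le hs hd (enE_add_lt_top hua hf)).trans ?_
    gcongr
    have e : u a + f = (u a - f) + (f + f) := by abel
    rw [e]
    exact (enE_add_le (measurable_sobWeight s) _ _).trans (by rw [hK]; gcongr)
  have h2 : Tendsto (fun a => bilinConst s * (enE (sobWeight s) (u a - f) * K)) l (𝓝 0) := by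
    have h3 := ENNReal.Tendsto.mul_const (b := K) h (Or.inr hKt.ne)
    have h4 := ENNReal.Tendsto.const_mul (a := bilinConst s) h3
      (Or.inr (bilinConst_lt_top hs).ne)
    simpa using h4
  exact tendsto_of_tendsto_of_tendsto_of_le_of_le' tendsto_const_nhds h2
    (Eventually.of_forall fun _ => zero_le) h1

lemma tendsto_bil {α : Type*} {l : Filter α} {s : ℝ} (hs : 1 < s) {u : α → L2R} {f : L2R}
    (hf : enE (sobWeight s) f < ∞)
    (h : Tendsto (fun a => enE (sobWeight s) (u a - f)) l (𝓝 0)) :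
    Tendsto (fun a => bil (u a) (u a)) l (𝓝 (bil f f)) :=
  tendsto_of_tendsto_enE (tendsto_enE_bil hs hf h)

/-! ### Propagation of weighted energies -/

/-- Grönwall for ‖√w u‖². The rate α is arbitrary so that the lemma serves the Galerkin
approximations and exact solutions alike. -/
lemma enE_le_exp_mul {p C : ℝ} {w : ℝ → ℝ} (hw : IsWeight p w) (hC : ∀ x, w x ≤ C)
    {T : ℝ} {u u' : ℝ → L2R} {α : ℝ → ℝ} (hα : ContinuousOn α (Set.Icc 0 T))
    (hu : ∀ t ∈ Set.Icc 0 T, HasDerivWithinAt u (u' t) (Set.Icc 0 T) t)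
    (hle : ∀ t ∈ Set.Icc 0 T, |inner ℝ (sqrtMul w (u t)) (sqrtMul w (u' t))|
      ≤ α t * ‖sqrtMul w (u t)‖ ^ 2) :
    ∀ t ∈ Set.Icc 0 T, enE w (u t)
      ≤ ENNReal.ofReal (Real.exp (2 * ∫ τ in 0..t, α τ)) * enE w (u 0) := by
  intro t ht
  have hd : ∀ t ∈ Set.Icc 0 T, HasDerivWithinAt (fun t => ‖sqrtMul w (u t)‖ ^ 2)
      (2 * inner ℝ (sqrtMul w (u t)) (sqrtMul w (u' t))) (Set.Icc 0 T) t := fun t ht =>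
    ((sqrtMul w).hasFDerivAt.comp_hasDerivWithinAt t (hu t ht)).norm_sq
  have h := le_mul_exp_integral (α := fun t => 2 * α t) (continuousOn_const.mul hα) hd
    (fun t ht => by
      have := (le_abs_self _).trans (hle t ht)
      linarith) t ht
  rw [intervalIntegral.integral_const_mul] at h
  rw [enE_eq_norm_sqrtMul hw hC, enE_eq_norm_sqrtMul hw hC,
    ← ENNReal.ofReal_mul (Real.exp_pos _).le]
  apply ENNReal.ofReal_le_ofReal
  rw [← mul_div_assoc, div_le_div_iff_of_pos_right Real.two_pi_pos]
  linarith

/-! ### Galerkin approximations -/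

lemma bil_zero {s : ℝ} (hs : 1 < s) : bil 0 0 = 0 := by
  have h0 : enE (sobWeight s) 0 = 0 := by
    have := enE_smul (sobWeight s) 0 0
    simpa using this
  have h := norm_bil_sq_le (s := s) (f := 0) (g := 0) hs (by simp [h0]) (by simp [h0])
  rw [h0] at h
  simp only [ENNReal.toReal_zero, mul_zero] at h
  exact norm_eq_zero.1 (pow_eq_zero_iff two_ne_zero |>.1 (le_antisymm h (by positivity)))

lemma exists_norm_bil_proj_le {s : ℝ} (hs : 1 < s) {N : ℝ} (hN : 0 ≤ N) :
    ∃ C, 0 ≤ C ∧ ∀ f g, ‖bil (proj N f) (proj N g)‖ ≤ C * (‖f‖ * ‖g‖) := by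
  set W := sobWeight s N with hW
  have hW0 : 0 ≤ W := zero_le_one.trans (one_le_sobWeight s N)
  have hs0 : (0 : ℝ) ≤ s := by linarith
  have hE : ∀ f : L2R, (enE (sobWeight s) (proj N f)).toReal ≤ W * ‖f‖ ^ 2 := by
    intro f
    apply ENNReal.toReal_le_of_le_ofReal (by positivity)
    refine (enE_proj_le_one (isWeight_sobWeight hs0) hN f).trans ?_
    rw [enE_one, ← ENNReal.ofReal_mul hW0]
    apply ENNReal.ofReal_le_ofReal
    gcongr
    exact div_le_self (by positivity) (by linarith [Real.two_le_pi])
  set A := 2 * Real.pi * ((bilinConst s).toReal * (W * W)) with hA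
  have hA0 : 0 ≤ A := by positivity
  refine ⟨Real.sqrt A, Real.sqrt_nonneg _, fun f g => ?_⟩
  have h := norm_bil_sq_le hs (enE_proj_lt_top hs0 hN f) (enE_proj_lt_top hs0 hN g)
  refine abs_le_of_sq_le_sq' ?_ (by positivity) |>.2
  calc ‖bil (proj N f) (proj N g)‖ ^ 2 ≤ _ := h
    _ ≤ 2 * Real.pi * ((bilinConst s).toReal * ((W * ‖f‖ ^ 2) * (W * ‖g‖ ^ 2))) := by
        gcongr; exacts [hE f, hE g]
    _ = (Real.sqrt A * (‖f‖ * ‖g‖)) ^ 2 := by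
        rw [mul_pow, Real.sq_sqrt hA0]; ring

/-- Projecting also the arguments of the nonlinearity gives a locally Lipschitz quadratic map of L².
It is orthogonal to its argument, since `proj N` is symmetric and `inner_bil_self` applies; hence
existence up to any T. -/
lemma exists_galerkin {s : ℝ} (hs : 2 < s) {N : ℝ} (hN : 0 ≤ N) (u₀ : L2R) {T : ℝ} (hT : 0 ≤ T) :
    ∃ u : ℝ → L2R, u 0 = proj N u₀ ∧ ∀ t ∈ Set.Icc 0 T, proj N (u t) = u t ∧
      HasDerivWithinAt u (proj N (bil (u t) (u t))) (Set.Icc 0 T) t := by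
  have hs1 : 1 < s := by linarith
  have hs0 : (0 : ℝ) ≤ s := by linarith
  obtain ⟨C, hC0, hC⟩ := exists_norm_bil_proj_le hs1 hN
  set F : L2R → L2R := fun u => proj N (bil (proj N u) (proj N u)) with hF
  have hE : ∀ f, enE (sobWeight s) (proj N f) < ∞ := enE_proj_lt_top hs0 hN
  obtain ⟨u, hu0, hu⟩ := exists_global_solution (F := F) hC0
    (by
      intro f g
      simp only [hF]
      rw [← map_sub, bil_self_sub hs1 (hE f) (hE g), ← map_sub, ← map_add]
      refine (norm_proj_le _ _).trans ((hC _ _).trans ?_)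
      calc C * (‖f - g‖ * ‖f + g‖) ≤ C * (‖f - g‖ * (‖f‖ + ‖g‖)) := by
            gcongr; exact norm_add_le f g
        _ = C * (‖f‖ + ‖g‖) * ‖f - g‖ := by ring)
    (by simp only [hF]; rw [map_zero, bil_zero hs1, map_zero])
    (by
      intro f
      simp only [hF]
      rw [← inner_proj_left]
      exact inner_bil_self hs (hE f))
    (proj N u₀) hT
  have hPF : ∀ v, proj N (F v) = F v := fun v => proj_proj le_rfl _
  -- The difference of the two sides has zero derivative and vanishes at time 0. The inner
  -- projections can then be dropped.
  have hP : ∀ t ∈ Set.Icc 0 T, proj N (u t) = u t := by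
    intro t ht
    have hd : ∀ t ∈ Set.Icc 0 T, HasDerivWithinAt (fun t => proj N (u t) - u t) 0
        (Set.Icc 0 T) t := by
      intro t ht
      have h1 := ((proj N).hasFDerivAt.comp_hasDerivWithinAt t (hu t ht)).sub (hu t ht)
      rw [hPF, sub_self] at h1
      exact h1
    have hc := constant_of_has_deriv_right_zero (fun t ht => (hd t ht).continuousWithinAt)
      (fun t ht => (hd t ⟨ht.1, ht.2.le⟩).mono_of_mem_nhdsWithin (Icc_mem_nhdsGE_of_mem ht)) t ht
    rw [hu0, proj_proj le_rfl, sub_self] at hc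
    exact sub_eq_zero.1 hc
  refine ⟨u, hu0, fun t ht => ⟨hP t ht, ?_⟩⟩
  have := hu t ht
  simp only [hF, hP t ht] at this
  exact this

/-- The Wiener norm bound in terms of the Sobolev energy. -/
lemma wn_le_sqrt {s : ℝ} (hs : 2 < s) {f : L2R} {B : ℝ} (hB : 0 ≤ B)
    (hf : enE (sobWeight s) f ≤ ENNReal.ofReal B) :
    wn f ≤ Real.sqrt ((wienerConst (3 / 2) s).toReal * B) := by
  apply Real.le_sqrt_of_sq_le
  refine (wn_sq_le hs (hf.trans_lt ENNReal.ofReal_lt_top)).trans ?_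
  gcongr
  exact ENNReal.toReal_le_of_le_ofReal hB hf

section Galerkin

variable {s N T : ℝ} {u : ℝ → L2R}

/-- The projection is symmetric for the weighted inner product, so it moves to f, which it fixes. -/
lemma galerkin_abs_inner_le {p : ℝ} {w : ℝ → ℝ} (hs : 2 < s) (hN : 0 ≤ N) (hp : 1 ≤ p)
    (hw : IsWeight p w) {f : L2R} (hf : proj N f = f) :
    |inner ℝ (sqrtMul (fun x => w (min |x| N)) f)
        (sqrtMul (fun x => w (min |x| N)) (proj N (bil f f)))|
      ≤ 2 * 2 ^ p * wn f * ‖sqrtMul (fun x => w (min |x| N)) f‖ ^ 2 := by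
  have hE : enE (sobWeight s) f < ∞ := by
    rw [← hf]; exact enE_proj_lt_top (by linarith) hN f
  rw [inner_sqrtMul_proj (hw.trunc hN) (hw.trunc_le_const hN), hf, mul_assoc]
  exact abs_inner_sqrtMul_bil_le hp (hw.trunc hN) (hw.trunc_le_const hN) hs hE

/-- The uniform time of existence and bound for Galerkin approximations. -/
lemma galerkin_uniform_bound (hs : 2 < s) (hN : 0 ≤ N) {u₀ : L2R} {Y : ℝ}
    (hY : 1 + 2 * Real.pi * (enE (sobWeight s) u₀).toReal ≤ Y) (hu₀ : enE (sobWeight s) u₀ < ∞)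
    (hT : 4 * 2 ^ (2 * s) * Real.sqrt (wienerConst (3 / 2) s).toReal * Real.sqrt Y * T ≤ 1)
    (h0 : u 0 = proj N u₀)
    (hu : ∀ t ∈ Set.Icc 0 T, proj N (u t) = u t ∧
      HasDerivWithinAt u (proj N (bil (u t) (u t))) (Set.Icc 0 T) t) :
    ∀ t ∈ Set.Icc 0 T, enE (sobWeight s) (u t) ≤ ENNReal.ofReal (4 * Y) := by
  intro t ht
  have hT0 : (0 : ℝ) ≤ T := ht.1.trans ht.2
  have hw := isWeight_sobWeight (s := s) (by linarith)
  have hwt := hw.trunc hN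
  have hwC := hw.trunc_le_const hN
  set v : ℝ → ℝ := fun x => sobWeight s (min |x| N) with hv
  -- The added 1 provides the positivity that the superlinear inequality needs.
  set f : ℝ → ℝ := fun t => 1 + ‖sqrtMul v (u t)‖ ^ 2 with hf
  set K := (wienerConst (3 / 2) s).toReal with hK
  have hfpos : ∀ t, 0 < f t := fun t => by simp only [hf]; positivity
  have hEf : ∀ t ∈ Set.Icc 0 T, enE (sobWeight s) (u t) ≤ ENNReal.ofReal (f t) := by
    intro t ht
    rw [← enE_trunc_of_proj_eq hw (hu t ht).1, enE_eq_norm_sqrtMul hwt hwC]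
    apply ENNReal.ofReal_le_ofReal
    refine (div_le_self (by positivity) (by linarith [Real.two_le_pi])).trans ?_
    simp only [hf]; linarith
  have hd : ∀ t ∈ Set.Icc 0 T, HasDerivWithinAt f
      (2 * inner ℝ (sqrtMul v (u t)) (sqrtMul v (proj N (bil (u t) (u t))))) (Set.Icc 0 T) t :=
    fun t ht => (((sqrtMul v).hasFDerivAt.comp_hasDerivWithinAt t (hu t ht).2).norm_sq).const_add 1
  have hf0 : f 0 ≤ Y := by
    refine le_trans ?_ hY
    simp only [hf]
    gcongr
    have h1 : enE v (u 0) ≤ enE (sobWeight s) u₀ := by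
      rw [h0]
      exact (enE_mono (hw.trunc_le hN) _).trans (enE_proj_le _ _ _)
    rw [enE_eq_norm_sqrtMul hwt hwC] at h1
    have h2 := ENNReal.toReal_mono hu₀.ne h1
    rw [ENNReal.toReal_ofReal (by positivity), div_le_iff₀ Real.two_pi_pos] at h2
    linarith
  -- A factor 2 from differentiating the square, 2 · 2^{2s} from the energy estimate with p = 2s,
  -- and √K from bounding the Wiener norm by the H^s energy.
  set c := 4 * 2 ^ (2 * s) * Real.sqrt K with hc
  have hc0 : 0 ≤ c := by positivity
  have hmain := le_four_mul_of_deriv_le (f := f) hc0 (fun t _ => hfpos t) hd (by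
    intro t ht
    have h1 := (le_abs_self _).trans
      (galerkin_abs_inner_le hs hN (by linarith : 1 ≤ 2 * s) hw (hu t ht).1)
    have h2 := wn_le_sqrt hs (hfpos t).le (hEf t ht)
    rw [Real.sqrt_mul ENNReal.toReal_nonneg] at h2
    have h3 : ‖sqrtMul v (u t)‖ ^ 2 ≤ f t := by simp only [hf]; linarith
    calc 2 * inner ℝ (sqrtMul v (u t)) (sqrtMul v (proj N (bil (u t) (u t))))
        ≤ 2 * (2 * 2 ^ (2 * s) * wn (u t) * ‖sqrtMul v (u t)‖ ^ 2) := by linarith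
      _ ≤ 2 * (2 * 2 ^ (2 * s) * (Real.sqrt K * Real.sqrt (f t)) * f t) := by gcongr
      _ = c * (f t * Real.sqrt (f t)) := by rw [hc]; ring)
    (by
      refine le_trans ?_ hT
      gcongr) t ht
  refine (hEf t ht).trans (ENNReal.ofReal_le_ofReal (hmain.trans ?_))
  gcongr

/-- The constant is independent of N and depends on w only through p; for the tail weights this
yields tails small uniformly in N. -/
lemma galerkin_enE_le {p A : ℝ} {w : ℝ → ℝ} (hs : 2 < s) (hN : 0 ≤ N) (hp : 1 ≤ p)
    (hw : IsWeight p w) {u₀ : L2R} (h0 : u 0 = proj N u₀)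
    (hu : ∀ t ∈ Set.Icc 0 T, proj N (u t) = u t ∧
      HasDerivWithinAt u (proj N (bil (u t) (u t))) (Set.Icc 0 T) t) (hA0 : 0 ≤ A)
    (hA : ∀ t ∈ Set.Icc 0 T, wn (u t) ≤ A) :
    ∀ t ∈ Set.Icc 0 T, enE w (u t)
      ≤ ENNReal.ofReal (Real.exp (2 * (2 * 2 ^ p * A * T))) * enE w u₀ := by
  intro t ht
  have h := enE_le_exp_mul (hw.trunc hN) (hw.trunc_le_const hN)
    (α := fun _ => 2 * 2 ^ p * A) continuousOn_const (fun t ht => (hu t ht).2) (by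
      intro t ht
      refine (galerkin_abs_inner_le hs hN hp hw (hu t ht).1).trans ?_
      gcongr
      exact hA t ht) t ht
  rw [enE_trunc_of_proj_eq hw (hu t ht).1] at h
  refine h.trans ?_
  gcongr
  · rw [intervalIntegral.integral_const, smul_eq_mul, sub_zero, mul_comm]
    gcongr
    exact ht.2
  · rw [h0]
    exact (enE_mono (hw.trunc_le hN) _).trans (enE_proj_le _ _ _)

/-- The difference of two Galerkin approximations. -/
lemma galerkin_sub_le {M B : ℝ} {v : ℝ → L2R} (hs : 2 < s) (hM : 0 ≤ M) (hMN : M ≤ N)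
    {u₀ : L2R} (hu₀ : enE (sobWeight s) u₀ ≤ ENNReal.ofReal B) (hB : 0 ≤ B)
    (hu0 : u 0 = proj N u₀) (hv0 : v 0 = proj M u₀)
    (hu : ∀ t ∈ Set.Icc 0 T, proj N (u t) = u t ∧
      HasDerivWithinAt u (proj N (bil (u t) (u t))) (Set.Icc 0 T) t)
    (hv : ∀ t ∈ Set.Icc 0 T, proj M (v t) = v t ∧
      HasDerivWithinAt v (proj M (bil (v t) (v t))) (Set.Icc 0 T) t)
    (huB : ∀ t ∈ Set.Icc 0 T, enE (sobWeight s) (u t) ≤ ENNReal.ofReal B)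
    (hvB : ∀ t ∈ Set.Icc 0 T, enE (sobWeight s) (v t) ≤ ENNReal.ofReal B) :
    ∀ t ∈ Set.Icc 0 T, ‖u t - v t‖ ^ 2 ≤
      (2 * Real.pi * (B / sobWeight s M)
        + 2 * Real.pi * ((bilinConst s).toReal * (B * B) / sobWeight (s - 1) M)) *
      Real.exp ((2 * Real.sqrt ((wienerConst (3 / 2) s).toReal * (4 * B)) + 1) * T) := by
  intro t ht
  have hT0 : (0 : ℝ) ≤ T := ht.1.trans ht.2
  have hs1 : 1 < s := by linarith
  -- Bound for the Wiener norm of u + v, whose H^s energy is at most 2 (B + B).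
  set A := Real.sqrt ((wienerConst (3 / 2) s).toReal * (4 * B)) with hA
  have hA0 : 0 ≤ A := Real.sqrt_nonneg _
  have hW1 : 0 < sobWeight (s - 1) M := lt_of_lt_of_le one_pos (one_le_sobWeight _ _)
  -- Bounds the squared L² norm of the part of the nonlinearity at v beyond frequency M, by its
  -- H^{s-1} bound. Adding δ to ‖u - v‖² makes the differential inequality homogeneous.
  set δ := 2 * Real.pi * ((bilinConst s).toReal * (B * B) / sobWeight (s - 1) M) with hδ
  have hδ0 : 0 ≤ δ := by positivity
  have hPP : ∀ f, proj N f - proj M f = proj N (f - proj M f) := by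
    intro f; rw [map_sub, proj_proj hMN]
  have hd : ∀ t ∈ Set.Icc 0 T, HasDerivWithinAt (fun t => ‖u t - v t‖ ^ 2 + δ)
      (2 * inner ℝ (u t - v t) (proj N (bil (u t) (u t)) - proj M (bil (v t) (v t))))
      (Set.Icc 0 T) t := fun t ht => (((hu t ht).2.sub (hv t ht).2).norm_sq).add_const δ
  have hlt : ∀ {f : L2R}, enE (sobWeight s) f ≤ ENNReal.ofReal B → enE (sobWeight s) f < ∞ :=
    fun h => h.trans_lt ENNReal.ofReal_lt_top
  have hle : ∀ t ∈ Set.Icc 0 T,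
      2 * inner ℝ (u t - v t) (proj N (bil (u t) (u t)) - proj M (bil (v t) (v t)))
        ≤ (2 * A + 1) * (‖u t - v t‖ ^ 2 + δ) := by
    intro t ht
    have hut := hlt (huB t ht)
    have hvt := hlt (hvB t ht)
    have hsub := enE_sub_lt_top hut hvt
    have hadd := enE_add_lt_top hut hvt
    set b := bil (v t) (v t) with hb
    set r := b - proj M b with hr
    have e : proj N (bil (u t) (u t)) - proj M b
        = proj N (bil (u t - v t) (u t + v t)) + proj N r := by
      rw [← bil_self_sub hs1 hut hvt, map_sub, hr, ← hPP]; abel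
    have hPw : proj N (u t - v t) = u t - v t := by
      rw [map_sub, (hu t ht).1]
      have := proj_proj hMN (v t)
      rw [(hv t ht).1] at this
      rw [this]
    have h1 : |inner ℝ (u t - v t) (bil (u t - v t) (u t + v t))| ≤ A * ‖u t - v t‖ ^ 2 := by
      refine (abs_inner_bil_le hs hsub hadd).trans ?_
      gcongr
      apply wn_le_sqrt hs (by positivity)
      refine (enE_add_le (measurable_sobWeight s) _ _).trans ?_
      calc 2 * (enE (sobWeight s) (u t) + enE (sobWeight s) (v t))
          ≤ 2 * (ENNReal.ofReal B + ENNReal.ofReal B) := by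
            gcongr; exacts [huB t ht, hvB t ht]
        _ = ENNReal.ofReal (4 * B) := by
            rw [← ENNReal.ofReal_add hB hB, ENNReal.ofReal_mul (by norm_num),
              ← two_mul, ENNReal.ofReal_mul (by norm_num), ← mul_assoc]
            norm_num
    have hbE := enE_bil_le hs1 hvt hvt
    have hbt : enE (sobWeight (s - 1)) b < ∞ := hbE.trans_lt
      (ENNReal.mul_lt_top (bilinConst_lt_top hs1) (ENNReal.mul_lt_top hvt hvt))
    have h2 : ‖r‖ ^ 2 ≤ δ := by
      refine (norm_sub_proj_sq_le (by linarith) hM hbt).trans ?_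
      rw [hδ]
      gcongr
      apply ENNReal.toReal_le_of_le_ofReal (by positivity)
      refine hbE.trans ?_
      rw [ENNReal.ofReal_mul ENNReal.toReal_nonneg, ENNReal.ofReal_mul hB,
        ENNReal.ofReal_toReal (bilinConst_lt_top hs1).ne]
      gcongr <;> exact hvB t ht
    have h3 : inner ℝ (u t - v t) (proj N r) ≤ ‖u t - v t‖ * ‖r‖ :=
      (real_inner_le_norm _ _).trans (by gcongr; exact norm_proj_le _ _)
    rw [e, inner_add_right, ← inner_proj_left, hPw]
    have h4 := (abs_le.1 h1).2
    nlinarith [sq_nonneg (‖u t - v t‖ - ‖r‖), mul_nonneg hA0 hδ0]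
  have h := le_mul_exp_integral (α := fun _ => 2 * A + 1) continuousOn_const hd hle t ht
  rw [intervalIntegral.integral_const, smul_eq_mul, sub_zero] at h
  have h0 : ‖u 0 - v 0‖ ^ 2 ≤ 2 * Real.pi * (B / sobWeight s M) := by
    rw [hu0, hv0, hPP]
    calc ‖proj N (u₀ - proj M u₀)‖ ^ 2 ≤ ‖u₀ - proj M u₀‖ ^ 2 := by
          gcongr; exact norm_proj_le _ _
      _ ≤ _ := norm_sub_proj_sq_le (by linarith) hM (hlt hu₀)
      _ ≤ _ := by
          have := zero_le_one.trans (one_le_sobWeight s M)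
          gcongr
          exact ENNReal.toReal_le_of_le_ofReal hB hu₀
  calc ‖u t - v t‖ ^ 2 ≤ ‖u t - v t‖ ^ 2 + δ := by linarith
    _ ≤ _ := h
    _ ≤ _ := by
        rw [mul_comm t]
        have : 0 ≤ 2 * Real.pi * (B / sobWeight s M) + δ :=
          add_nonneg ((sq_nonneg _).trans h0) hδ0
        gcongr
        exact ht.2

end Galerkin

/-! ### Local existence -/

/-- The integrated equation passes to the limit by dominated convergence; continuity of V then
allows differentiation. -/
lemma hasDerivWithinAt_of_tendsto {E : Type*} [NormedAddCommGroup E] [NormedSpace ℝ E]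
    [CompleteSpace E] {T K : ℝ} {u v : ℕ → ℝ → E} {U V : ℝ → E}
    (hu : ∀ n, ∀ t ∈ Set.Icc 0 T, HasDerivWithinAt (u n) (v n t) (Set.Icc 0 T) t)
    (hv : ∀ n, ContinuousOn (v n) (Set.Icc 0 T)) (hK : ∀ n, ∀ t ∈ Set.Icc 0 T, ‖v n t‖ ≤ K)
    (hU : ∀ t ∈ Set.Icc 0 T, Tendsto (fun n => u n t) atTop (𝓝 (U t)))
    (hV : ∀ t ∈ Set.Icc 0 T, Tendsto (fun n => v n t) atTop (𝓝 (V t)))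
    (hVc : ContinuousOn V (Set.Icc 0 T)) :
    ∀ t ∈ Set.Icc 0 T, HasDerivWithinAt U (V t) (Set.Icc 0 T) t := by
  have hsub : ∀ t ∈ Set.Icc 0 T, Set.uIcc 0 t ⊆ Set.Icc 0 T := fun t ht => by
    rw [Set.uIcc_of_le ht.1]; exact Set.Icc_subset_Icc_right ht.2
  have hint : ∀ t ∈ Set.Icc 0 T, U t = U 0 + ∫ τ in 0..t, V τ := by
    intro t ht
    have h0 : (0 : ℝ) ∈ Set.Icc 0 T := ⟨le_rfl, ht.1.trans ht.2⟩
    have h1 : ∀ n, ∫ τ in 0..t, v n τ = u n t - u n 0 := by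
      intro n
      apply intervalIntegral.integral_eq_sub_of_hasDeriv_right_of_le ht.1
      · exact fun x hx => ((hu n x ⟨hx.1, hx.2.trans ht.2⟩).continuousWithinAt).mono
          (Set.Icc_subset_Icc_right ht.2)
      · intro x hx
        exact ((hu n x ⟨hx.1.le, hx.2.le.trans ht.2⟩).hasDerivAt
          (Icc_mem_nhds hx.1 (hx.2.trans_le ht.2))).hasDerivWithinAt
      · exact ((hv n).mono (hsub t ht)).intervalIntegrable
    have h2 : Tendsto (fun n => ∫ τ in 0..t, v n τ) atTop (𝓝 (∫ τ in 0..t, V τ)) := by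
      have hsub' : Set.uIoc 0 t ⊆ Set.Icc 0 T := Set.uIoc_subset_uIcc.trans (hsub t ht)
      apply intervalIntegral.tendsto_integral_filter_of_dominated_convergence (fun _ => K)
      · exact Eventually.of_forall fun n =>
          ((hv n).mono hsub').aestronglyMeasurable measurableSet_uIoc
      · exact Eventually.of_forall fun n => Eventually.of_forall fun x hx => hK n x (hsub' hx)
      · exact intervalIntegrable_const
      · exact Eventually.of_forall fun x hx => hV x (hsub' hx)
    have h3 := ((hU t ht).sub (hU 0 h0)).congr fun n => (h1 n).symm
    rw [← tendsto_nhds_unique h3 h2]; abel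
  intro t ht
  have : Fact (t ∈ Set.Icc 0 T) := ⟨ht⟩
  have h1 : HasDerivWithinAt (fun t => ∫ τ in 0..t, V τ) (V t) (Set.Icc 0 T) t := by
    apply intervalIntegral.integral_hasDerivWithinAt_right (t := Set.Icc 0 T)
    · exact (hVc.mono (hsub t ht)).intervalIntegrable
    · exact hVc.stronglyMeasurableAtFilter_nhdsWithin measurableSet_Icc t
    · exact hVc t ht
  exact (h1.const_add (U 0)).congr (fun x hx => hint x hx) (hint t ht)

/-- Solutions that are continuous in `H^s`, with the time derivative taken in `L²`. -/
def IsStrongSol (s : ℝ) (I : Set ℝ) (u : ℝ → L2R) : Prop :=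
  ∀ t ∈ I, enE (sobWeight s) (u t) < ∞ ∧
    Tendsto (fun r => enE (sobWeight s) (u r - u t)) (𝓝[I] t) (𝓝 0) ∧
    HasDerivWithinAt u (bil (u t) (u t)) I t

lemma tendsto_sobWeight {s : ℝ} (hs : 0 < s) :
    Tendsto (fun n : ℕ => sobWeight s n) atTop atTop := by
  unfold sobWeight
  apply tendsto_atTop_add_const_left
  have := (tendsto_rpow_atTop (y := 2 * s) (by linarith)).comp tendsto_natCast_atTop_atTop
  refine this.congr fun n => ?_
  simp

lemma tendsto_proj {s : ℝ} (hs : 0 < s) {f : L2R} (hf : enE (sobWeight s) f < ∞) :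
    Tendsto (fun n : ℕ => proj n f) atTop (𝓝 f) := by
  have h1 : Tendsto (fun n : ℕ => 2 * Real.pi * ((enE (sobWeight s) f).toReal / sobWeight s n))
      atTop (𝓝 0) := by
    have := (tendsto_const_nhds (x := (enE (sobWeight s) f).toReal)).div_atTop
      (tendsto_sobWeight hs)
    simpa using this.const_mul (2 * Real.pi)
  have h2 : Tendsto (fun n : ℕ => ‖f - proj n f‖ ^ 2) atTop (𝓝 0) :=
    squeeze_zero (fun _ => sq_nonneg _)
      (fun n => norm_sub_proj_sq_le hs.le (Nat.cast_nonneg n) hf) h1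
  rw [tendsto_iff_norm_sub_tendsto_zero]
  have h3 := h2.sqrt
  simp only [Real.sqrt_zero] at h3
  refine h3.congr fun n => ?_
  rw [Real.sqrt_sq (norm_nonneg _), norm_sub_rev]

theorem exists_local_solution {s : ℝ} (hs : 2 < s) {u₀ : L2R} (hu₀ : enE (sobWeight s) u₀ < ∞) :
    ∃ T : ℝ, 0 < T ∧ ∃ U : ℝ → L2R, U 0 = u₀ ∧ IsStrongSol s (Set.Icc 0 T) U := by
  have hs0 : (0 : ℝ) ≤ s := by linarith
  have hs1 : (1 : ℝ) < s := by linarith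
  set Y : ℝ := 1 + 2 * Real.pi * (enE (sobWeight s) u₀).toReal with hY
  have hY0 : 0 ≤ Y := by positivity
  set c : ℝ := 4 * 2 ^ (2 * s) * Real.sqrt (wienerConst (3 / 2) s).toReal * Real.sqrt Y with hc
  have hc0 : 0 ≤ c := by positivity
  -- Small enough for `galerkin_uniform_bound`, for all cut-offs at once; the 1 covers c = 0.
  set T : ℝ := 1 / (c + 1) with hT
  have hT0 : 0 < T := by positivity
  have hcT : c * T ≤ 1 := by
    rw [hT, mul_one_div, div_le_one (by linarith)]; linarith
  set B : ℝ := 4 * Y with hB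
  have hB0 : 0 ≤ B := by positivity
  have hu₀B : enE (sobWeight s) u₀ ≤ ENNReal.ofReal B := by
    rw [← ENNReal.ofReal_toReal hu₀.ne]
    apply ENNReal.ofReal_le_ofReal
    have := Real.two_le_pi
    have h1 : (0 : ℝ) ≤ (enE (sobWeight s) u₀).toReal := ENNReal.toReal_nonneg
    nlinarith
  choose u hu0 hu using fun n : ℕ =>
    exists_galerkin hs (Nat.cast_nonneg n) u₀ hT0.le
  have huB : ∀ n, ∀ t ∈ Set.Icc 0 T, enE (sobWeight s) (u n t) ≤ ENNReal.ofReal B := fun n =>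
    galerkin_uniform_bound hs (Nat.cast_nonneg n) le_rfl hu₀ hcT (hu0 n) (hu n)
  have huf : ∀ n, ∀ t ∈ Set.Icc 0 T, enE (sobWeight s) (u n t) < ∞ := fun n t ht =>
    (huB n t ht).trans_lt ENNReal.ofReal_lt_top
  set A : ℝ := Real.sqrt ((wienerConst (3 / 2) s).toReal * B) with hA
  set ε : ℕ → ℝ≥0∞ := fun m => ENNReal.ofReal (Real.exp (2 * (2 * 2 ^ (2 * s + 1) * A * T)))
    * enE (tailWeight s m) u₀ with hε
  have hεt : Tendsto ε atTop (𝓝 0) := by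
    have := ENNReal.Tendsto.const_mul (a := ENNReal.ofReal
      (Real.exp (2 * (2 * 2 ^ (2 * s + 1) * A * T)))) (tendsto_enE_tail hs0 hu₀)
      (Or.inr ENNReal.ofReal_ne_top)
    rwa [mul_zero] at this
  have htail : ∀ m n, ∀ t ∈ Set.Icc 0 T, enE (tailWeight s m) (u n t) ≤ ε m := fun m n =>
    galerkin_enE_le hs (Nat.cast_nonneg n) (by linarith) (isWeight_tailWeight hs0 m) (hu0 n)
      (hu n) (Real.sqrt_nonneg _) fun t ht => wn_le_sqrt hs hB0 (huB n t ht)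
  set η : ℕ → ℝ := fun M => (2 * Real.pi * (B / sobWeight s M)
        + 2 * Real.pi * ((bilinConst s).toReal * (B * B) / sobWeight (s - 1) M)) *
      Real.exp ((2 * Real.sqrt ((wienerConst (3 / 2) s).toReal * (4 * B)) + 1) * T) with hη
  have hηt : Tendsto η atTop (𝓝 0) := by
    have h1 := ((tendsto_const_nhds (x := B)).div_atTop
      (tendsto_sobWeight (s := s) (by linarith))).const_mul (2 * Real.pi)
    have h2 := ((tendsto_const_nhds (x := (bilinConst s).toReal * (B * B))).div_atTop
      (tendsto_sobWeight (s := s - 1) (by linarith))).const_mul (2 * Real.pi)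
    rw [mul_zero] at h1 h2
    have h3 := (h1.add h2).mul_const
      (Real.exp ((2 * Real.sqrt ((wienerConst (3 / 2) s).toReal * (4 * B)) + 1) * T))
    rw [add_zero, zero_mul] at h3
    exact h3
  have hdiff : ∀ M N, M ≤ N → ∀ t ∈ Set.Icc 0 T, ‖u N t - u M t‖ ≤ Real.sqrt (η M) := by
    intro M N hMN t ht
    apply Real.le_sqrt_of_sq_le
    exact galerkin_sub_le hs (Nat.cast_nonneg M) (by exact_mod_cast hMN) hu₀B hB0 (hu0 N) (hu0 M)
      (hu N) (hu M) (huB N) (huB M) t ht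
  have hηs : Tendsto (fun M => Real.sqrt (η M)) atTop (𝓝 0) := by
    have := hηt.sqrt
    rwa [Real.sqrt_zero] at this
  -- Stated for all real t, with the value 0 outside the interval, so that the choice yields a total
  -- function.
  have hlim : ∀ t, ∃ l, t ∈ Set.Icc 0 T → Tendsto (fun n => u n t) atTop (𝓝 l) := by
    intro t
    by_cases ht : t ∈ Set.Icc 0 T
    · have hcs : CauchySeq (fun n => u n t) := by
        refine cauchySeq_of_le_tendsto_0' (fun M => Real.sqrt (η M)) (fun M N hMN => ?_) hηs
        rw [dist_comm, dist_eq_norm]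
        exact hdiff M N hMN t ht
      obtain ⟨l, hl⟩ := cauchySeq_tendsto_of_complete hcs
      exact ⟨l, fun _ => hl⟩
    · exact ⟨0, fun h => absurd h ht⟩
  choose U hU using hlim
  have hunif : TendstoUniformlyOn u U atTop (Set.Icc 0 T) := by
    rw [Metric.tendstoUniformlyOn_iff]
    intro e he
    filter_upwards [hηs.eventually (gt_mem_nhds he)] with M hM t ht
    refine lt_of_le_of_lt ?_ hM
    rw [dist_eq_norm]
    refine le_of_tendsto ((hU t ht).sub_const (u M t)).norm ?_
    filter_upwards [eventually_ge_atTop M] with N hN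
    exact hdiff M N hN t ht
  have huc : ∀ n, ContinuousOn (u n) (Set.Icc 0 T) := fun n t ht =>
    (hu n t ht).2.continuousWithinAt
  have hUc : ContinuousOn U (Set.Icc 0 T) :=
    hunif.continuousOn (Frequently.of_forall huc)
  have hUf : ∀ t ∈ Set.Icc 0 T, enE (sobWeight s) (U t) < ∞ := fun t ht =>
    (enE_le_of_tendsto (isWeight_sobWeight hs0) (hU t ht)
      (Eventually.of_forall fun n => huB n t ht)).trans_lt ENNReal.ofReal_lt_top
  have hUtail : ∀ m, ∀ t ∈ Set.Icc 0 T, enE (tailWeight s m) (U t) ≤ ε m := fun m t ht =>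
    enE_le_of_tendsto (isWeight_tailWeight hs0 m) (hU t ht)
      (Eventually.of_forall fun n => htail m n t ht)
  have hUs : ∀ t ∈ Set.Icc 0 T,
      Tendsto (fun r => enE (sobWeight s) (U r - U t)) (𝓝[Set.Icc 0 T] t) (𝓝 0) := fun t ht =>
    tendsto_enE_of_tail hs0 hεt (hUc t ht) fun m => by
      filter_upwards [self_mem_nhdsWithin] with r hr using hUtail m r hr
  have hus : ∀ n, ∀ t ∈ Set.Icc 0 T,
      Tendsto (fun r => enE (sobWeight s) (u n r - u n t)) (𝓝[Set.Icc 0 T] t) (𝓝 0) :=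
    fun n t ht => tendsto_enE_of_tail hs0 hεt (huc n t ht) fun m => by
      filter_upwards [self_mem_nhdsWithin] with r hr using htail m n r hr
  have hnU : ∀ t ∈ Set.Icc 0 T,
      Tendsto (fun n => enE (sobWeight s) (u n t - U t)) atTop (𝓝 0) := fun t ht =>
    tendsto_enE_of_tail hs0 hεt (hU t ht) fun m => Eventually.of_forall fun n => htail m n t ht
  refine ⟨T, hT0, U, ?_, fun t ht => ⟨hUf t ht, hUs t ht, ?_⟩⟩
  · have h1 := hU 0 ⟨le_rfl, hT0.le⟩
    simp_rw [hu0] at h1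
    exact tendsto_nhds_unique h1 (tendsto_proj (by linarith) hu₀)
  · refine hasDerivWithinAt_of_tendsto (u := u) (v := fun n t => proj n (bil (u n t) (u n t)))
      (V := fun t => bil (U t) (U t))
      (K := Real.sqrt (2 * Real.pi * ((bilinConst s).toReal * (B * B))))
      (fun n t ht => (hu n t ht).2) ?_ ?_ hU ?_ ?_ t ht
    · exact fun n t ht => ((proj n).continuous.tendsto _).comp
        (tendsto_bil hs1 (huf n t ht) (hus n t ht))
    · intro n t ht
      refine (norm_proj_le _ _).trans (Real.le_sqrt_of_sq_le ?_)
      refine (norm_bil_sq_le hs1 (huf n t ht) (huf n t ht)).trans ?_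
      gcongr <;> exact ENNReal.toReal_le_of_le_ofReal hB0 (huB n t ht)
    · intro t ht
      have h1 := tendsto_bil hs1 (hUf t ht) (hnU t ht)
      have hb : enE (sobWeight (s - 1)) (bil (U t) (U t)) < ∞ :=
        (enE_bil_le hs1 (hUf t ht) (hUf t ht)).trans_lt (ENNReal.mul_lt_top
          (bilinConst_lt_top hs1) (ENNReal.mul_lt_top (hUf t ht) (hUf t ht)))
      have h2 := tendsto_proj (by linarith : 0 < s - 1) hb
      have h3 : Tendsto (fun n : ℕ => proj n (bil (u n t) (u n t) - bil (U t) (U t))) atTop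
          (𝓝 0) := by
        apply squeeze_zero_norm (fun n => norm_proj_le _ _)
        simpa using (h1.sub_const (bil (U t) (U t))).norm
      have h4 := h3.add h2
      rw [zero_add] at h4
      refine h4.congr fun n => ?_
      rw [map_sub]; abel
    · exact fun t ht => tendsto_bil hs1 (hUf t ht) (hUs t ht)

/-! ### Equivalence of the notions of solution -/

/-- The equation identifies the given time derivative with `bil (ψ t) (ψ t)`, and convergence of
difference quotients in H^{s-1} implies convergence in L². -/
lemma IsSolution.isStrongSol {s : ℝ} (hs : 1 < s) {I : Set ℝ} {ψ : ℝ → L2R}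
    (h : IsSolution s I ψ) : IsStrongSol s I ψ := by
  obtain ⟨hc, ψ', -, hd, heq⟩ := h
  intro t ht
  have hE := (memSob_iff s _).1 (hc t ht).1
  refine ⟨hE, tendsto_sobNorm_iff.1 (hc t ht).2, ?_⟩
  have e : ψ' t = bil (ψ t) (ψ t) := by
    apply eq_of_rep_ae_eq
    filter_upwards [heq t ht, hat_ae_eq_rep (ψ' t), rep_bil hs hE hE] with k h1 h2 h3
    rw [← h2, h3, eq_neg_of_add_eq_zero_left h1, bilinHat_eq]; ring
  rw [← e, hasDerivWithinAt_iff_tendsto_slope]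
  have h1 := tendsto_of_tendsto_enE (tendsto_sobNorm_iff.1 (hd t ht))
  exact h1.congr fun r => by simp [slope]

/-- An `L²` derivative that is continuous in `H^σ` is a derivative in `H^σ`. -/
lemma tendsto_enE_slope {σ : ℝ} (hσ : 0 ≤ σ) {I : Set ℝ} (hI : Convex ℝ I) {u v : ℝ → L2R}
    (hu : ∀ t ∈ I, HasDerivWithinAt u (v t) I t) {t : ℝ} (ht : t ∈ I)
    (hv : Tendsto (fun r => enE (sobWeight σ) (v r - v t)) (𝓝[I] t) (𝓝 0)) :
    Tendsto (fun r => enE (sobWeight σ) ((r - t)⁻¹ • (u r - u t) - v t)) (𝓝[I \ {t}] t)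
      (𝓝 0) := by
  rw [ENNReal.tendsto_nhds_zero]
  intro ε hε
  -- The minimum with 1 replaces a possibly infinite ε by a real number.
  set e : ℝ := (min ε 1).toReal with he
  have hmin : min ε 1 ≠ ∞ := ne_top_of_le_ne_top (by simp) (min_le_right _ _)
  have he0 : 0 ≤ e := ENNReal.toReal_nonneg
  have hev := (ENNReal.tendsto_nhds_zero.1 hv) (min ε 1) (lt_min hε one_pos)
  rw [eventually_nhdsWithin_iff, Metric.eventually_nhds_iff_ball] at hev
  obtain ⟨δ, hδ, hball⟩ := hev
  rw [eventually_nhdsWithin_iff]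
  filter_upwards [Metric.ball_mem_nhds t hδ] with r hr hrI
  obtain ⟨hrI, hrt⟩ := hrI
  have hrt' : r - t ≠ 0 := sub_ne_zero.2 hrt
  have hw := isWeight_sobWeight hσ
  refine le_trans (enE_le_of_trunc hw (K := ENNReal.ofReal e) fun n => ?_) (by
    rw [he, ENNReal.ofReal_toReal hmin]; exact min_le_left _ _)
  have hwt := hw.trunc (ρ := n) (Nat.cast_nonneg n)
  have hwC := hw.trunc_le_const (ρ := n) (Nat.cast_nonneg n)
  set M := sqrtMul (fun x => sobWeight σ (min |x| n)) with hM
  have hMb : ∀ x ∈ I ∩ Metric.ball t δ, ‖M (v x) - M (v t)‖ ≤ Real.sqrt (2 * Real.pi * e) := by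
    intro x hx
    have h1 := (enE_mono (hw.trunc_le (Nat.cast_nonneg n)) (v x - v t)).trans
      (hball x hx.2 hx.1)
    rw [enE_eq_norm_sqrtMul hwt hwC, ← ENNReal.ofReal_toReal hmin,
      ENNReal.ofReal_le_ofReal_iff he0, div_le_iff₀ Real.two_pi_pos, ← hM, map_sub] at h1
    apply Real.le_sqrt_of_sq_le
    linarith
  -- Mean value inequality for M(u r) - r M(v t), whose derivative is small near t. The bound does
  -- not depend on the truncation n.
  have hd : ∀ x ∈ I ∩ Metric.ball t δ, HasDerivWithinAt (fun r => M (u r) - r • M (v t))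
      (M (v x) - M (v t)) (I ∩ Metric.ball t δ) x := by
    intro x hx
    have h1 := M.hasFDerivAt.comp_hasDerivWithinAt x ((hu x hx.1).mono
      (Set.inter_subset_left : I ∩ Metric.ball t δ ⊆ I))
    have h2 := (hasDerivWithinAt_id x (I ∩ Metric.ball t δ)).smul_const (M (v t))
    rw [one_smul] at h2
    exact h1.sub h2
  have h := (hI.inter (convex_ball t δ)).norm_image_sub_le_of_norm_hasDerivWithin_le hd hMb
    ⟨ht, Metric.mem_ball_self hδ⟩ ⟨hrI, hr⟩
  have h2 : M ((r - t)⁻¹ • (u r - u t) - v t)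
      = (r - t)⁻¹ • (M (u r) - r • M (v t) - (M (u t) - t • M (v t))) := by
    rw [map_sub, map_smul, map_sub]
    have : M (u r) - r • M (v t) - (M (u t) - t • M (v t))
        = (M (u r) - M (u t)) - (r - t) • M (v t) := by rw [sub_smul]; abel
    rw [this, smul_sub (r - t)⁻¹ (M (u r) - M (u t)), smul_smul, inv_mul_cancel₀ hrt', one_smul]
  rw [enE_eq_norm_sqrtMul hwt hwC, ← hM, h2]
  apply ENNReal.ofReal_le_ofReal
  rw [div_le_iff₀ Real.two_pi_pos, norm_smul, norm_inv]
  have h3 : ‖r - t‖⁻¹ * ‖M (u r) - r • M (v t) - (M (u t) - t • M (v t))‖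
      ≤ Real.sqrt (2 * Real.pi * e) := by
    rw [inv_mul_le_iff₀ (norm_pos_iff.2 hrt'), mul_comm]
    exact h
  calc _ ≤ Real.sqrt (2 * Real.pi * e) ^ 2 := by gcongr
    _ = e * (2 * Real.pi) := by rw [Real.sq_sqrt (by positivity)]; ring

lemma IsStrongSol.isSolution {s : ℝ} (hs : 1 < s) {I : Set ℝ} (hI : Convex ℝ I) {ψ : ℝ → L2R}
    (h : IsStrongSol s I ψ) : IsSolution s I ψ := by
  refine ⟨fun t ht => ⟨(memSob_iff s _).2 (h t ht).1, tendsto_sobNorm_iff.2 (h t ht).2.1⟩,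
    fun t => bil (ψ t) (ψ t), fun t ht => ⟨?_, ?_⟩, fun t ht => ?_, fun t ht => ?_⟩
  · rw [memSob_iff]
    exact (enE_bil_le hs (h t ht).1 (h t ht).1).trans_lt (ENNReal.mul_lt_top
      (bilinConst_lt_top hs) (ENNReal.mul_lt_top (h t ht).1 (h t ht).1))
  · exact tendsto_sobNorm_iff.2 (tendsto_enE_bil hs (h t ht).1 (h t ht).2.1)
  · exact tendsto_sobNorm_iff.2 (tendsto_enE_slope (by linarith) hI (fun t ht => (h t ht).2.2) ht
      (tendsto_enE_bil hs (h t ht).1 (h t ht).2.1))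
  · filter_upwards [hat_ae_eq_rep (bil (ψ t) (ψ t)), rep_bil hs (h t ht).1 (h t ht).1]
      with k h1 h2
    rw [h1, h2, bilinHat_eq]; ring

/-! ### Interpolation -/

lemma lintegral_comp_div {F : ℝ → ℝ≥0∞} (hF : Measurable F) {R : ℝ} (hR : 0 < R) :
    ∫⁻ k, F (k / R) = ENNReal.ofReal R * ∫⁻ k, F k := by
  have h := Real.map_volume_mul_right (a := R⁻¹) (inv_ne_zero hR.ne')
  rw [inv_inv, abs_of_pos hR] at h
  rw [← smul_eq_mul, ← lintegral_smul_measure, ← h, lintegral_map hF (by fun_prop)]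
  rfl

/-- Cauchy–Schwarz with the Sobolev weight rescaled to frequency R; the substitution k = R x gives
R³ · R = R⁴. -/
lemma wiener_sq_le_scaled {σ R : ℝ} (hR : 0 < R) {g : ℝ → ℂ} (hg : Measurable g) :
    wiener (3 / 2) g ^ 2 ≤ ENNReal.ofReal (R ^ 4) * wienerConst (3 / 2) σ *
      (energy (fun _ => 1) g
        + ENNReal.ofReal ((R ^ (2 * σ))⁻¹) * energy (fun k => |k| ^ (2 * σ)) g) := by
  have h := wiener_sq_le_of_pos (r := 3 / 2) (m := fun k => sobWeight σ (k / R)) (by fun_prop)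
    (fun k => lt_of_lt_of_le one_pos (one_le_sobWeight σ _)) hg
  refine h.trans (le_of_eq ?_)
  congr 1
  · have e : ∀ k : ℝ, ENNReal.ofReal (|k| ^ (2 * (3 / 2) : ℝ) / sobWeight σ (k / R))
        = ENNReal.ofReal (R ^ 3) *
          (fun x => ENNReal.ofReal (|x| ^ (2 * (3 / 2) : ℝ) / sobWeight σ x)) (k / R) := by
      intro k
      simp only
      rw [← ENNReal.ofReal_mul (by positivity)]
      congr 1
      rw [show (2 * (3 / 2) : ℝ) = (3 : ℕ) by norm_num, Real.rpow_natCast, Real.rpow_natCast,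
        abs_div, abs_of_pos hR]
      field_simp
    simp_rw [e]
    rw [lintegral_const_mul' _ _ ENNReal.ofReal_ne_top, lintegral_comp_div
      (F := fun x => ENNReal.ofReal (|x| ^ (2 * (3 / 2) : ℝ) / sobWeight σ x)) (by fun_prop) hR,
      ← mul_assoc, ← ENNReal.ofReal_mul (by positivity), ← pow_succ]
    rfl
  · unfold energy
    rw [← lintegral_const_mul' _ _ ENNReal.ofReal_ne_top, ← lintegral_add_left (by fun_prop)]
    congr 1; funext k
    unfold sobWeight
    rw [ENNReal.ofReal_add (by positivity) (by positivity), add_mul, ← mul_assoc,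
      ← ENNReal.ofReal_mul (by positivity)]
    congr 3
    rw [abs_div, abs_of_pos hR, Real.div_rpow (abs_nonneg k) hR.le]
    field_simp

/-- The constant of the interpolation inequality. -/
def interpConst (σ : ℝ) (f : L2R) : ℝ≥0∞ :=
  (wienerConst (3 / 2) σ * (enE (fun _ => 1) f + 1)) ^ (1 / 2 : ℝ) + 1

lemma wiener_le_homNorm {σ : ℝ} (hσ : 2 < σ) (f : L2R) :
    wiener (3 / 2) (rep f) ≤ interpConst σ f * homNorm σ f ^ (2 / σ) := by
  have hpow : 0 < 2 / σ := by positivity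
  -- Ensured by the outer 1 in the constant; it makes the bound infinite when the homogeneous norm
  -- is.
  have hC0 : interpConst σ f ≠ 0 := by unfold interpConst; simp
  have hhom : homNorm σ f ^ 2 = energy (fun k => |k| ^ (2 * σ)) (rep f) := by
    rw [homNorm_eq, ← ENNReal.rpow_natCast, ← ENNReal.rpow_mul]
    norm_num
    rfl
  rcases eq_or_ne (homNorm σ f) ∞ with htop | htop
  · rw [htop, ENNReal.top_rpow_of_pos hpow, ENNReal.mul_top hC0]; exact le_top
  rcases eq_or_ne (homNorm σ f) 0 with hzero | hzero
  · rw [hzero, zero_pow two_ne_zero] at hhom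
    have h1 := (lintegral_eq_zero_iff (by fun_prop)).1 hhom.symm
    have h2 : wiener (3 / 2) (rep f) = 0 := by
      unfold wiener
      rw [lintegral_eq_zero_iff (by fun_prop)]
      filter_upwards [h1] with k hk
      simp only [Pi.zero_apply, mul_eq_zero, ENNReal.ofReal_eq_zero, pow_eq_zero_iff two_ne_zero]
        at hk ⊢
      rcases hk with hk | hk
      · left
        have hk0 : |k| = 0 := by
          by_contra hne
          have : 0 < |k| ^ (2 * σ) := Real.rpow_pos_of_pos
            (lt_of_le_of_ne (abs_nonneg k) (Ne.symm hne)) _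
          linarith
        rw [hk0, Real.zero_rpow (by norm_num)]
      · right
        simpa using hk
    rw [h2]; exact zero_le
  · set h := (homNorm σ f).toReal with hh
    have hpos : 0 < h := ENNReal.toReal_pos hzero htop
    have hh' : homNorm σ f = ENNReal.ofReal h := (ENNReal.ofReal_toReal htop).symm
    -- Scale at which R^{2σ} = h²: the homogeneous term becomes 1 and R⁴ = (h^{2/σ})², which is the
    -- exponent in the continuation criterion.
    set R := h ^ (1 / σ) with hR
    have hR0 : 0 < R := by positivity
    have h1 := wiener_sq_le_scaled (σ := σ) hR0 (measurable_rep f)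
    have e1 : R ^ (2 * σ) = h ^ 2 := by
      rw [hR, ← Real.rpow_mul hpos.le, ← Real.rpow_natCast]
      congr 1
      push_cast
      field_simp
    have e2 : R ^ 4 = (h ^ (2 / σ)) ^ 2 := by
      rw [hR, ← Real.rpow_natCast, ← Real.rpow_natCast, ← Real.rpow_mul hpos.le,
        ← Real.rpow_mul hpos.le]
      congr 1
      push_cast
      ring
    have e3 : ENNReal.ofReal ((R ^ (2 * σ))⁻¹) * energy (fun k => |k| ^ (2 * σ)) (rep f) = 1 := by
      rw [← hhom, hh', ← ENNReal.ofReal_pow hpos.le, ← ENNReal.ofReal_mul (by positivity), e1,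
        inv_mul_cancel₀ (by positivity), ENNReal.ofReal_one]
    rw [e3, e2, ENNReal.ofReal_pow (by positivity), ← ENNReal.ofReal_rpow_of_pos hpos, ← hh'] at h1
    have h2 : wiener (3 / 2) (rep f) ^ 2 ≤ (interpConst σ f * homNorm σ f ^ (2 / σ)) ^ 2 := by
      refine h1.trans ?_
      rw [mul_pow, mul_assoc, mul_comm]
      gcongr
      calc wienerConst (3 / 2) σ * (energy (fun _ => 1) (rep f) + 1)
          = ((wienerConst (3 / 2) σ * (enE (fun _ => 1) f + 1)) ^ (1 / 2 : ℝ)) ^ 2 := by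
            rw [← ENNReal.rpow_natCast, ← ENNReal.rpow_mul]
            norm_num
            rfl
        _ ≤ _ := by
            unfold interpConst
            gcongr
            exact le_self_add
    exact (ENNReal.pow_le_pow_left_iff two_ne_zero).1 h2

lemma interpConst_lt_top {σ : ℝ} (hσ : 2 < σ) (f : L2R) : interpConst σ f < ∞ := by
  unfold interpConst
  refine ENNReal.add_lt_top.2 ⟨ENNReal.rpow_lt_top_of_nonneg (by norm_num) ?_, by simp⟩
  exact (ENNReal.mul_lt_top (lintegral_rpow_div_sobWeight_lt_top (by norm_num) (by linarith))
    (ENNReal.add_lt_top.2 ⟨energy_one_rep_lt_top f, by simp⟩)).ne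

lemma interpConst_congr (σ : ℝ) {f g : L2R} (h : ‖f‖ ^ 2 = ‖g‖ ^ 2) :
    interpConst σ f = interpConst σ g := by
  unfold interpConst
  rw [enE_one, enE_one, h]

/-! ### Continuation -/

lemma IsStrongSol.mono {s : ℝ} {I J : Set ℝ} {u : ℝ → L2R} (h : IsStrongSol s I u) (hJ : J ⊆ I) :
    IsStrongSol s J u := fun t ht =>
  ⟨(h t (hJ ht)).1, (h t (hJ ht)).2.1.mono_left (nhdsWithin_mono t hJ), (h t (hJ ht)).2.2.mono hJ⟩

lemma IsStrongSol.congr {s : ℝ} {I : Set ℝ} {u v : ℝ → L2R} (h : IsStrongSol s I u)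
    (huv : ∀ t ∈ I, v t = u t) : IsStrongSol s I v := by
  intro t ht
  rw [huv t ht]
  refine ⟨(h t ht).1, (h t ht).2.1.congr' ?_, (h t ht).2.2.congr huv (huv t ht)⟩
  filter_upwards [self_mem_nhdsWithin] with r hr
  rw [huv r hr]

lemma IsStrongSol.comp_sub_const {s a b : ℝ} {u : ℝ → L2R} (h : IsStrongSol s (Set.Icc 0 b) u) :
    IsStrongSol s (Set.Icc a (a + b)) (fun t => u (t - a)) := by
  intro t ht
  have hmaps : Set.MapsTo (fun r => r - a) (Set.Icc a (a + b)) (Set.Icc 0 b) := fun r hr =>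
    ⟨by linarith [hr.1], by linarith [hr.2]⟩
  obtain ⟨h1, h2, h3⟩ := h (t - a) (hmaps ht)
  have hd : HasDerivWithinAt (fun r : ℝ => r - a) 1 (Set.Icc a (a + b)) t :=
    (hasDerivWithinAt_id t _).sub_const a
  refine ⟨h1, h2.comp ?_, ?_⟩
  · exact hd.continuousWithinAt.tendsto_nhdsWithin hmaps
  · have := h3.scomp t hd hmaps
    rwa [one_smul] at this

/-- Off a closed set the neighbourhood filter within it is trivial, so conditions within A and
within B can be joined at every point of the union, in particular at a junction. -/
lemma IsStrongSol.union {s : ℝ} {A B : Set ℝ} (hA : IsClosed A) (hB : IsClosed B) {u : ℝ → L2R}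
    (h1 : IsStrongSol s A u) (h2 : IsStrongSol s B u) : IsStrongSol s (A ∪ B) u := by
  have key : ∀ {A : Set ℝ}, IsClosed A → IsStrongSol s A u → ∀ t,
      Tendsto (fun r => enE (sobWeight s) (u r - u t)) (𝓝[A] t) (𝓝 0) ∧
        HasDerivWithinAt u (bil (u t) (u t)) A t := by
    intro A hA h t
    by_cases ht : t ∈ A
    · exact (h t ht).2
    · have htc : t ∉ closure A := by rwa [hA.closure_eq]
      refine ⟨?_, HasFDerivWithinAt.of_notMem_closure htc⟩
      rw [notMem_closure_iff_nhdsWithin_eq_bot.1 htc]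
      exact tendsto_bot
  intro t ht
  refine ⟨ht.elim (fun h => (h1 t h).1) (fun h => (h2 t h).1), ?_,
    (key hA h1 t).2.union (key hB h2 t).2⟩
  rw [nhdsWithin_union]
  exact (key hA h1 t).1.sup (key hB h2 t).1

lemma IsStrongSol.continuousOn_wn {s : ℝ} (hs : 2 < s) {I : Set ℝ} {u : ℝ → L2R}
    (h : IsStrongSol s I u) : ContinuousOn (fun t => wn (u t)) I := by
  intro t ht
  have h0 : Tendsto (fun r => wn (u r - u t)) (𝓝[I] t) (𝓝 0) := by
    have h1 := ((ENNReal.tendsto_toReal ENNReal.zero_ne_top).comp (h t ht).2.1).const_mul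
      (wienerConst (3 / 2) s).toReal
    have h2 := h1.sqrt
    simp only [ENNReal.toReal_zero, mul_zero, Real.sqrt_zero] at h2
    refine tendsto_of_tendsto_of_tendsto_of_le_of_le' tendsto_const_nhds h2
      (Eventually.of_forall fun r => wn_nonneg _) ?_
    filter_upwards [self_mem_nhdsWithin] with r hr
    exact Real.le_sqrt_of_sq_le (wn_sq_le hs (enE_sub_lt_top (h r hr).1 (h t ht).1))
  rw [ContinuousWithinAt, tendsto_iff_dist_tendsto_zero]
  refine tendsto_of_tendsto_of_tendsto_of_le_of_le' tendsto_const_nhds h0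
    (Eventually.of_forall fun r => dist_nonneg) ?_
  filter_upwards [self_mem_nhdsWithin] with r hr
  exact wn_sub_le hs (h r hr).1 (h t ht).1

/-- Weighted energies grow at most by the exponential of the accumulated Wiener norm. -/
lemma IsStrongSol.enE_le {s T p J : ℝ} {w : ℝ → ℝ} (hs : 2 < s) {u : ℝ → L2R}
    (h : IsStrongSol s (Set.Ico 0 T) u) (hJ : ∀ t ∈ Set.Ico 0 T, ∫ τ in 0..t, wn (u τ) ≤ J)
    (hp : 1 ≤ p) (hw : IsWeight p w) :
    ∀ t ∈ Set.Ico 0 T,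
      enE w (u t) ≤ ENNReal.ofReal (Real.exp (2 * (2 * 2 ^ p * J))) * enE w (u 0) := by
  intro t ht
  have hI : IsStrongSol s (Set.Icc 0 t) u := h.mono fun x hx => ⟨hx.1, hx.2.trans_lt ht.2⟩
  apply enE_le_of_trunc hw
  intro n
  have hwt := hw.trunc (ρ := n) (Nat.cast_nonneg n)
  have hwC := hw.trunc_le_const (ρ := n) (Nat.cast_nonneg n)
  have h1 := enE_le_exp_mul hwt hwC (u := u) (u' := fun t => bil (u t) (u t))
    (α := fun t => 2 * 2 ^ p * wn (u t))
    (continuousOn_const.mul (hI.continuousOn_wn hs)) (fun x hx => (hI x hx).2.2)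
    (fun x hx => by
      rw [mul_assoc]
      exact abs_inner_sqrtMul_bil_le hp hwt hwC hs (hI x hx).1) t ⟨ht.1, le_rfl⟩
  refine h1.trans ?_
  rw [intervalIntegral.integral_const_mul]
  gcongr
  · exact hJ t ht
  · exact enE_mono (hw.trunc_le (Nat.cast_nonneg n)) _

lemma IsStrongSol.norm_sq_eq {s T : ℝ} (hs : 2 < s) {u : ℝ → L2R}
    (h : IsStrongSol s (Set.Ico 0 T) u) : ∀ t ∈ Set.Ico 0 T, ‖u t‖ ^ 2 = ‖u 0‖ ^ 2 := by
  intro t ht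
  have hI : IsStrongSol s (Set.Icc 0 t) u := h.mono fun x hx => ⟨hx.1, hx.2.trans_lt ht.2⟩
  exact norm_sq_const_of_inner_eq_zero (fun x hx => (hI x hx).2.2)
    (fun x hx => inner_bil_self hs (hI x hx).1) t ⟨ht.1, le_rfl⟩

/-- Conservation of the L² norm freezes the interpolation constant at its initial value, so the
integrability hypothesis passes to the Wiener norm. -/
lemma IsStrongSol.integral_wn_le {s σ T : ℝ} (hs : 2 < s) (hσ : 2 < σ) {u : ℝ → L2R}
    (h : IsStrongSol s (Set.Ico 0 T) u)
    (hint : ∫⁻ τ in Set.Ioo 0 T, homNorm σ (u τ) ^ (2 / σ) < ∞) :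
    ∃ J, ∀ t ∈ Set.Ico 0 T, ∫ τ in 0..t, wn (u τ) ≤ J := by
  have hfin : ∫⁻ τ in Set.Ioo 0 T, ENNReal.ofReal (wn (u τ)) < ∞ := by
    refine lt_of_le_of_lt (setLIntegral_mono' measurableSet_Ioo (g := fun τ =>
      interpConst σ (u 0) * homNorm σ (u τ) ^ (2 / σ)) fun τ hτ => ?_) ?_
    · refine ENNReal.ofReal_toReal_le.trans ?_
      rw [← interpConst_congr σ (h.norm_sq_eq hs τ ⟨hτ.1.le, hτ.2⟩)]
      exact wiener_le_homNorm hσ _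
    · rw [lintegral_const_mul' _ _ (interpConst_lt_top hσ _).ne]
      exact ENNReal.mul_lt_top (interpConst_lt_top hσ _) hint
  refine ⟨(∫⁻ τ in Set.Ioo 0 T, ENNReal.ofReal (wn (u τ))).toReal, fun t ht => ?_⟩
  have hc : ContinuousOn (fun τ => wn (u τ)) (Set.Icc 0 t) :=
    (h.continuousOn_wn hs).mono fun x hx => ⟨hx.1, hx.2.trans_lt ht.2⟩
  rw [intervalIntegral.integral_of_le ht.1, integral_eq_lintegral_of_nonneg_ae
    (Eventually.of_forall fun τ => wn_nonneg _)
    ((hc.mono Set.Ioc_subset_Icc_self).aestronglyMeasurable measurableSet_Ioc)]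
  exact ENNReal.toReal_mono hfin.ne (lintegral_mono_set fun x hx => ⟨hx.1, hx.2.trans_lt ht.2⟩)

/-- A solution whose Wiener norm is integrable up to time `T` extends to the closed interval. -/
lemma IsStrongSol.exists_extension {s T J : ℝ} (hs : 2 < s) (hT : 0 < T) {u : ℝ → L2R}
    (h : IsStrongSol s (Set.Ico 0 T) u) (hJ : ∀ t ∈ Set.Ico 0 T, ∫ τ in 0..t, wn (u τ) ≤ J) :
    ∃ U, IsStrongSol s (Set.Icc 0 T) U ∧ ∀ t ∈ Set.Ico 0 T, U t = u t := by
  have hs0 : (0 : ℝ) ≤ s := by linarith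
  have hs1 : (1 : ℝ) < s := by linarith
  have h0 : (0 : ℝ) ∈ Set.Ico 0 T := ⟨le_rfl, hT⟩
  obtain ⟨B, hB0, hB⟩ : ∃ B : ℝ, 0 ≤ B ∧
      ∀ t ∈ Set.Ico 0 T, enE (sobWeight s) (u t) ≤ ENNReal.ofReal B := by
    have hf := ENNReal.mul_lt_top (ENNReal.ofReal_lt_top
      (r := Real.exp (2 * (2 * 2 ^ (2 * s) * J)))) (h 0 h0).1
    refine ⟨(ENNReal.ofReal (Real.exp (2 * (2 * 2 ^ (2 * s) * J)))
      * enE (sobWeight s) (u 0)).toReal, ENNReal.toReal_nonneg, fun t ht => ?_⟩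
    rw [ENNReal.ofReal_toReal hf.ne]
    exact h.enE_le hs hJ (by linarith) (isWeight_sobWeight hs0) t ht
  set ε : ℕ → ℝ≥0∞ := fun m => ENNReal.ofReal (Real.exp (2 * (2 * 2 ^ (2 * s + 1) * J)))
    * enE (tailWeight s m) (u 0) with hε
  have hεt : Tendsto ε atTop (𝓝 0) := by
    have := ENNReal.Tendsto.const_mul (a := ENNReal.ofReal
      (Real.exp (2 * (2 * 2 ^ (2 * s + 1) * J)))) (tendsto_enE_tail hs0 (h 0 h0).1)
      (Or.inr ENNReal.ofReal_ne_top)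
    rwa [mul_zero] at this
  have htail : ∀ m, ∀ t ∈ Set.Ico 0 T, enE (tailWeight s m) (u t) ≤ ε m := fun m =>
    h.enE_le hs hJ (by linarith) (isWeight_tailWeight hs0 m)
  set K : ℝ := Real.sqrt (2 * Real.pi * ((bilinConst s).toReal * (B * B))) with hK
  have hbil : ∀ t ∈ Set.Ico 0 T, ‖bil (u t) (u t)‖ ≤ K := by
    intro t ht
    apply Real.le_sqrt_of_sq_le
    refine (norm_bil_sq_le hs1 (h t ht).1 (h t ht).1).trans ?_
    gcongr <;> exact ENNReal.toReal_le_of_le_ofReal hB0 (hB t ht)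
  -- The H^s bound controls the time derivative in L²; the resulting Lipschitz continuity gives the
  -- limit at T.
  have hlip : ∀ x ∈ Set.Ico 0 T, ∀ y ∈ Set.Ico 0 T, ‖u y - u x‖ ≤ K * ‖y - x‖ :=
    fun x hx y hy => (convex_Ico 0 T).norm_image_sub_le_of_norm_hasDerivWithin_le
      (fun x hx => (h x hx).2.2) hbil hx hy
  have hlipo : LipschitzOnWith K.toNNReal u (Set.Ico 0 T) := by
    apply LipschitzOnWith.of_dist_le_mul
    intro x hx y hy
    rw [dist_eq_norm, dist_eq_norm, Real.coe_toNNReal _ (Real.sqrt_nonneg _)]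
    exact hlip y hy x hx
  have : (𝓝[Set.Ico 0 T] T).NeBot := by
    rw [← mem_closure_iff_nhdsWithin_neBot, closure_Ico hT.ne]
    exact ⟨hT.le, le_rfl⟩
  obtain ⟨uT, huT⟩ : ∃ uT, Tendsto u (𝓝[Set.Ico 0 T] T) (𝓝 uT) := by
    apply cauchy_map_iff_exists_tendsto.1
    have hc : Cauchy (𝓝[Set.Ico 0 T] T) := cauchy_nhds.mono nhdsWithin_le_nhds
    exact hc.map_of_le hlipo.uniformContinuousOn inf_le_right
  have hEq : Set.Ico 0 T ∈ 𝓝[Set.Ico 0 T] T := self_mem_nhdsWithin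
  have hEs : Tendsto (fun r => enE (sobWeight s) (u r - uT)) (𝓝[Set.Ico 0 T] T) (𝓝 0) :=
    tendsto_enE_of_tail hs0 hεt huT fun m => by
      filter_upwards [hEq] with r hr using htail m r hr
  have hEf : enE (sobWeight s) uT < ∞ :=
    (enE_le_of_tendsto (isWeight_sobWeight hs0) huT (by
      filter_upwards [hEq] with r hr using hB r hr)).trans_lt ENNReal.ofReal_lt_top
  set U : ℝ → L2R := fun t => if t < T then u t else uT with hU
  have hUu : ∀ t ∈ Set.Ico 0 T, U t = u t := fun t ht => if_pos ht.2
  have hUT : U T = uT := if_neg (lt_irrefl T)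
  have hEU : ∀ᶠ r in 𝓝[Set.Ico 0 T] T, U r = u r := by
    filter_upwards [hEq] with r hr using hUu r hr
  have hins : Set.Icc 0 T = insert T (Set.Ico 0 T) := (Set.Ico_insert_right hT.le).symm
  have hUs := h.congr hUu
  refine ⟨U, fun t ht => ?_, hUu⟩
  rcases eq_or_lt_of_le ht.2 with rfl | hlt
  · refine ⟨by rwa [hUT], ?_, ?_⟩
    · rw [hins, nhdsWithin_insert, tendsto_sup, tendsto_pure_left]
      refine ⟨fun S hS => ?_, ?_⟩
      · have e : enE (sobWeight s) (U t - U t) = 0 := by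
          simpa using enE_smul (sobWeight s) 0 (U t)
        rw [e]; exact mem_of_mem_nhds hS
      · rw [hUT]
        refine hEs.congr' ?_
        filter_upwards [hEU] with r hr
        rw [hr]
    · have hcont : ContinuousWithinAt U (Set.Ioo 0 t) t := by
        rw [ContinuousWithinAt, hUT]
        refine (huT.congr' ?_).mono_left (nhdsWithin_mono _ Set.Ioo_subset_Ico_self)
        filter_upwards [hEU] with r hr using hr.symm
      have hda : ∀ r ∈ Set.Ioo 0 t, HasDerivAt U (bil (u r) (u r)) r := fun r hr => by
        have := (hUs r (Set.Ioo_subset_Ico_self hr)).2.2.hasDerivAt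
          (Ico_mem_nhds hr.1 hr.2)
        rwa [hUu r (Set.Ioo_subset_Ico_self hr)] at this
      -- At the endpoint: a continuous function whose derivative has a one-sided limit is
      -- differentiable there with that value. The limit exists by continuity of the nonlinearity
      -- along H^s convergence.
      refine (hasDerivWithinAt_Iic_of_tendsto_deriv (s := Set.Ioo 0 t)
        (fun r hr => (hda r hr).differentiableAt.differentiableWithinAt) hcont
        (Ioo_mem_nhdsLT hT) ?_).mono Set.Icc_subset_Iic_self
      rw [hUT]
      have hle : 𝓝[<] t ≤ 𝓝[Set.Ico 0 t] t := by
        rw [← nhdsWithin_Ioo_eq_nhdsLT hT]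
        exact nhdsWithin_mono _ Set.Ioo_subset_Ico_self
      refine ((tendsto_bil hs1 hEf hEs).mono_left hle).congr' ?_
      filter_upwards [Ioo_mem_nhdsLT hT] with r hr
      rw [(hda r hr).deriv]
  · have hmem : Set.Ico 0 T ∈ 𝓝[Set.Icc 0 T] t := by
      filter_upwards [self_mem_nhdsWithin, mem_nhdsWithin_of_mem_nhds (Iio_mem_nhds hlt)]
        with r hr hr' using ⟨hr.1, hr'⟩
    obtain ⟨h1, h2, h3⟩ := hUs t ⟨ht.1, hlt⟩
    exact ⟨h1, h2.mono_left (nhdsWithin_le_of_mem hmem), h3.mono_of_mem_nhdsWithin hmem⟩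

/-- The local solution started from U T is shifted to time T; the two pieces live on closed
intervals and agree at T, so they glue. -/
lemma IsStrongSol.exists_continuation {s T : ℝ} (hs : 2 < s) (hT : 0 < T) {U : ℝ → L2R}
    (h : IsStrongSol s (Set.Icc 0 T) U) :
    ∃ T', T < T' ∧ ∃ Ψ, IsStrongSol s (Set.Icc 0 T') Ψ ∧ ∀ t ∈ Set.Icc 0 T, Ψ t = U t := by
  obtain ⟨δ, hδ, φ, hφ0, hφ⟩ := exists_local_solution hs (h T ⟨hT.le, le_rfl⟩).1
  set Ψ : ℝ → L2R := fun t => if t ≤ T then U t else φ (t - T) with hΨ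
  have hl : ∀ t ∈ Set.Icc 0 T, Ψ t = U t := fun t ht => if_pos ht.2
  have hr : ∀ t ∈ Set.Icc T (T + δ), Ψ t = φ (t - T) := by
    intro t ht
    rcases eq_or_lt_of_le ht.1 with rfl | hlt
    · rw [hl T ⟨hT.le, le_rfl⟩, sub_self, hφ0]
    · exact if_neg hlt.not_ge
  refine ⟨T + δ, by linarith, Ψ, ?_, hl⟩
  have := (h.congr hl).union isClosed_Icc isClosed_Icc (hφ.comp_sub_const.congr hr)
  rwa [Set.Icc_union_Icc_eq_Icc hT.le (by linarith)] at this

end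

end SurfaceWave

/-! ### The continuation criterion -/

theorem lemma6p2 (s s' T : ℝ) (hs : 2 < s) (hs' : 2 < s') (hT : 0 < T)
    (ψ : ℝ → SurfaceWave.L2R)
    (hψ : SurfaceWave.IsSolution s (Set.Ico 0 T) ψ)
    (hint : ∫⁻ τ in Set.Ioo 0 T, SurfaceWave.homNorm s' (ψ τ) ^ (2 / s') < ∞) :
    ∃ T' : ℝ, T < T' ∧ ∃ Ψ : ℝ → SurfaceWave.L2R,
      SurfaceWave.IsSolution s (Set.Ico 0 T') Ψ ∧ ∀ t ∈ Set.Ico 0 T, Ψ t = ψ t := by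
  have hstrong := hψ.isStrongSol (by linarith)
  obtain ⟨J, hJ⟩ := hstrong.integral_wn_le hs hs' hint
  obtain ⟨U, hU, hUψ⟩ := hstrong.exists_extension hs hT hJ
  obtain ⟨T', hT', Ψ, hΨ, hΨU⟩ := hU.exists_continuation hs hT
  refine ⟨T', hT', Ψ, (hΨ.mono Set.Ico_subset_Icc_self).isSolution (by linarith)
    (convex_Ico 0 T'), fun t ht => ?_⟩
  rw [hΨU t (Set.Ico_subset_Icc_self ht), hUψ t ht]
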